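/- **Setting.** Fix a first-order signature with function symbols only (equality $\approx$ is the only predicate) and an infinite set of variables. A *literal* is an equation $s\approx t$ or an inequation $s\not\approx t$, with unordered sides; $s\,\#\,t$ denotes either; $\mathrm{comp}$ is the complement. A *clause* is a finite multiset of literals, read as a disjunction, and $N$ is a set of clauses. A *closure* $C\cdot\sigma$ is a clause with a substitution $\sigma$ such that $C\sigma$ is ground. Clauses are considered up to renaming of variables whenever variable disjointness is required. All mgus are idempotent and introduce no fresh variables. Let $\prec_T$ be a *desired* term ordering: a well-founded rewrite ordering (irreflexive, transitive, closed under contexts and substitutions), total on ground terms, with only finitely many ground terms below each ground term. It is extended to literals by the multiset extension, with $s\approx t\mapsto\{s,t\}$ and $s\not\approx t\mapsto\{s,s,t,t\}$, and to clauses by the multiset extension again; a term $\beta$ is compared with literals as $\{\beta\}$ and with clauses as $\{\{\beta\}\}$. **Trails.** A trail $\Gamma$ is a sequence of annotated ground literals $L\sigma^{k:(L\vee C)\cdot\sigma}$, with level $k$. Let $\mathrm{conv}(\Gamma)$ be a convergent ground rewrite system for the positive equations of $\Gamma$, oriented by $\prec_T$ (normal forms do not depend on the choice; take all ground $l\to r$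 with $r\prec_T l$ such that $l\approx r$ follows from the positive equations of $\Gamma$). A term is irreducible if no rule applies, and a substitution is irreducible if all terms of its codomain are. A ground literal $L$ is true (false) in $\Gamma$ if $\Gamma\models L$ ($\Gamma\models\mathrm{comp}(L)$), defined if it is true or false, and undefined otherwise. It is $\beta$-true ($\beta$-false) if moreover $L\prec_T\beta$; it is $\beta$-undefined if $\beta\prec_T L$ or $L$ is undefined, and $\beta$-defined otherwise. A ground clause is $\beta$-true if some literal of it is $\beta$-true, $\beta$-false if all are $\beta$-false, and $\beta$-undefined otherwise. A *core* of a defined $L$ is a minimal subsequence of $\Gamma$ in which $L$ is defined. The *defining literal* of $L$ is the last literal of a nonempty core whose last literal is earliest possible; if the only core is empty there is none. The *level* of $L\in\Gamma$ is its annotated level; that of a defined $L\notin\Gamma$ is the level of its defining literal, and $0$ if there is none. The level of a clause is the maximum level of its literals ($0$ for the empty clause). A trail literal is a *decision literal* if its level is one more than that of the preceding trail literal (counted as $0$ if there is none). **Trail ordering.** For $\Gamma=[L_1,\dots,L_n]$, let $\prec_{\Gamma^*}$ be the following ordering on ground literals. First come the $\beta$-defined literals of level $0$, ordered by $\prec_T$.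 Then come the $\beta$-defined literals of level $>0$, ordered first by the index $i$ of their defining literal $L_i$, and for the same $i$: first $L_i$, then $\mathrm{comp}(L_i)$, then all others, ordered by $\prec_T$. Last come the $\beta$-undefined literals, ordered by $\prec_T$. It is extended to clauses as a multiset extension. **Rewrite steps.** A rewrite step consists of a closure $(s\,\#\,t\vee C)\cdot\sigma$ with distinguished literal $s\,\#\,t$ and, unless it is initial, two parent steps and a position. From variable disjoint steps $I_1$ with $(l_1\approx r_1\vee C_1)\cdot\sigma_1$ and $I_2$ with $(l_2\,\#\,r_2\vee C_2)\cdot\sigma_2$ such that $r_1\sigma_1\prec_T l_1\sigma_1$ and $(l_2\,\#\,r_2)\sigma_2|_p=l_1\sigma_1$, a *rewrite inference* produces $\bigl((l_2\,\#\,r_2)\delta[r_1]_p\mu\vee C_1\mu\vee C_2\delta\mu\bigr)\cdot\sigma_1\sigma_2\rho$ with distinguished literal $(l_2\,\#\,r_2)\delta[r_1]_p\mu$, where $\mu=\mathrm{mgu}((l_2\,\#\,r_2)\delta|_p,l_1)$. If $p$ is a position of $l_2\,\#\,r_2$, then $\delta$ and $\rho$ are trivial. Otherwise $\delta$ introduces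 only fresh variables and $(l_2\,\#\,r_2)\delta$ is the most general instance of $l_2\,\#\,r_2$ that has the position $p$ and has $(l_2\,\#\,r_2)\sigma_2$ as an instance; $\rho$ instantiates the fresh variables such that $x\delta\sigma_2\rho=x\sigma_2$ for all variables $x$ of $I_2$. A *reduction chain* from $\Gamma$ is a finite sequence of rewrite steps each of which is a variable-renamed copy of an annotation in $\Gamma$ (its distinguished literal being the one on the trail), or the result of a rewrite inference from earlier members. A *reduction chain application* from $\Gamma$ to $(l\,\#\,r)\delta^{o:(l\,\#\,r\vee C)\cdot\delta}$ is a reduction chain from $\Gamma$ extended by this annotated literal whose last distinguished ground literal is the $\mathrm{conv}(\Gamma)$-normal form of $(l\,\#\,r)\delta$, and which loses this property if any step is removed. A *refutation* from $\Gamma$ and an annotated ground literal that is $\beta$-false in $\Gamma$ is a reduction chain from $\Gamma$ extended by it whose last distinguished ground literal has the form $s\not\approx s$, and which loses this property if any step other than the last is removed. **Calculus.** States are tuples $(\Gamma;N;U;\beta;k;D)$, where $U$ is a set of learned clauses, $\beta$ is a ground term, $k\in\mathbb N$, and $D$ is $\top$, $\bot$ or a closure. The initial state is $(\epsilon;N;\emptyset;\beta;0;\top)$.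 In a state with $D=\top$: * *Propagate*: let $C_0\vee C_1\vee L\in N\cup U$, with grounding $\sigma$ irreducible by $\mathrm{conv}(\Gamma)$, such that all literals of $C_0\sigma$ are false in $\Gamma$, all literals of $C_1\sigma$ equal $L\sigma$, $\mu$ is the mgu of $L$ and the literals of $C_1$, $L\sigma$ is $\beta$-undefined, and $(C_0\vee L)\mu\sigma\prec_T\beta$. Let $(s_m\,\#\,t_m\vee C_m)\cdot\sigma_m$ be the last closure of a reduction chain application from $\Gamma$ to $L\sigma^{k:(L\vee C_0)\mu\cdot\sigma}$. Append $(s_m\,\#\,t_m)\sigma_m^{\,k:(s_m\# t_m\vee C_m)\cdot\sigma_m}$ to $\Gamma$. * *Decide*: let $C_0\vee L\in N\cup U$, with grounding $\sigma$ irreducible by $\mathrm{conv}(\Gamma)$, such that $C_0\sigma$ is $\beta$-undefined or $\beta$-true, $L\sigma$ is $\beta$-undefined, and $(C_0\vee L)\sigma\prec_T\beta$. Let $(s_m\,\#\,t_m\vee C_m)\cdot\sigma_m$ be the last closure of a reduction chain application from $\Gamma$ to $L\sigma^{k+1:(L\vee C_0)\cdot\sigma}$. Append $(s_m\,\#\,t_m)\sigma_m^{\,k+1:(s_m\#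 t_m\vee\mathrm{comp}(s_m\# t_m))\cdot\sigma_m}$ to $\Gamma$ and set the level to $k+1$. * *Conflict*: if $D'\in N\cup U$ and $\sigma$ is grounding for $D'$ and irreducible by $\mathrm{conv}(\Gamma)$ and $D'\sigma$ is $\beta$-false in $\Gamma$, replace $\top$ by $\bot$ if $D'\sigma$ is of level $0$, and by $D'\cdot\sigma$ otherwise. * *Grow*: change to $(\epsilon;N;U;\beta';0;\top)$ for some ground $\beta'$ with $\beta\prec_T\beta'$. In a state with a closure as last component: * *Skip*: if $\Gamma=\Gamma',K,L$, the closure is $D\cdot\sigma$ and $D\sigma$ is $\beta$-false in $\Gamma',K$, remove $L$ and set the level to that of $K$. * *Explore-Refutation*: if the closure is $(D\vee s\,\#\,t)\cdot\sigma$, $(s\,\#\,t)\sigma$ is strictly $\prec_{\Gamma^*}$-maximal in $(D\vee s\,\#\,t)\sigma$ and its defining literal is the last literal of $\Gamma$, replace the closure by the closure $C'\cdot\sigma'$ of any step of a refutation from $\Gamma$ and $(s\,\#\,t)\sigma^{k:(s\# t\vee D)\cdot\sigma}$ such that $C'\sigma'\prec_{\Gamma^*}(D\vee s\,\#\,t)\sigma$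 and $C'\sigma'$ is $\beta$-false in $\Gamma$. * *Factorize*: replace $(D\vee L\vee L')\cdot\sigma$ by $(D\vee L)\mu\cdot\sigma$ if $L\sigma=L'\sigma$ and $\mu=\mathrm{mgu}(L,L')$. * *Equality-Resolution*: replace $(D\vee s\not\approx s')\cdot\sigma$ by $D\mu\cdot\sigma$ if $s\sigma=s'\sigma$ and $\mu=\mathrm{mgu}(s,s')$. * *Backtrack*: if the closure is $(D\vee L)\cdot\sigma$, $D\sigma$ is of level $<k$, $\Gamma=\Gamma_1,K,\Gamma_2$, and $\Gamma_1,K$ is the shortest prefix of $\Gamma$ in which some ground instance of $D\vee L$ is $\beta$-false, change to $(\Gamma_1;N;U\cup\{D\vee L\};\beta;j-i;\top)$, where $j$ is the level of $K$ and $i=1$ if $K$ is a decision literal, $i=0$ otherwise. (Whenever literals are unified, their sides are matched as in the common ground instance under $\sigma$.) A *run* is a finite or infinite sequence of rule applications starting from the initial state. It is *regular* if 1. Conflict and Factorize have precedence over all other rules; 2. if $k=0$, Propagate has precedence over Decide; 3. if an annotated literal $L^{k:C\cdot\sigma}$ with $C\in N\cup U$ could be added by Propagate, then Decide does not add $\mathrm{comp}(L)$;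 4. between an application of Conflict and the next Backtrack, Skip is applied at least once, unless Conflict was applied immediately after Decide; 5. if Conflict was applied immediately after Decide, then the next Backtrack is applied only in a state whose trail ends in a literal $L'$ and whose closure $D\cdot\sigma$ satisfies $L\sigma=\mathrm{comp}(L')$ for some $L\in D$. A state is *stuck* if its last component is not $\bot$ and no rule except possibly Grow is applicable to it. **Corollary (Satisfiable Clause Sets).** Let $\prec_T$ be a desired term ordering, $N$ a satisfiable set of clauses and $\beta$ a ground term. Then every regular run without rule Grow from $(\epsilon;N;\emptyset;\beta;0;\top)$ ends in a stuck state: there is no infinite regular run without Grow, and every finite one that cannot be continued to a longer regular run without Grow has a stuck state as its last state. -/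

import Mathlib

universe u v w

namespace SCLEQ

/-! ### Terms, substitutions, positions -/

section Calculus

variable {L : FirstOrder.Language.{u, v}} {V : Type w}

open Classical in
/-- The variables of a term. -/
noncomputable def tvars (t : L.Term V) : Finset V := t.varFinset

/-- A term is ground if it contains no variable. -/
def IsGroundTerm (t : L.Term V) : Prop := tvars t = ∅

/-- Substitutions are total mappings from variables to terms; `t.subst σ` is the term `tσ`. -/
abbrev Subst (L : FirstOrder.Language.{u, v}) (V : Type w) := V → L.Term V

/-- The subterm of `t` at a position, if the position exists in `t`. Arguments are numbered
from `0`. -/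
def subtermAt : L.Term V → List ℕ → Option (L.Term V)
  | t, [] => some t
  | .var _, _ :: _ => none
  | .func (l := n) _ ts, i :: p => if h : i < n then subtermAt (ts ⟨i, h⟩) p else none

/-- `replaceAt t p s` is `t[s]_p` (and `t` itself if `p` is not a position of `t`). -/
def replaceAt : L.Term V → List ℕ → L.Term V → L.Term V
  | _, [], s => s
  | .var x, _ :: _, _ => .var x
  | .func f ts, i :: p, s => .func f fun j => if j.val = i then replaceAt (ts j) p s else ts j

/-- `p` is a position of `t`. -/
def IsPos (t : L.Term V) (p : List ℕ) : Prop := (subtermAt t p).isSome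

/-! ### Literals and clauses -/

/-- An equational literal: `s ≈ t` if `sign = true` and `s ≉ t` if `sign = false`. The two sides
form an unordered pair, so that `s ≈ t` and `t ≈ s` are the same literal. -/
@[ext] structure Lit (L : FirstOrder.Language.{u, v}) (V : Type w) where
  sign : Bool
  sides : Sym2 (L.Term V)

/-- The literal `s # t` of the given sign. -/
def mkLit (b : Bool) (s t : L.Term V) : Lit L V := ⟨b, s(s, t)⟩

namespace Lit

def comp (ℓ : Lit L V) : Lit L V := ⟨!ℓ.sign, ℓ.sides⟩

def subst (ℓ : Lit L V) (σ : Subst L V) : Lit L V := ⟨ℓ.sign, ℓ.sides.map fun t => t.subst σ⟩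

def vars (ℓ : Lit L V) : Set V := {x | ∃ t ∈ ℓ.sides, x ∈ tvars t}

def IsGround (ℓ : Lit L V) : Prop := ∀ t ∈ ℓ.sides, IsGroundTerm t

/-- The multiset `{s, t}` for `s ≈ t`, and `{s, s, t, t}` for `s ≉ t`. -/
def mset (ℓ : Lit L V) : Multiset (L.Term V) :=
  if ℓ.sign then ℓ.sides.toMultiset else ℓ.sides.toMultiset + ℓ.sides.toMultiset

/-- Truth of a literal in a structure under an assignment. -/
def Holds {M : Type*} [L.Structure M] (a : V → M) (ℓ : Lit L V) : Prop :=
  ℓ.sign = true ↔ ∃ s t, ℓ.sides = s(s, t) ∧ s.realize a = t.realize a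

end Lit

/-- Clauses are finite multisets of literals. -/
abbrev Clause (L : FirstOrder.Language.{u, v}) (V : Type w) := Multiset (Lit L V)

namespace Clause

def subst (C : Clause L V) (σ : Subst L V) : Clause L V := C.map fun ℓ => ℓ.subst σ

def vars (C : Clause L V) : Set V := {x | ∃ ℓ ∈ C, x ∈ ℓ.vars}

def IsGround (C : Clause L V) : Prop := ∀ ℓ ∈ C, ℓ.IsGround

/-- `σ` is grounding for `C`. -/
def Grounds (σ : Subst L V) (C : Clause L V) : Prop := IsGround (subst C σ)

end Clause

/-- A clause set is satisfiable if some nonempty structure satisfies the universal closure of all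
its clauses. -/
def Satisfiable (N : Set (Clause L V)) : Prop :=
  ∃ (M : Type (max u w)) (_ : Nonempty M) (_ : L.Structure M),
    ∀ C ∈ N, ∀ a : V → M, ∃ ℓ ∈ C, ℓ.Holds a

/-- `G ⊨ ℓ` for a set `G` of ground literals and a ground literal `ℓ`. -/
def Entails (G : Set (Lit L V)) (ℓ : Lit L V) : Prop :=
  ∀ (M : Type (max u w)) [Nonempty M] [L.Structure M] (a : V → M),
    (∀ g ∈ G, g.Holds a) → ℓ.Holds a

/-! ### Orderings -/

/-- The multiset extension of a strict order. -/
def MulLT {α : Type*} (r : α → α → Prop) (A B : Multiset α) : Prop :=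
  ∃ X Y Z : Multiset α, Z ≠ 0 ∧ A = X + Y ∧ B = X + Z ∧ ∀ y ∈ Y, ∃ z ∈ Z, r y z

/-- A desired term ordering: a well-founded rewrite ordering which is total on ground terms and
such that there are only finitely many ground terms below any ground term. -/
structure IsDesired (lt : L.Term V → L.Term V → Prop) : Prop where
  wf : WellFounded lt
  irrefl : ∀ t, ¬ lt t t
  trans : ∀ s t u, lt s t → lt t u → lt s u
  subst : ∀ s t (σ : Subst L V), lt s t → lt (s.subst σ) (t.subst σ)
  context : ∀ s t u p, IsPos u p → lt s t → lt (replaceAt u p s) (replaceAt u p t)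
  total : ∀ s t, IsGroundTerm s → IsGroundTerm t → s ≠ t → lt s t ∨ lt t s
  finite : ∀ t, IsGroundTerm t → {s | IsGroundTerm s ∧ lt s t}.Finite

/-- The term ordering extended to literals. -/
def litLT (lt : L.Term V → L.Term V → Prop) (ℓ κ : Lit L V) : Prop := MulLT lt ℓ.mset κ.mset

/-- `ℓ ≺ β` for a literal `ℓ` and a term `β`. -/
def litBelow (lt : L.Term V → L.Term V → Prop) (β : L.Term V) (ℓ : Lit L V) : Prop :=
  MulLT lt ℓ.mset {β}

/-- `β ≺ ℓ` for a literal `ℓ` and a term `β`. -/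
def litAbove (lt : L.Term V → L.Term V → Prop) (β : L.Term V) (ℓ : Lit L V) : Prop :=
  MulLT lt {β} ℓ.mset

/-- `C ≺ β` for a clause `C` and a term `β`. -/
def clauseBelow (lt : L.Term V → L.Term V → Prop) (β : L.Term V) (C : Clause L V) : Prop :=
  MulLT (MulLT lt) (C.map Lit.mset) {{β}}

/-! ### Rewriting -/

/-- A term rewrite system. -/
abbrev TRS (L : FirstOrder.Language.{u, v}) (V : Type w) := Set (L.Term V × L.Term V)

/-- One rewrite step with a rule of `R`. -/
def Rewrites (R : TRS L V) (s t : L.Term V) : Prop :=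
  ∃ l r, (l, r) ∈ R ∧ ∃ (p : List ℕ) (σ : Subst L V),
    subtermAt s p = some (l.subst σ) ∧ t = replaceAt s p (r.subst σ)

def Irreducible (R : TRS L V) (t : L.Term V) : Prop := ∀ t', ¬ Rewrites R t t'

/-- `s = t↓_R`. -/
def IsNormalForm (R : TRS L V) (t s : L.Term V) : Prop :=
  Relation.ReflTransGen (Rewrites R) t s ∧ Irreducible R s

/-- All terms in the codomain of `σ` are irreducible. -/
def IrreducibleSubst (R : TRS L V) (σ : Subst L V) : Prop :=
  ∀ x, σ x ≠ .var x → Irreducible R (σ x)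

/-- The convergent ground rewrite system given by the positive equations in `G`: all their ground
consequences, oriented by the term ordering. If the ordering is a desired one, the system is
terminating and confluent, and the normal form of a ground term is the least ground term that is
equal to it modulo the positive equations in `G`. Hence it has the same normal forms as every
other convergent ground system that is oriented by the ordering and has the same equational
theory. -/
def conv (lt : L.Term V → L.Term V → Prop) (G : Set (Lit L V)) : TRS L V :=
  {e | IsGroundTerm e.1 ∧ IsGroundTerm e.2 ∧ lt e.2 e.1 ∧
    Entails {g ∈ G | g.sign = true} (mkLit true e.1 e.2)}

/-! ### Most general unifiers -/

/-- The substitution `θ` solves all equations in `E`. -/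
def Unifies (E : Set (L.Term V × L.Term V)) (θ : Subst L V) : Prop :=
  ∀ e ∈ E, e.1.subst θ = e.2.subst θ

def eqVars (E : Set (L.Term V × L.Term V)) : Set V := {x | ∃ e ∈ E, x ∈ tvars e.1 ∨ x ∈ tvars e.2}

/-- `μ` is an idempotent most general unifier of `E` that introduces no fresh variables. -/
structure IsMGU (E : Set (L.Term V × L.Term V)) (μ : Subst L V) : Prop where
  unifies : Unifies E μ
  general : ∀ θ, Unifies E θ → ∃ η : Subst L V, ∀ x, θ x = (μ x).subst η
  idem : ∀ x, (μ x).subst μ = μ x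
  off : ∀ x, x ∉ eqVars E → μ x = .var x
  noFresh : ∀ x ∈ eqVars E, ∀ y ∈ tvars (μ x), y ∈ eqVars E

/-! ### Trails -/

/-- The annotated ground literal `(lit)σ^{level : (lit ∨ rest)·σ}`. -/
structure AnnLit (L : FirstOrder.Language.{u, v}) (V : Type w) where
  lit : Lit L V
  rest : Clause L V
  subst : Subst L V
  level : ℕ

namespace AnnLit

/-- The ground literal. -/
def gl (a : AnnLit L V) : Lit L V := a.lit.subst a.subst

/-- The annotated clause `lit ∨ rest`. -/
def cl (a : AnnLit L V) : Clause L V := a.lit ::ₘ a.rest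

end AnnLit

/-- Sequences of annotated literals; new literals are added at the right end. -/
abbrev Trail (L : FirstOrder.Language.{u, v}) (V : Type w) := List (AnnLit L V)

/-- The set of ground literals on a trail. -/
def glits (Γ : Trail L V) : Set (Lit L V) := {ℓ | ∃ a ∈ Γ, a.gl = ℓ}

/-- `ℓ` is defined by the literals in `G`. -/
def Defined (G : Set (Lit L V)) (ℓ : Lit L V) : Prop := Entails G ℓ ∨ Entails G ℓ.comp

section Beta

variable (lt : L.Term V → L.Term V → Prop) (β : L.Term V) (Γ : Trail L V)

def BTrue (ℓ : Lit L V) : Prop := litBelow lt β ℓ ∧ Entails (glits Γ) ℓ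

def BFalse (ℓ : Lit L V) : Prop := litBelow lt β ℓ ∧ Entails (glits Γ) ℓ.comp

def BUndef (ℓ : Lit L V) : Prop := litAbove lt β ℓ ∨ ¬ Defined (glits Γ) ℓ

def BDef (ℓ : Lit L V) : Prop := ¬ BUndef lt β Γ ℓ

def CBTrue (C : Clause L V) : Prop := ∃ ℓ ∈ C, BTrue lt β Γ ℓ

def CBFalse (C : Clause L V) : Prop := ∀ ℓ ∈ C, BFalse lt β Γ ℓ

def CBUndef (C : Clause L V) : Prop := ¬ CBTrue lt β Γ C ∧ ¬ CBFalse lt β Γ C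

end Beta

/-! ### Cores, defining literals, levels -/

/-- The literals of `Γ` at the indices in `I`. -/
def subLits (Γ : Trail L V) (I : Finset ℕ) : Set (Lit L V) :=
  {ℓ | ∃ i ∈ I, ∃ a, Γ[i]? = some a ∧ a.gl = ℓ}

/-- The subsequence of `Γ` with index set `I` is a core of `ℓ`: a minimal subsequence in which `ℓ`
is defined. -/
def IsCore (Γ : Trail L V) (ℓ : Lit L V) (I : Finset ℕ) : Prop :=
  I ⊆ Finset.range Γ.length ∧ Defined (subLits Γ I) ℓ ∧ ∀ J, J ⊂ I → ¬ Defined (subLits Γ J) ℓ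

/-- The literal with index `i` is the defining literal of `ℓ` in `Γ`: the largest literal of a
core whose largest literal is minimal among those of all cores. -/
def IsDefiningIdx (Γ : Trail L V) (ℓ : Lit L V) (i : ℕ) : Prop :=
  ∃ I, IsCore Γ ℓ I ∧ IsGreatest (I : Set ℕ) i ∧ ∀ J, IsCore Γ ℓ J → ∃ j ∈ J, i ≤ j

/-- The ground literal `ℓ` is of level `k` in `Γ`. -/
def LitLevel (Γ : Trail L V) (ℓ : Lit L V) (k : ℕ) : Prop :=
  (∃ a ∈ Γ, a.gl = ℓ ∧ a.level = k) ∨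
  (ℓ ∉ glits Γ ∧ Defined (glits Γ) ℓ ∧
    ((∃ i a, IsDefiningIdx Γ ℓ i ∧ Γ[i]? = some a ∧ a.level = k) ∨
      (¬ (∃ i, IsDefiningIdx Γ ℓ i) ∧ k = 0)))

/-- The ground clause `C` is of level `k`: the maximum level of a literal in `C`, and `0` for the
empty clause. -/
def ClauseLevel (Γ : Trail L V) (C : Clause L V) (k : ℕ) : Prop :=
  IsGreatest {j | ∃ ℓ ∈ C, LitLevel Γ ℓ j} k ∨ (C = 0 ∧ k = 0)

/-- The literal `a`, standing immediately after `Γ`, is a decision literal: its level is one more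
than the level of the preceding literal, which counts as `0` if there is none. -/
def IsDecision (Γ : Trail L V) (a : AnnLit L V) : Prop :=
  a.level = (Γ.getLast?.map AnnLit.level).getD 0 + 1

/-! ### The trail induced ordering -/

section TrailOrder

variable (lt : L.Term V → L.Term V → Prop) (β : L.Term V) (Γ : Trail L V)

/-- `ℓ` is the `i`-th literal of `Γ`, and of level greater than zero. -/
def OnTrail (i : ℕ) (ℓ : Lit L V) : Prop := ∃ a, Γ[i]? = some a ∧ 0 < a.level ∧ ℓ = a.gl

/-- `ℓ` is the complement of the `i`-th literal of `Γ`, and of level greater than zero. -/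
def CompOnTrail (i : ℕ) (ℓ : Lit L V) : Prop := ∃ a, Γ[i]? = some a ∧ 0 < a.level ∧ ℓ = a.gl.comp

/-- `ℓ` is a `β`-defined ground literal of level greater than zero that is neither contained in `Γ`
nor in `comp Γ`, and its defining literal is the `i`-th literal of `Γ`. -/
def OffTrail (i : ℕ) (ℓ : Lit L V) : Prop :=
  ℓ.IsGround ∧ BDef lt β Γ ℓ ∧ ℓ ∉ glits Γ ∧ ℓ.comp ∉ glits Γ ∧ IsDefiningIdx Γ ℓ i ∧
    ∃ a, Γ[i]? = some a ∧ 0 < a.level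

def LevelZero (ℓ : Lit L V) : Prop := ℓ.IsGround ∧ BDef lt β Γ ℓ ∧ LitLevel Γ ℓ 0

def LevelPos (ℓ : Lit L V) : Prop := ℓ.IsGround ∧ BDef lt β Γ ℓ ∧ ∃ k, 0 < k ∧ LitLevel Γ ℓ k

/-- The ordering on ground literals that is induced by the trail. -/
inductive TrailLT : Lit L V → Lit L V → Prop
  | off_off {i j ℓ κ} : OffTrail lt β Γ i ℓ → OffTrail lt β Γ j κ →
      i < j ∨ (i = j ∧ litLT lt ℓ κ) → TrailLT ℓ κ
  | on_on {i j ℓ κ} : OnTrail Γ i ℓ → OnTrail Γ j κ → i < j → TrailLT ℓ κ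
  | comp_on {i j ℓ κ} : CompOnTrail Γ i ℓ → OnTrail Γ j κ → i < j → TrailLT ℓ κ
  | on_comp {i j ℓ κ} : OnTrail Γ i ℓ → CompOnTrail Γ j κ → i < j ∨ i = j → TrailLT ℓ κ
  | comp_comp {i j ℓ κ} : CompOnTrail Γ i ℓ → CompOnTrail Γ j κ → i < j → TrailLT ℓ κ
  | on_off {i k ℓ κ} : OnTrail Γ i ℓ → OffTrail lt β Γ k κ → i ≤ k → TrailLT ℓ κ
  | comp_off {i k ℓ κ} : CompOnTrail Γ i ℓ → OffTrail lt β Γ k κ → i ≤ k → TrailLT ℓ κ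
  | off_on {k i ℓ κ} : OffTrail lt β Γ k ℓ → OnTrail Γ i κ → k < i → TrailLT ℓ κ
  | off_comp {k i ℓ κ} : OffTrail lt β Γ k ℓ → CompOnTrail Γ i κ → k < i → TrailLT ℓ κ
  | zero_zero {ℓ κ} : LevelZero lt β Γ ℓ → LevelZero lt β Γ κ → litLT lt ℓ κ → TrailLT ℓ κ
  | zero_pos {ℓ κ} : LevelZero lt β Γ ℓ → LevelPos lt β Γ κ → TrailLT ℓ κ
  | undef_undef {ℓ κ} : ℓ.IsGround → κ.IsGround → BUndef lt β Γ ℓ → BUndef lt β Γ κ →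
      litLT lt ℓ κ → TrailLT ℓ κ
  | def_undef {ℓ κ} : ℓ.IsGround → κ.IsGround → BDef lt β Γ ℓ → BUndef lt β Γ κ → TrailLT ℓ κ

/-- The trail induced ordering on ground clauses. -/
def ClauseTrailLT (C D : Clause L V) : Prop := MulLT (TrailLT lt β Γ) C D

end TrailOrder

/-! ### Rewrite steps, reduction chains, refutations -/

/-- A rewrite step: its rewrite literal, the rest of its clause, its substitution and, unless it
is an initial one, the two rewrite steps it was inferred from and a position. -/
inductive RStep (L : FirstOrder.Language.{u, v}) (V : Type w) where
  | leaf (lit : Lit L V) (rest : Clause L V) (σ : Subst L V) : RStep L V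
  | infer (lit : Lit L V) (rest : Clause L V) (σ : Subst L V) (I₁ I₂ : RStep L V)
      (p : List ℕ) : RStep L V

namespace RStep

def lit : RStep L V → Lit L V
  | leaf ℓ _ _ => ℓ
  | infer ℓ _ _ _ _ _ => ℓ

def rest : RStep L V → Clause L V
  | leaf _ C _ => C
  | infer _ C _ _ _ _ => C

def subst : RStep L V → Subst L V
  | leaf _ _ σ => σ
  | infer _ _ σ _ _ _ => σ

def cl (I : RStep L V) : Clause L V := I.lit ::ₘ I.rest

end RStep

/-- `I` is the initial rewrite step for a copy of the annotation of `a` with renamed variables. -/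
def IsLeafOf (a : AnnLit L V) (I : RStep L V) : Prop :=
  ∃ (π : Equiv.Perm V) (σ : Subst L V),
    I = .leaf (a.lit.subst fun x => .var (π x)) (Clause.subst a.rest fun x => .var (π x)) σ ∧
    ∀ x ∈ Clause.vars a.cl, σ (π x) = a.subst x

/-- `l δ # r δ` is the most general instance of `l # r` that has the position `p` (in `l δ`) and of
which `(l # r) σ` is an instance, where `δ` only instantiates variables of `l # r`, and introduces
only variables outside of `X`. -/
def IsPosExtension (l r : L.Term V) (σ : Subst L V) (p : List ℕ) (X : Set V) (δ : Subst L V) :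
    Prop :=
  IsPos (l.subst δ) p ∧
  (∀ x, δ x ≠ .var x → x ∈ (mkLit true l r).vars ∧ ∀ y ∈ tvars (δ x), y ∉ X) ∧
  (∃ ρ : Subst L V, (l.subst δ).subst ρ = l.subst σ ∧ (r.subst δ).subst ρ = r.subst σ) ∧
  ∀ η : Subst L V, IsPos (l.subst η) p →
    (∃ ρ : Subst L V, (l.subst η).subst ρ = l.subst σ ∧ (r.subst η).subst ρ = r.subst σ) →
    ∃ ρ : Subst L V, (l.subst δ).subst ρ = l.subst η ∧ (r.subst δ).subst ρ = r.subst η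

/-- `I` is the result of a rewrite inference at position `p` from the variable disjoint rewrite
steps `I₁` (with the rewriting equation) and `I₂` (with the rewritten literal). As sides of
literals are unordered, the rewritten side is called `l₂`. The first alternative for `δ` is
rewriting at a position of `l₂`, the second one is rewriting below variable level. The
substitution `σ` of the result extends those of `I₁` and `I₂`, and maps the variables introduced
by `δ` such that `(xδ)σ` is the value of `x` under the substitution of `I₂`. -/
def IsRewriteInference (lt : L.Term V → L.Term V → Prop) (I₁ I₂ : RStep L V) (p : List ℕ)
    (I : RStep L V) : Prop :=
  Disjoint (Clause.vars I₁.cl) (Clause.vars I₂.cl) ∧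
  ∃ (l₁ r₁ l₂ r₂ : L.Term V) (b : Bool) (δ μ σ : Subst L V) (q : L.Term V),
    I₁.lit = mkLit true l₁ r₁ ∧ I₂.lit = mkLit b l₂ r₂ ∧
    lt (r₁.subst I₁.subst) (l₁.subst I₁.subst) ∧
    subtermAt (l₂.subst I₂.subst) p = some (l₁.subst I₁.subst) ∧
    ((IsPos l₂ p ∧ ∀ x, δ x = .var x) ∨
      (¬ IsPos l₂ p ∧
        IsPosExtension l₂ r₂ I₂.subst p (Clause.vars I₁.cl ∪ Clause.vars I₂.cl) δ)) ∧
    subtermAt (l₂.subst δ) p = some q ∧ IsMGU {(q, l₁)} μ ∧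
    (∀ x ∈ Clause.vars I₁.cl, σ x = I₁.subst x) ∧
    (∀ x ∈ Clause.vars I₂.cl, σ x = I₂.subst x ∧ (δ x).subst σ = I₂.subst x) ∧
    I = .infer ((mkLit b (replaceAt (l₂.subst δ) p r₁) (r₂.subst δ)).subst μ)
      (Clause.subst I₁.rest μ + Clause.subst (Clause.subst I₂.rest δ) μ) σ I₁ I₂ p

/-- A reduction chain from `Γ`. -/
def IsChain (lt : L.Term V → L.Term V → Prop) (Γ : Trail L V) (P : List (RStep L V)) : Prop :=
  ∀ i I, P[i]? = some I →
    (∃ a ∈ Γ, IsLeafOf a I) ∨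
    (∃ I₁ ∈ P.take i, ∃ I₂ ∈ P.take i, ∃ p, IsRewriteInference lt I₁ I₂ p I)

/-- A reduction chain application from `Γ` to the annotated literal `a`, without minimality. -/
def IsPreReduction (lt : L.Term V → L.Term V → Prop) (Γ : Trail L V) (a : AnnLit L V)
    (P : List (RStep L V)) : Prop :=
  IsChain lt (Γ ++ [a]) P ∧
  ∃ I, P.getLast? = some I ∧ ∃ (b : Bool) (l r s t : L.Term V),
    a.lit = mkLit b l r ∧ I.lit = mkLit b s t ∧
    IsNormalForm (conv lt (glits Γ)) (l.subst a.subst) (s.subst I.subst) ∧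
    IsNormalForm (conv lt (glits Γ)) (r.subst a.subst) (t.subst I.subst)

/-- `P` is a (minimal) reduction chain application from `Γ` to the annotated literal `a`. -/
def IsReduction (lt : L.Term V → L.Term V → Prop) (Γ : Trail L V) (a : AnnLit L V)
    (P : List (RStep L V)) : Prop :=
  IsPreReduction lt Γ a P ∧ ∀ i < P.length, ¬ IsPreReduction lt Γ a (P.eraseIdx i)

/-- A refutation from `Γ` and the annotated literal `a`, without minimality. -/
def IsPreRefutation (lt : L.Term V → L.Term V → Prop) (β : L.Term V) (Γ : Trail L V)
    (a : AnnLit L V) (P : List (RStep L V)) : Prop :=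
  BFalse lt β Γ a.gl ∧ IsChain lt (Γ ++ [a]) P ∧
  ∃ I, P.getLast? = some I ∧ ∃ s, I.lit.subst I.subst = mkLit false s s

/-- `P` is a (minimal) refutation from `Γ` and the annotated literal `a`. -/
def IsRefutation (lt : L.Term V → L.Term V → Prop) (β : L.Term V) (Γ : Trail L V)
    (a : AnnLit L V) (P : List (RStep L V)) : Prop :=
  IsPreRefutation lt β Γ a P ∧ ∀ i, i + 1 < P.length → ¬ IsPreRefutation lt β Γ a (P.eraseIdx i)

/-! ### States and rules -/

/-- The last component of a state: `⊤`, `⊥`, or a closure `C·σ`. -/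
inductive Status (L : FirstOrder.Language.{u, v}) (V : Type w) where
  | top : Status L V
  | bot : Status L V
  | closure (C : Clause L V) (σ : Subst L V) : Status L V

/-- A state `(Γ; N; U; β; k; D)`. -/
structure State (L : FirstOrder.Language.{u, v}) (V : Type w) where
  trail : Trail L V
  initial : Set (Clause L V)
  learned : Set (Clause L V)
  bound : L.Term V
  level : ℕ
  status : Status L V

inductive Rule where
  | propagate
  | decide
  | conflict
  | skip
  | exploreRefutation
  | factorize
  | equalityResolution
  | backtrack
  | grow

variable (lt : L.Term V → L.Term V → Prop)

/-- Rule Propagate can add the annotated literal `a` to the trail of the state. The selected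
literal is `s # t`, and `C₁` lists the sides of the other literals that become equal to it, each
oriented as `s # t` is. -/
def CanPropagate (S : State L V) (a : AnnLit L V) : Prop :=
  S.status = .top ∧
  ∃ (C₀ : Clause L V) (C₁ : Multiset (L.Term V × L.Term V)) (b : Bool) (s t : L.Term V)
    (σ μ : Subst L V) (P : List (RStep L V)) (I : RStep L V),
    C₀ + C₁.map (fun e => mkLit b e.1 e.2) + {mkLit b s t} ∈ S.initial ∪ S.learned ∧
    Clause.Grounds σ (C₀ + C₁.map (fun e => mkLit b e.1 e.2) + {mkLit b s t}) ∧
    (∀ ℓ ∈ Clause.subst C₀ σ, Entails (glits S.trail) ℓ.comp) ∧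
    (∀ e ∈ C₁, e.1.subst σ = s.subst σ ∧ e.2.subst σ = t.subst σ) ∧
    IsMGU {e | ∃ f ∈ C₁, e = (f.1, s) ∨ e = (f.2, t)} μ ∧
    BUndef lt S.bound S.trail ((mkLit b s t).subst σ) ∧
    clauseBelow lt S.bound (Clause.subst (Clause.subst (C₀ + {mkLit b s t}) μ) σ) ∧
    IrreducibleSubst (conv lt (glits S.trail)) σ ∧
    IsReduction lt S.trail ⟨(mkLit b s t).subst μ, Clause.subst C₀ μ, σ, S.level⟩ P ∧
    P.getLast? = some I ∧
    a = ⟨I.lit, I.rest, I.subst, S.level⟩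

/-- Rule Decide can add the annotated literal `a` to the trail of the state (up to the restrictions
imposed on regular runs). -/
def CanDecide (S : State L V) (a : AnnLit L V) : Prop :=
  S.status = .top ∧
  ∃ (C₀ : Clause L V) (ℓ : Lit L V) (σ : Subst L V) (P : List (RStep L V)) (I : RStep L V),
    C₀ + {ℓ} ∈ S.initial ∪ S.learned ∧
    Clause.Grounds σ (C₀ + {ℓ}) ∧
    (CBUndef lt S.bound S.trail (Clause.subst C₀ σ) ∨
      CBTrue lt S.bound S.trail (Clause.subst C₀ σ)) ∧
    BUndef lt S.bound S.trail (ℓ.subst σ) ∧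
    clauseBelow lt S.bound (Clause.subst (C₀ + {ℓ}) σ) ∧
    IrreducibleSubst (conv lt (glits S.trail)) σ ∧
    IsReduction lt S.trail ⟨ℓ, C₀, σ, S.level + 1⟩ P ∧
    P.getLast? = some I ∧
    a = ⟨I.lit, {I.lit.comp}, I.subst, S.level + 1⟩

/-- Some ground instance of `C` is `β`-false in `Γ`. -/
def HasFalseInstance (β : L.Term V) (Γ : Trail L V) (C : Clause L V) : Prop :=
  ∃ τ, Clause.Grounds τ C ∧ CBFalse lt β Γ (Clause.subst C τ)

/-- `Step lt ρ S T`: an application of rule `ρ` to the state `S` results in the state `T`. -/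
inductive Step : Rule → State L V → State L V → Prop
  | propagate {S : State L V} {a : AnnLit L V} (h : CanPropagate lt S a) :
      Step .propagate S { S with trail := S.trail ++ [a] }
  | decide {S : State L V} {a : AnnLit L V} (h : CanDecide lt S a) :
      Step .decide S { S with trail := S.trail ++ [a], level := S.level + 1 }
  | conflict_bot {S : State L V} {D : Clause L V} {σ : Subst L V} (hS : S.status = .top)
      (hD : D ∈ S.initial ∪ S.learned) (hσ : Clause.Grounds σ D)
      (hf : CBFalse lt S.bound S.trail (Clause.subst D σ))
      (hi : IrreducibleSubst (conv lt (glits S.trail)) σ)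
      (hl : ClauseLevel S.trail (Clause.subst D σ) 0) :
      Step .conflict S { S with status := .bot }
  | conflict_closure {S : State L V} {D : Clause L V} {σ : Subst L V} (hS : S.status = .top)
      (hD : D ∈ S.initial ∪ S.learned) (hσ : Clause.Grounds σ D)
      (hf : CBFalse lt S.bound S.trail (Clause.subst D σ))
      (hi : IrreducibleSubst (conv lt (glits S.trail)) σ)
      (hl : ¬ ClauseLevel S.trail (Clause.subst D σ) 0) :
      Step .conflict S { S with status := .closure D σ }
  | skip {S : State L V} {Γ : Trail L V} {K a : AnnLit L V} {D : Clause L V} {σ : Subst L V}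
      (hS : S.status = .closure D σ) (hΓ : S.trail = Γ ++ [K] ++ [a])
      (hf : CBFalse lt S.bound (Γ ++ [K]) (Clause.subst D σ)) :
      Step .skip S { S with trail := Γ ++ [K], level := K.level }
  | exploreRefutation {S : State L V} {D : Clause L V} {ℓ : Lit L V} {σ : Subst L V}
      {P : List (RStep L V)} {I : RStep L V}
      (hS : S.status = .closure (D + {ℓ}) σ)
      (hmax : ∀ κ ∈ Clause.subst D σ,
        κ ≠ ℓ.subst σ ∧ ¬ TrailLT lt S.bound S.trail (ℓ.subst σ) κ)
      (hdef : ∃ i, i + 1 = S.trail.length ∧ IsDefiningIdx S.trail (ℓ.subst σ) i)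
      (hP : IsRefutation lt S.bound S.trail ⟨ℓ, D, σ, S.level⟩ P)
      (hI : I ∈ P)
      (hlt : ClauseTrailLT lt S.bound S.trail (Clause.subst I.cl I.subst)
        (Clause.subst (D + {ℓ}) σ))
      (hf : CBFalse lt S.bound S.trail (Clause.subst I.cl I.subst)) :
      Step .exploreRefutation S { S with status := .closure I.cl I.subst }
  | factorize {S : State L V} {D : Clause L V} {b : Bool} {s t s' t' : L.Term V}
      {σ μ : Subst L V}
      (hS : S.status = .closure (D + {mkLit b s t} + {mkLit b s' t'}) σ)
      (hs : s.subst σ = s'.subst σ) (ht : t.subst σ = t'.subst σ)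
      (hμ : IsMGU {(s, s'), (t, t')} μ) :
      Step .factorize S { S with status := .closure (Clause.subst (D + {mkLit b s t}) μ) σ }
  | equalityResolution {S : State L V} {D : Clause L V} {s s' : L.Term V} {σ μ : Subst L V}
      (hS : S.status = .closure (D + {mkLit false s s'}) σ)
      (hs : s.subst σ = s'.subst σ) (hμ : IsMGU {(s, s')} μ) :
      Step .equalityResolution S { S with status := .closure (Clause.subst D μ) σ }
  | backtrack {S : State L V} {Γ Γ' : Trail L V} {K : AnnLit L V} {D : Clause L V} {ℓ : Lit L V}
      {σ : Subst L V} {i i' : ℕ}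
      (hS : S.status = .closure (D + {ℓ}) σ) (hΓ : S.trail = Γ ++ [K] ++ Γ')
      (hl : ClauseLevel S.trail (Clause.subst D σ) i') (hk : i' < S.level)
      (hf : HasFalseInstance lt S.bound (Γ ++ [K]) (D + {ℓ}))
      (hmin : ∀ Δ, Δ <+: Γ → ¬ HasFalseInstance lt S.bound Δ (D + {ℓ}))
      (hi : (IsDecision Γ K ∧ i = 1) ∨ (¬ IsDecision Γ K ∧ i = 0)) :
      Step .backtrack S { S with
        trail := Γ, learned := S.learned ∪ {D + {ℓ}}, level := K.level - i, status := .top }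
  | grow {S : State L V} {β' : L.Term V} (hS : S.status = .top) (hg : IsGroundTerm β')
      (hβ : lt S.bound β') :
      Step .grow S { S with trail := [], bound := β', level := 0 }

/-- The rule `ρ` is applicable to `S`. -/
def Applicable (ρ : Rule) (S : State L V) : Prop := ∃ T, Step lt ρ S T

/-- A stuck state. -/
def IsStuck (S : State L V) : Prop :=
  S.status ≠ .bot ∧ ∀ ρ, ρ ≠ .grow → ¬ Applicable lt ρ S

/-! ### Runs -/

/-- The initial state `(ε; N; ∅; β; 0; ⊤)`. -/
def initialState (N : Set (Clause L V)) (β : L.Term V) : State L V := ⟨[], N, ∅, β, 0, .top⟩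

/-- The states `S 0, S 1, …` and rules `ρ 0, ρ 1, …` form a run of length `n` (possibly infinite)
from the initial state: for `i < n`, rule `ρ i` leads from `S i` to `S (i + 1)`. -/
def IsRun (N : Set (Clause L V)) (β : L.Term V) (S : ℕ → State L V) (ρ : ℕ → Rule) (n : ℕ∞) :
    Prop :=
  S 0 = initialState N β ∧ ∀ i : ℕ, (i : ℕ∞) < n → Step lt (ρ i) (S i) (S (i + 1))

/-- In the sequence `ρ` of rules, `j` is the last application of Conflict before `i`. -/
def IsLastConflict (ρ : ℕ → Rule) (j i : ℕ) : Prop :=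
  j < i ∧ ρ j = .conflict ∧ ∀ m, j < m → m < i → ρ m ≠ .conflict

/-- The application of Conflict at `j` immediately follows an application of Decide. -/
def AfterDecide (ρ : ℕ → Rule) (j : ℕ) : Prop := ∃ m, m + 1 = j ∧ ρ m = .decide

/-- A regular run of length `n`. -/
structure IsRegularRun (N : Set (Clause L V)) (β : L.Term V) (S : ℕ → State L V) (ρ : ℕ → Rule)
    (n : ℕ∞) : Prop where
  run : IsRun lt N β S ρ n
  precedence : ∀ i : ℕ, (i : ℕ∞) < n → ρ i ≠ .conflict → ρ i ≠ .factorize →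
    ¬ Applicable lt .conflict (S i) ∧ ¬ Applicable lt .factorize (S i)
  levelZero : ∀ i : ℕ, (i : ℕ∞) < n → (S i).level = 0 → ρ i = .decide →
    ¬ Applicable lt .propagate (S i)
  noOppositeDecision : ∀ i : ℕ, (i : ℕ∞) < n → ρ i = .decide →
    ∀ a, (S (i + 1)).trail = (S i).trail ++ [a] →
      ¬ ∃ c, CanPropagate lt (S i) c ∧ c.cl ∈ (S i).initial ∪ (S i).learned ∧ a.gl = c.gl.comp
  skipOnce : ∀ i : ℕ, (i : ℕ∞) < n → ρ i = .backtrack → ∀ j, IsLastConflict ρ j i →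
    (∃ m, j < m ∧ m < i ∧ ρ m = .skip) ∨ AfterDecide ρ j
  backtrackAfterDecide : ∀ i : ℕ, (i : ℕ∞) < n → ρ i = .backtrack → ∀ j, IsLastConflict ρ j i →
    AfterDecide ρ j → ∃ Γ a D σ, (S i).trail = Γ ++ [a] ∧ (S i).status = .closure D σ ∧
      ∃ ℓ ∈ D, ℓ.subst σ = a.gl.comp

/-- A regular run without rule Grow that is maximal, that is, it is infinite, or it is finite and
cannot be continued to a longer regular run without rule Grow. -/
structure IsMaximalRegularRun (N : Set (Clause L V)) (β : L.Term V) (S : ℕ → State L V)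
    (ρ : ℕ → Rule) (n : ℕ∞) : Prop where
  regular : IsRegularRun lt N β S ρ n
  noGrow : ∀ i : ℕ, (i : ℕ∞) < n → ρ i ≠ .grow
  maximal : ∀ m : ℕ, n = m → ¬ ∃ S' ρ', (∀ i ≤ m, S' i = S i) ∧ (∀ i < m, ρ' i = ρ i) ∧
    IsRegularRun lt N β S' ρ' ((m + 1 : ℕ) : ℕ∞) ∧ ρ' m ≠ .grow

end Calculus

end SCLEQ

/-! Fix a model `M` of `N`. The theorem splits into progress (a finite regular run that does not end
in a stuck state can be continued, `IsRegularRun.exists_continuation`) and termination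
(`IsRegularRun.ne_top`).

Both rest on the invariant `Inv`. All learned clauses and annotations are valid in `M`. Every trail
literal was undefined when it was added, and the other literals of its annotation were false by
then, except that a decision carries the tautology `L ∨ comp L`. No proper prefix of the trail makes
an instance of a known clause false, because Conflict has precedence and Backtrack returns to a
prefix without false instances. Trail literals of level zero follow from valid clauses, so they hold
in `M`; hence no valid clause is false at level zero, and `⊥` is never reached.

Progress: only Backtrack is subject to the last two regularity conditions, so the critical state is
one in which Backtrack is the only applicable rule. All literals of its closure but one, `ℓ`, are
defined before the last trail literal `a`. If `ℓ` is so as well, Skip applies. Otherwise `ℓ` has a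
refutation: ground rewriting is refutationally complete (`exists_derived_refutation`, via Newman's
lemma and a model of normal forms) and lifts to rewrite inferences (`exists_isRewriteInference`).
Its last step is smaller in the trail ordering, so Explore-Refutation applies, unless `a` is a
decision and `ℓ` its complement (`Inv.backtrack_cases`). In this remaining case Backtrack is
permitted, because Conflict follows Decide if no literal has been skipped.

Termination: the closure at a Backtrack never includes an instance of an already known clause
(`IsRegularRun.not_redundant`). If Skip was used, such an instance would be false in a proper prefix
of the trail at the conflict. If not, Propagate could have added the complement of the decision,
which regularity forbids. All these ground clauses are multisets over the finitely many ground
literals below `β`, so by Dickson's lemma Backtrack is applied finitely often. After the last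
Backtrack, either a conflict state is reached and `conflictRank` decreases forever, or the trail
grows forever, although its literals are distinct and bounded by `β`. -/

namespace SCLEQ

/-! ### Syntax, substitution, positions, and entailment. -/

section Terms

variable {L : FirstOrder.Language.{u, v}} {V : Type w}

open FirstOrder.Language (Term)

/-! ### Terms -/

theorem mem_tvars_var {x y : V} : x ∈ tvars (Term.var y : L.Term V) ↔ x = y := by
  classical
  unfold tvars
  simp [Term.varFinset]

theorem mem_tvars_func {x : V} {n : ℕ} {f : L.Functions n} {ts : Fin n → L.Term V} :
    x ∈ tvars (Term.func f ts) ↔ ∃ i, x ∈ tvars (ts i) := by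
  classical
  unfold tvars
  simp [Term.varFinset]

theorem isGroundTerm_iff {t : L.Term V} : IsGroundTerm t ↔ ∀ x, x ∉ tvars t := by
  unfold IsGroundTerm
  exact Finset.eq_empty_iff_forall_notMem

theorem subst_subst (t : L.Term V) (σ τ : Subst L V) :
    (t.subst σ).subst τ = t.subst fun x => (σ x).subst τ := by
  induction t with
  | var x => rfl
  | func f ts ih => simp only [Term.subst]; congr 1; funext i; exact ih i

theorem subst_congr {t : L.Term V} {σ τ : Subst L V} :
    t.subst σ = t.subst τ ↔ ∀ x ∈ tvars t, σ x = τ x := by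
  induction t with
  | var x => simp [Term.subst, mem_tvars_var]
  | func f ts ih =>
    simp only [Term.subst, mem_tvars_func, Term.func.injEq, heq_eq_eq, true_and]
    constructor
    · rintro h x ⟨i, hi⟩
      exact (ih i).1 (congrFun h i) x hi
    · intro h
      funext i
      exact (ih i).2 fun x hx => h x ⟨i, hx⟩

theorem subst_var (t : L.Term V) : (t.subst fun x => Term.var x) = t := by
  induction t with
  | var x => rfl
  | func f ts ih => simp only [Term.subst]; congr 1; funext i; exact ih i

theorem subst_eq_self {t : L.Term V} {σ : Subst L V} (h : ∀ x ∈ tvars t, σ x = .var x) :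
    t.subst σ = t := by
  conv_rhs => rw [← subst_var t]
  exact subst_congr.2 h

theorem IsGroundTerm.subst_eq {t : L.Term V} (h : IsGroundTerm t) (σ : Subst L V) :
    t.subst σ = t :=
  subst_eq_self fun x hx => absurd hx (isGroundTerm_iff.1 h x)

theorem mem_tvars_subst {t : L.Term V} {σ : Subst L V} {y : V} :
    y ∈ tvars (t.subst σ) ↔ ∃ x ∈ tvars t, y ∈ tvars (σ x) := by
  induction t with
  | var x => simp [Term.subst, mem_tvars_var]
  | func f ts ih =>
    simp only [Term.subst, mem_tvars_func, ih]
    constructor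
    · rintro ⟨i, x, hx, hy⟩
      exact ⟨x, ⟨i, hx⟩, hy⟩
    · rintro ⟨x, ⟨i, hx⟩, hy⟩
      exact ⟨i, x, hx, hy⟩

theorem isGroundTerm_subst {t : L.Term V} {σ : Subst L V} :
    IsGroundTerm (t.subst σ) ↔ ∀ x ∈ tvars t, IsGroundTerm (σ x) := by
  simp only [isGroundTerm_iff, mem_tvars_subst]
  grind

theorem realize_eq_of_subst {M : Type*} [L.Structure M] (a : V → M) (t : L.Term V)
    (σ : Subst L V) : (t.subst σ).realize a = t.realize fun x => (σ x).realize a :=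
  Term.realize_subst

/-! ### Positions -/

@[simp] theorem subtermAt_nil (t : L.Term V) : subtermAt t [] = some t := by
  cases t <;> simp [subtermAt]

@[simp] theorem replaceAt_nil (t s : L.Term V) : replaceAt t [] s = s := by
  cases t <;> simp [replaceAt]

@[simp] theorem subtermAt_var_cons (x : V) (i : ℕ) (p : List ℕ) :
    subtermAt (Term.var x : L.Term V) (i :: p) = none := by
  simp [subtermAt]

theorem subtermAt_func_cons {n : ℕ} (f : L.Functions n) (ts : Fin n → L.Term V) (i : ℕ)
    (p : List ℕ) : subtermAt (Term.func f ts) (i :: p) =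
      if h : i < n then subtermAt (ts ⟨i, h⟩) p else none := by
  rw [subtermAt]

theorem replaceAt_func_cons {n : ℕ} (f : L.Functions n) (ts : Fin n → L.Term V) (i : ℕ)
    (p : List ℕ) (s : L.Term V) : replaceAt (Term.func f ts) (i :: p) s =
      Term.func f fun j => if j.val = i then replaceAt (ts j) p s else ts j := by
  rw [replaceAt]

theorem subtermAt_func_cons_eq_some {n : ℕ} {f : L.Functions n} {ts : Fin n → L.Term V} {i : ℕ}
    {p : List ℕ} {q : L.Term V} : subtermAt (Term.func f ts) (i :: p) = some q ↔
      ∃ h : i < n, subtermAt (ts ⟨i, h⟩) p = some q := by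
  rw [subtermAt_func_cons]
  split_ifs with h <;> simp [h]

theorem IsPos.exists_subtermAt {t : L.Term V} {p : List ℕ} (h : IsPos t p) :
    ∃ q, subtermAt t p = some q :=
  Option.isSome_iff_exists.1 h

theorem isPos_of_subtermAt {t q : L.Term V} {p : List ℕ} (h : subtermAt t p = some q) :
    IsPos t p := by
  simp [IsPos, h]

/-- Induction along a position of a term. -/
theorem subtermAt_induction {P : L.Term V → List ℕ → L.Term V → Prop}
    (root : ∀ t, P t [] t)
    (arg : ∀ {n : ℕ} (f : L.Functions n) (ts : Fin n → L.Term V) (i : Fin n) (p : List ℕ)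
      (q : L.Term V), subtermAt (ts i) p = some q → P (ts i) p q → P (.func f ts) (i.val :: p) q)
    {t q : L.Term V} {p : List ℕ} (h : subtermAt t p = some q) : P t p q := by
  induction p generalizing t with
  | nil =>
    rw [subtermAt_nil, Option.some.injEq] at h
    exact h ▸ root t
  | cons i p ih =>
    cases t with
    | var x => simp at h
    | func f ts =>
      obtain ⟨hi, h⟩ := subtermAt_func_cons_eq_some.1 h
      exact arg f ts ⟨i, hi⟩ p q h (ih h)

theorem subtermAt_subst {t q : L.Term V} {p : List ℕ} (h : subtermAt t p = some q)
    (σ : Subst L V) : subtermAt (t.subst σ) p = some (q.subst σ) := by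
  refine subtermAt_induction (P := fun t p q => subtermAt (t.subst σ) p = some (q.subst σ))
    (fun t => by simp) ?_ h
  intro n f ts i p q _ ih
  simp only [Term.subst]
  rw [subtermAt_func_cons_eq_some]
  exact ⟨i.2, ih⟩

theorem replaceAt_subst {t q : L.Term V} {p : List ℕ} (h : subtermAt t p = some q)
    (s : L.Term V) (σ : Subst L V) :
    (replaceAt t p s).subst σ = replaceAt (t.subst σ) p (s.subst σ) := by
  refine subtermAt_induction
    (P := fun t p _ => (replaceAt t p s).subst σ = replaceAt (t.subst σ) p (s.subst σ))
    (fun t => by simp) ?_ h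
  intro n f ts i p q _ ih
  rw [replaceAt_func_cons]
  simp only [Term.subst]
  rw [replaceAt_func_cons]
  congr 1
  funext j
  split_ifs with hj
  · obtain rfl : j = i := Fin.ext hj
    exact ih
  · rfl

theorem replaceAt_self {t q : L.Term V} {p : List ℕ} (h : subtermAt t p = some q) :
    replaceAt t p q = t := by
  refine subtermAt_induction (P := fun t p q => replaceAt t p q = t) (fun t => by simp) ?_ h
  intro n f ts i p q _ ih
  rw [replaceAt_func_cons]
  congr 1
  funext j
  split_ifs with hj
  · obtain rfl : j = i := Fin.ext hj
    exact ih
  · rfl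

theorem tvars_subtermAt {t q : L.Term V} {p : List ℕ} (h : subtermAt t p = some q) :
    ∀ x ∈ tvars q, x ∈ tvars t := by
  refine subtermAt_induction (P := fun t _ q => ∀ x ∈ tvars q, x ∈ tvars t)
    (fun t x hx => hx) ?_ h
  intro n f ts i p q _ ih x hx
  exact mem_tvars_func.2 ⟨i, ih x hx⟩

theorem tvars_replaceAt {t s : L.Term V} {p : List ℕ} :
    ∀ x ∈ tvars (replaceAt t p s), x ∈ tvars t ∨ x ∈ tvars s := by
  induction p generalizing t with
  | nil => intro x hx; rw [replaceAt_nil] at hx; exact .inr hx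
  | cons i p ih =>
    cases t with
    | var y => intro x hx; simp only [replaceAt] at hx; exact .inl hx
    | func f ts =>
      intro x hx
      rw [replaceAt_func_cons, mem_tvars_func] at hx
      obtain ⟨j, hj⟩ := hx
      rw [mem_tvars_func]
      split_ifs at hj with h
      · exact (ih x hj).imp_left fun h => ⟨j, h⟩
      · exact .inl ⟨j, hj⟩

theorem IsGroundTerm.replaceAt {t s : L.Term V} (ht : IsGroundTerm t) (hs : IsGroundTerm s)
    (p : List ℕ) : IsGroundTerm (replaceAt t p s) :=
  isGroundTerm_iff.2 fun x hx => (tvars_replaceAt x hx).elim (isGroundTerm_iff.1 ht x)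
    (isGroundTerm_iff.1 hs x)

theorem realize_replaceAt {M : Type*} [L.Structure M] {a : V → M} {t q s : L.Term V} {p : List ℕ}
    (h : subtermAt t p = some q) (hs : s.realize a = q.realize a) :
    (replaceAt t p s).realize a = t.realize a := by
  revert hs
  refine subtermAt_induction (P := fun t p q => s.realize a = q.realize a →
    (replaceAt t p s).realize a = t.realize a) (fun t h => by simpa using h) ?_ h
  intro n f ts i p q _ ih hs
  rw [replaceAt_func_cons, Term.realize_func, Term.realize_func]
  congr 1
  funext j
  split_ifs with hj
  · obtain rfl : j = i := Fin.ext hj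
    exact ih hs
  · rfl

/-! ### Literals -/

theorem mkLit_comm (b : Bool) (s t : L.Term V) : mkLit b s t = mkLit b t s := by
  simp [mkLit, Sym2.eq_swap]

theorem Lit.exists_mkLit (ℓ : Lit L V) : ∃ b s t, ℓ = mkLit b s t := by
  obtain ⟨b, e⟩ := ℓ
  induction e using Sym2.ind with
  | _ s t => exact ⟨b, s, t, rfl⟩

@[simp] theorem mkLit_sign (b : Bool) (s t : L.Term V) : (mkLit b s t).sign = b := rfl

@[simp] theorem mem_mkLit_sides {b : Bool} {s t x : L.Term V} :
    x ∈ (mkLit b s t).sides ↔ x = s ∨ x = t := by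
  simp [mkLit]

theorem mkLit_inj {b c : Bool} {s t s' t' : L.Term V} (h : mkLit b s t = mkLit c s' t') :
    b = c ∧ (s = s' ∧ t = t' ∨ s = t' ∧ t = s') := by
  simpa [mkLit] using h

@[simp] theorem mkLit_subst (b : Bool) (s t : L.Term V) (σ : Subst L V) :
    (mkLit b s t).subst σ = mkLit b (s.subst σ) (t.subst σ) := by
  simp [mkLit, Lit.subst]

@[simp] theorem mkLit_comp (b : Bool) (s t : L.Term V) :
    (mkLit b s t).comp = mkLit (!b) s t := rfl

@[simp] theorem Lit.comp_comp (ℓ : Lit L V) : ℓ.comp.comp = ℓ := by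
  simp [Lit.comp]

@[simp] theorem Lit.comp_sides (ℓ : Lit L V) : ℓ.comp.sides = ℓ.sides := rfl

/-- A literal whose instance is `s # t`, written with its sides in the corresponding order. -/
theorem Lit.exists_of_subst_eq {ℓ : Lit L V} {σ : Subst L V} {b : Bool} {s t : L.Term V}
    (h : ℓ.subst σ = mkLit b s t) :
    ∃ s' t', ℓ = mkLit b s' t' ∧ s'.subst σ = s ∧ t'.subst σ = t := by
  obtain ⟨c, s', t', rfl⟩ := ℓ.exists_mkLit
  rw [mkLit_subst] at h
  obtain ⟨rfl, ⟨h1, h2⟩ | ⟨h1, h2⟩⟩ := mkLit_inj h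
  · exact ⟨s', t', rfl, h1, h2⟩
  · exact ⟨t', s', mkLit_comm _ _ _, h2, h1⟩

theorem Lit.subst_subst (ℓ : Lit L V) (σ τ : Subst L V) :
    (ℓ.subst σ).subst τ = ℓ.subst fun x => (σ x).subst τ := by
  obtain ⟨b, s, t, rfl⟩ := ℓ.exists_mkLit
  simp [SCLEQ.subst_subst]

theorem Lit.subst_var (ℓ : Lit L V) : (ℓ.subst fun x => .var x) = ℓ := by
  obtain ⟨b, s, t, rfl⟩ := ℓ.exists_mkLit
  simp [SCLEQ.subst_var]

@[simp] theorem mem_mkLit_vars {b : Bool} {s t : L.Term V} {x : V} :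
    x ∈ (mkLit b s t).vars ↔ x ∈ tvars s ∨ x ∈ tvars t := by
  simp [Lit.vars]

theorem Lit.subst_congr {ℓ : Lit L V} {σ τ : Subst L V} (h : ∀ x ∈ ℓ.vars, σ x = τ x) :
    ℓ.subst σ = ℓ.subst τ := by
  obtain ⟨b, s, t, rfl⟩ := ℓ.exists_mkLit
  simp only [mem_mkLit_vars] at h
  rw [mkLit_subst, mkLit_subst, SCLEQ.subst_congr.2 fun x hx => h x (.inl hx),
    SCLEQ.subst_congr.2 fun x hx => h x (.inr hx)]

theorem Lit.mem_vars_subst {ℓ : Lit L V} {σ : Subst L V} {y : V} :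
    y ∈ (ℓ.subst σ).vars ↔ ∃ x ∈ ℓ.vars, y ∈ tvars (σ x) := by
  obtain ⟨b, s, t, rfl⟩ := ℓ.exists_mkLit
  simp only [mkLit_subst, mem_mkLit_vars, mem_tvars_subst]
  grind

@[simp] theorem mkLit_isGround {b : Bool} {s t : L.Term V} :
    (mkLit b s t).IsGround ↔ IsGroundTerm s ∧ IsGroundTerm t := by
  simp [Lit.IsGround]

theorem Lit.IsGround.comp {ℓ : Lit L V} (h : ℓ.IsGround) : ℓ.comp.IsGround := h

theorem Lit.vars_finite (ℓ : Lit L V) : ℓ.vars.Finite := by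
  classical
  obtain ⟨b, s, t, rfl⟩ := ℓ.exists_mkLit
  refine (tvars s ∪ tvars t).finite_toSet.subset fun x hx => ?_
  simpa using hx

theorem isGround_subst_iff {ℓ : Lit L V} {σ : Subst L V} :
    (ℓ.subst σ).IsGround ↔ ∀ x ∈ ℓ.vars, IsGroundTerm (σ x) := by
  obtain ⟨b, s, t, rfl⟩ := ℓ.exists_mkLit
  simp only [mkLit_subst, mkLit_isGround, isGroundTerm_subst, mem_mkLit_vars]
  grind

section Semantics

variable {M : Type*} [L.Structure M] {a : V → M}

theorem holds_mkLit {b : Bool} {s t : L.Term V} :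
    (mkLit b s t).Holds a ↔ (b = true ↔ s.realize a = t.realize a) := by
  unfold Lit.Holds
  have : (∃ s' t', (mkLit b s t).sides = s(s', t') ∧ s'.realize a = t'.realize a) ↔
      s.realize a = t.realize a := by
    constructor
    · rintro ⟨s', t', h, h'⟩
      simp only [mkLit, Sym2.eq_iff] at h
      obtain ⟨rfl, rfl⟩ | ⟨rfl, rfl⟩ := h
      · exact h'
      · exact h'.symm
    · exact fun h => ⟨s, t, rfl, h⟩
  rw [this, mkLit_sign]

theorem holds_comp {ℓ : Lit L V} : ℓ.comp.Holds a ↔ ¬ ℓ.Holds a := by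
  obtain ⟨b, s, t, rfl⟩ := ℓ.exists_mkLit
  rw [mkLit_comp, holds_mkLit, holds_mkLit]
  cases b <;> simp

theorem holds_subst {ℓ : Lit L V} {σ : Subst L V} :
    (ℓ.subst σ).Holds a ↔ ℓ.Holds fun x => (σ x).realize a := by
  obtain ⟨b, s, t, rfl⟩ := ℓ.exists_mkLit
  rw [mkLit_subst, holds_mkLit, holds_mkLit, realize_eq_of_subst, realize_eq_of_subst]

end Semantics

/-! ### Clauses -/

namespace Clause

theorem subst_add (C D : Clause L V) (σ : Subst L V) : subst (C + D) σ = subst C σ + subst D σ :=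
  Multiset.map_add _ _ _

@[simp] theorem subst_singleton (ℓ : Lit L V) (σ : Subst L V) :
    subst {ℓ} σ = {ℓ.subst σ} := rfl

@[simp] theorem subst_cons (ℓ : Lit L V) (C : Clause L V) (σ : Subst L V) :
    subst (ℓ ::ₘ C) σ = ℓ.subst σ ::ₘ subst C σ :=
  Multiset.map_cons _ _ _

theorem subst_subst (C : Clause L V) (σ τ : Subst L V) :
    subst (subst C σ) τ = subst C fun x => (σ x).subst τ := by
  simp [subst, Lit.subst_subst]

theorem subst_var (C : Clause L V) : (subst C fun x => .var x) = C := by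
  simp [subst, Lit.subst_var]

theorem subst_congr {C : Clause L V} {σ τ : Subst L V} (h : ∀ x ∈ vars C, σ x = τ x) :
    subst C σ = subst C τ :=
  Multiset.map_congr rfl fun ℓ hℓ => Lit.subst_congr fun x hx => h x ⟨ℓ, hℓ, hx⟩

theorem mem_vars_subst {C : Clause L V} {σ : Subst L V} {y : V} :
    y ∈ vars (subst C σ) ↔ ∃ x ∈ vars C, y ∈ tvars (σ x) := by
  simp only [vars, subst, Set.mem_ofPred_eq, Multiset.mem_map]
  constructor
  · rintro ⟨_, ⟨ℓ, hℓ, rfl⟩, hy⟩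
    obtain ⟨x, hx, h⟩ := Lit.mem_vars_subst.1 hy
    exact ⟨x, ⟨ℓ, hℓ, hx⟩, h⟩
  · rintro ⟨x, ⟨ℓ, hℓ, hx⟩, h⟩
    exact ⟨_, ⟨ℓ, hℓ, rfl⟩, Lit.mem_vars_subst.2 ⟨x, hx, h⟩⟩

theorem vars_finite (C : Clause L V) : (vars C).Finite := by
  classical
  have : vars C = ⋃ ℓ ∈ C.toFinset, ℓ.vars := by
    ext x
    simp [vars]
  rw [this]
  exact C.toFinset.finite_toSet.biUnion fun ℓ _ => ℓ.vars_finite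

theorem mem_vars_cons {ℓ : Lit L V} {C : Clause L V} {x : V} :
    x ∈ vars (ℓ ::ₘ C) ↔ x ∈ ℓ.vars ∨ x ∈ vars C := by
  simp [vars]

theorem mem_vars_add {C D : Clause L V} {x : V} :
    x ∈ vars (C + D) ↔ x ∈ vars C ∨ x ∈ vars D := by
  simp only [vars, Set.mem_ofPred_eq, Multiset.mem_add]
  grind

theorem isGround_subst_iff {C : Clause L V} {σ : Subst L V} :
    IsGround (subst C σ) ↔ ∀ x ∈ vars C, IsGroundTerm (σ x) := by
  constructor
  · rintro h x ⟨ℓ, hℓ, hx⟩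
    exact SCLEQ.isGround_subst_iff.1 (h _ (Multiset.mem_map_of_mem _ hℓ)) x hx
  · intro h κ hκ
    obtain ⟨ℓ, hℓ, rfl⟩ := Multiset.mem_map.1 hκ
    exact SCLEQ.isGround_subst_iff.2 fun x hx => h x ⟨ℓ, hℓ, hx⟩

/-- The clause holds in `M` under every assignment. -/
def Valid (M : Type*) [L.Structure M] (C : Clause L V) : Prop :=
  ∀ a : V → M, ∃ ℓ ∈ C, ℓ.Holds a

variable {M : Type*} [L.Structure M]

theorem Valid.subst {C : Clause L V} (h : Valid M C) (σ : Subst L V) :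
    Valid M (subst C σ) := by
  intro a
  obtain ⟨ℓ, hℓ, h⟩ := h fun x => (σ x).realize a
  exact ⟨_, Multiset.mem_map_of_mem _ hℓ, holds_subst.2 h⟩

end Clause

/-! ### Entailment -/

theorem Entails.mono {G H : Set (Lit L V)} (h : G ⊆ H) {ℓ : Lit L V} (hG : Entails G ℓ) :
    Entails H ℓ := fun M _ _ a hH => hG M a fun g hg => hH g (h hg)

theorem Defined.mono {G H : Set (Lit L V)} (h : G ⊆ H) {ℓ : Lit L V} (hG : Defined G ℓ) :
    Defined H ℓ := hG.imp (Entails.mono h) (Entails.mono h)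

theorem entails_of_mem {G : Set (Lit L V)} {ℓ : Lit L V} (h : ℓ ∈ G) : Entails G ℓ :=
  fun _ _ _ _ hG => hG ℓ h

theorem defined_comp {G : Set (Lit L V)} {ℓ : Lit L V} : Defined G ℓ.comp ↔ Defined G ℓ := by
  unfold Defined
  rw [Lit.comp_comp, or_comm]

/-- The set of literals has a model. -/
def Consistent (G : Set (Lit L V)) : Prop :=
  ∃ (M : Type (max u w)) (_ : Nonempty M) (_ : L.Structure M) (a : V → M), ∀ g ∈ G, g.Holds a

theorem Consistent.mono {G H : Set (Lit L V)} (h : G ⊆ H) (hH : Consistent H) :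
    Consistent G := by
  obtain ⟨M, i, j, a, h'⟩ := hH
  exact ⟨M, i, j, a, fun g hg => h' g (h hg)⟩

theorem Consistent.not_entails_comp {G : Set (Lit L V)} (h : Consistent G) {ℓ : Lit L V}
    (h1 : Entails G ℓ) : ¬ Entails G ℓ.comp := by
  obtain ⟨M, i, j, a, hG⟩ := h
  exact fun h2 => holds_comp.1 (h2 M a hG) (h1 M a hG)

/-- A countermodel to `comp ℓ` satisfies `ℓ`. This keeps trails consistent, since only undefined
literals are added. -/
theorem consistent_insert_of_not_entails_comp {G : Set (Lit L V)} {ℓ : Lit L V}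
    (h : ¬ Entails G ℓ.comp) : Consistent (insert ℓ G) := by
  simp only [Entails, not_forall] at h
  obtain ⟨M, i, j, a, hG, hℓ⟩ := h
  refine ⟨M, i, j, a, fun g hg => ?_⟩
  obtain rfl | hg := hg
  · exact not_not.1 fun h => hℓ (holds_comp.2 h)
  · exact hG g hg

end Terms

end SCLEQ

namespace SCLEQ

/-! ### Comparison with the bound `β`, and ground rewriting. -/

section Orderings

variable {L : FirstOrder.Language.{u, v}} {V : Type w}

open FirstOrder.Language (Term)

/-! ### Bounds and the term ordering -/

/-- As `Z` is nonempty, a singleton leaves no room for the common part `X`. Comparisons with `β`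
thereby become pointwise, for literals and for clauses. -/
theorem mulLT_singleton {α : Type*} {r : α → α → Prop} {A : Multiset α} {b : α} :
    MulLT r A {b} ↔ ∀ a ∈ A, r a b := by
  constructor
  · rintro ⟨X, Y, Z, hZ, rfl, h, hY⟩
    have hX : X = 0 := by
      have := congrArg Multiset.card h
      have hZ' := Multiset.card_pos.2 hZ
      simp only [Multiset.card_singleton, Multiset.card_add] at this
      exact Multiset.card_eq_zero.1 (by omega)
    subst hX
    rw [zero_add] at h
    subst h
    simpa using hY
  · intro h
    exact ⟨0, A, {b}, by simp, by simp, by simp, fun y hy => ⟨b, by simp, h y hy⟩⟩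

theorem mem_mset {ℓ : Lit L V} {t : L.Term V} : t ∈ ℓ.mset ↔ t ∈ ℓ.sides := by
  unfold Lit.mset
  have h : t ∈ ℓ.sides.toMultiset ↔ t ∈ ℓ.sides := Sym2.mem_toMultiset
  split_ifs <;> simp [h]

variable {lt : L.Term V → L.Term V → Prop} {β : L.Term V}

theorem litBelow_iff {ℓ : Lit L V} : litBelow lt β ℓ ↔ ∀ t ∈ ℓ.sides, lt t β := by
  simp [litBelow, mulLT_singleton, mem_mset]

@[simp] theorem litBelow_mkLit {b : Bool} {s t : L.Term V} :
    litBelow lt β (mkLit b s t) ↔ lt s β ∧ lt t β := by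
  simp [litBelow_iff]

theorem litBelow_comp {ℓ : Lit L V} : litBelow lt β ℓ.comp ↔ litBelow lt β ℓ := by
  simp [litBelow_iff]

theorem clauseBelow_iff {C : Clause L V} :
    clauseBelow lt β C ↔ ∀ ℓ ∈ C, litBelow lt β ℓ := by
  have : clauseBelow lt β C ↔ MulLT (MulLT lt) (C.map Lit.mset) {({β} : Multiset _)} := Iff.rfl
  rw [this, mulLT_singleton]
  simp [litBelow]

/-- Either case would put `β` below itself. Consequently, for literals below `β` being `β`-undefined
is the same as being undefined. -/
theorem litBelow.not_litAbove (hlt : IsDesired lt) {ℓ : Lit L V} (h : litBelow lt β ℓ) :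
    ¬ litAbove lt β ℓ := by
  rintro ⟨X, Y, Z, hZ, h1, h2, hY⟩
  have hb : β ∈ X + Y := by rw [← h1]; simp
  have hm : ∀ t ∈ X + Z, lt t β := fun t ht => litBelow_iff.1 h t (mem_mset.1 (h2 ▸ ht))
  obtain hX | hX := Multiset.mem_add.1 hb
  · exact hlt.irrefl β (hm β (Multiset.mem_add.2 (.inl hX)))
  · obtain ⟨z, hz, hz'⟩ := hY β hX
    exact hlt.irrefl β (hlt.trans _ _ _ hz' (hm z (Multiset.mem_add.2 (.inr hz))))

theorem litBelow.bUndef_iff (hlt : IsDesired lt) {ℓ : Lit L V} (h : litBelow lt β ℓ)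
    {Γ : Trail L V} : BUndef lt β Γ ℓ ↔ ¬ Defined (glits Γ) ℓ :=
  ⟨fun h' => h'.resolve_left (h.not_litAbove hlt), .inr⟩

theorem litBelow.bDef_iff (hlt : IsDesired lt) {ℓ : Lit L V} (h : litBelow lt β ℓ)
    {Γ : Trail L V} : BDef lt β Γ ℓ ↔ Defined (glits Γ) ℓ := by
  rw [BDef, h.bUndef_iff hlt, not_not]

/-- The ground literals below `β`. -/
def boundedLits (lt : L.Term V → L.Term V → Prop) (β : L.Term V) : Set (Lit L V) :=
  {ℓ | ℓ.IsGround ∧ litBelow lt β ℓ}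

/-- The finiteness on which termination rests: a sign and two of the finitely many ground terms
below `β` determine the literal. -/
theorem boundedLits_finite (hlt : IsDesired lt) (hβ : IsGroundTerm β) :
    (boundedLits lt β).Finite := by
  have h := hlt.finite β hβ
  refine ((Set.finite_univ (α := Bool)).prod (h.prod h)).image
    (fun e => mkLit e.1 e.2.1 e.2.2) |>.subset ?_
  rintro ℓ ⟨h1, h2⟩
  obtain ⟨b, s, t, rfl⟩ := ℓ.exists_mkLit
  rw [mkLit_isGround] at h1
  rw [litBelow_mkLit] at h2
  exact ⟨(b, s, t), ⟨trivial, ⟨h1.1, h2.1⟩, ⟨h1.2, h2.2⟩⟩, rfl⟩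

theorem IsDesired.replaceAt_lt (hlt : IsDesired lt) {t l r : L.Term V} {p : List ℕ}
    (h : subtermAt t p = some l) (hr : lt r l) : lt (replaceAt t p r) t := by
  have := hlt.context r l t p (isPos_of_subtermAt h) hr
  rwa [replaceAt_self h] at this

/-! ### Ground rewriting -/

/-- A system of ground rules, oriented by `lt`. -/
def GroundOriented (lt : L.Term V → L.Term V → Prop) (R : TRS L V) : Prop :=
  ∀ l r, (l, r) ∈ R → IsGroundTerm l ∧ IsGroundTerm r ∧ lt r l

variable {R : TRS L V}

theorem GroundOriented.rewrites_iff (hR : GroundOriented lt R) {s t : L.Term V} :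
    Rewrites R s t ↔ ∃ l r p, (l, r) ∈ R ∧ subtermAt s p = some l ∧ t = replaceAt s p r := by
  constructor
  · rintro ⟨l, r, h, p, σ, h1, h2⟩
    obtain ⟨hl, hr, _⟩ := hR l r h
    rw [hl.subst_eq] at h1
    rw [hr.subst_eq] at h2
    exact ⟨l, r, p, h, h1, h2⟩
  · rintro ⟨l, r, p, h, h1, h2⟩
    obtain ⟨hl, hr, _⟩ := hR l r h
    exact ⟨l, r, h, p, fun x => .var x, by rwa [hl.subst_eq], by rwa [hr.subst_eq]⟩

theorem GroundOriented.lt_of_rewrites (hR : GroundOriented lt R) (hlt : IsDesired lt)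
    {s t : L.Term V} (h : Rewrites R s t) : lt t s := by
  obtain ⟨l, r, p, h2, h1, rfl⟩ := hR.rewrites_iff.1 h
  exact hlt.replaceAt_lt h1 (hR l r h2).2.2

theorem GroundOriented.isGroundTerm (hR : GroundOriented lt R)
    {s t : L.Term V} (h : Relation.ReflTransGen (Rewrites R) s t) (hs : IsGroundTerm s) :
    IsGroundTerm t := by
  induction h with
  | refl => exact hs
  | tail _ h ih =>
    obtain ⟨l, r, p, h2, h1, rfl⟩ := hR.rewrites_iff.1 h
    exact ih.replaceAt (hR l r h2).2.1 p

theorem GroundOriented.eq_or_lt (hR : GroundOriented lt R) (hlt : IsDesired lt)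
    {s t : L.Term V} (h : Relation.ReflTransGen (Rewrites R) s t) : t = s ∨ lt t s := by
  induction h with
  | refl => exact .inl rfl
  | tail _ h ih =>
    have h' := hR.lt_of_rewrites hlt h
    exact .inr (ih.elim (fun h => h ▸ h') fun h => hlt.trans _ _ _ h' h)

theorem GroundOriented.exists_isNormalForm (hR : GroundOriented lt R) (hlt : IsDesired lt)
    (s : L.Term V) : ∃ t, IsNormalForm R s t := by
  induction s using hlt.wf.induction with
  | _ s ih =>
    by_cases h : Irreducible R s
    · exact ⟨s, .refl, h⟩
    · simp only [Irreducible, not_forall, not_not] at h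
      obtain ⟨s', h⟩ := h
      obtain ⟨t, ht, ht'⟩ := ih s' (hR.lt_of_rewrites hlt h)
      exact ⟨t, .head h ht, ht'⟩

/-- A redex in `σ x` is a redex in `tσ`. Thus an irreducible ground literal has only irreducible
terms substituted into it, and normalising the substitution does not alter it. -/
theorem GroundOriented.irreducible_of_subst (hR : GroundOriented lt R) {t : L.Term V}
    {σ : Subst L V} (h : Irreducible R (t.subst σ)) {x : V} (hx : x ∈ tvars t) :
    Irreducible R (σ x) := by
  induction t with
  | var y => rw [mem_tvars_var] at hx; exact hx ▸ h
  | func f ts ih =>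
    obtain ⟨i, hi⟩ := mem_tvars_func.1 hx
    refine ih i ?_ hi
    intro t' ht'
    obtain ⟨l, r, p, h1, h2, rfl⟩ := hR.rewrites_iff.1 ht'
    refine h (replaceAt ((Term.func f ts).subst σ) (i :: p) r) (hR.rewrites_iff.2
      ⟨l, r, i :: p, h1, ?_, rfl⟩)
    simp only [Term.subst]
    exact subtermAt_func_cons_eq_some.2 ⟨i.2, h2⟩

/-- The literal `κ` results from `ℓ` by rewriting its sides. -/
def LitReduces (R : TRS L V) (ℓ κ : Lit L V) : Prop :=
  ∃ b s t s' t', ℓ = mkLit b s t ∧ κ = mkLit b s' t' ∧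
    Relation.ReflTransGen (Rewrites R) s s' ∧ Relation.ReflTransGen (Rewrites R) t t'

theorem LitReduces.litBelow (hR : GroundOriented lt R) (hlt : IsDesired lt) {ℓ κ : Lit L V}
    (h : LitReduces R ℓ κ) (hℓ : litBelow lt β ℓ) : litBelow lt β κ := by
  obtain ⟨b, s, t, s', t', rfl, rfl, h1, h2⟩ := h
  rw [litBelow_mkLit] at hℓ ⊢
  constructor
  · obtain h | h := hR.eq_or_lt hlt h1
    · exact h ▸ hℓ.1
    · exact hlt.trans _ _ _ h hℓ.1
  · obtain h | h := hR.eq_or_lt hlt h2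
    · exact h ▸ hℓ.2
    · exact hlt.trans _ _ _ h hℓ.2

theorem LitReduces.isGround (hR : GroundOriented lt R) {ℓ κ : Lit L V}
    (h : LitReduces R ℓ κ) (hℓ : ℓ.IsGround) : κ.IsGround := by
  obtain ⟨b, s, t, s', t', rfl, rfl, h1, h2⟩ := h
  rw [mkLit_isGround] at hℓ ⊢
  exact ⟨hR.isGroundTerm h1 hℓ.1, hR.isGroundTerm h2 hℓ.2⟩

theorem groundOriented_conv (G : Set (Lit L V)) : GroundOriented lt (conv lt G) :=
  fun _ _ h => ⟨h.1, h.2.1, h.2.2.1⟩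

/-- Every rule of `conv` is entailed by the positive part of `G`. Hence rewriting preserves values
in every model of `G`, and so truth, falsity and definedness in `G`. -/
theorem realize_eq_of_rewrites_conv {G : Set (Lit L V)} {M : Type (max u w)} [Nonempty M]
    [L.Structure M] {a : V → M} (hG : ∀ g ∈ G, g.Holds a) {s t : L.Term V}
    (h : Relation.ReflTransGen (Rewrites (conv lt G)) s t) : t.realize a = s.realize a := by
  induction h with
  | refl => rfl
  | tail _ h ih =>
    obtain ⟨l, r, p, h1, h2, rfl⟩ := (groundOriented_conv G).rewrites_iff.1 h
    rw [← ih]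
    refine realize_replaceAt h2 ?_
    have := h1.2.2.2 M a fun g hg => hG g hg.1
    rw [holds_mkLit] at this
    exact (this.1 rfl).symm

theorem LitReduces.holds_iff {G : Set (Lit L V)} {ℓ κ : Lit L V}
    (h : LitReduces (conv lt G) ℓ κ) {M : Type (max u w)} [Nonempty M]
    [L.Structure M] {a : V → M} (hG : ∀ g ∈ G, g.Holds a) : κ.Holds a ↔ ℓ.Holds a := by
  obtain ⟨b, s, t, s', t', rfl, rfl, h1, h2⟩ := h
  rw [holds_mkLit, holds_mkLit, realize_eq_of_rewrites_conv hG h1,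
    realize_eq_of_rewrites_conv hG h2]

theorem LitReduces.entails_iff {G : Set (Lit L V)} {ℓ κ : Lit L V}
    (h : LitReduces (conv lt G) ℓ κ) : Entails G κ ↔ Entails G ℓ :=
  ⟨fun h' M _ _ a hG => (h.holds_iff hG).1 (h' M a hG),
    fun h' M _ _ a hG => (h.holds_iff hG).2 (h' M a hG)⟩

theorem LitReduces.comp {ℓ κ : Lit L V} (h : LitReduces R ℓ κ) : LitReduces R ℓ.comp κ.comp := by
  obtain ⟨b, s, t, s', t', rfl, rfl, h1, h2⟩ := h
  exact ⟨!b, s, t, s', t', rfl, rfl, h1, h2⟩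

theorem LitReduces.defined_iff {G : Set (Lit L V)} {ℓ κ : Lit L V}
    (h : LitReduces (conv lt G) ℓ κ) : Defined G κ ↔ Defined G ℓ :=
  or_congr h.entails_iff h.comp.entails_iff

theorem Rewrites.func {n : ℕ} {f : L.Functions n} {ts : Fin n → L.Term V} (i : Fin n)
    {u : L.Term V} (h : Rewrites R (ts i) u) :
    Rewrites R (.func f ts) (.func f (Function.update ts i u)) := by
  obtain ⟨l, r, h, p, σ, h1, rfl⟩ := h
  refine ⟨l, r, h, i :: p, σ, subtermAt_func_cons_eq_some.2 ⟨i.2, h1⟩, ?_⟩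
  rw [replaceAt_func_cons]
  congr 1
  funext j
  by_cases hj : j = i
  · subst hj
    simp
  · rw [Function.update_of_ne hj, if_neg fun h => hj (Fin.ext h)]

theorem reflTransGen_rewrites_arg {n : ℕ} {f : L.Functions n} {ts : Fin n → L.Term V} (i : Fin n)
    {u : L.Term V} (h : Relation.ReflTransGen (Rewrites R) (ts i) u) :
    Relation.ReflTransGen (Rewrites R) (.func f ts) (.func f (Function.update ts i u)) := by
  induction h with
  | refl => rw [Function.update_eq_self]
  | tail _ h ih =>
    refine ih.tail ?_
    have := Rewrites.func (f := f) (ts := Function.update ts i _) i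
      (by rw [Function.update_self]; exact h)
    rwa [Function.update_idem] at this

theorem reflTransGen_rewrites_args {n : ℕ} {f : L.Functions n} {ts us : Fin n → L.Term V}
    (h : ∀ i, Relation.ReflTransGen (Rewrites R) (ts i) (us i)) :
    Relation.ReflTransGen (Rewrites R) (.func f ts) (.func f us) := by
  classical
  -- The arguments are rewritten one after the other; `s` collects those that are done.
  have key : ∀ s : Finset (Fin n), Relation.ReflTransGen (Rewrites R) (.func f ts)
      (.func f fun i => if i ∈ s then us i else ts i) := by
    intro s
    induction s using Finset.induction_on with
    | empty => simpa using .refl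
    | insert i s hi ih =>
      refine ih.trans ?_
      have := reflTransGen_rewrites_arg (R := R) (f := f)
        (ts := fun j => if j ∈ s then us j else ts j) i (u := us i) (by simpa [hi] using h i)
      convert this using 2
      funext j
      by_cases hj : j = i
      · subst hj
        simp
      · simp [hj]
  simpa using key Finset.univ

theorem reflTransGen_rewrites_subst {t : L.Term V} {σ τ : Subst L V}
    (h : ∀ x ∈ tvars t, Relation.ReflTransGen (Rewrites R) (σ x) (τ x)) :
    Relation.ReflTransGen (Rewrites R) (t.subst σ) (t.subst τ) := by
  induction t with
  | var x => exact h x (mem_tvars_var.2 rfl)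
  | func f ts ih =>
    simp only [Term.subst]
    exact reflTransGen_rewrites_args fun i => ih i fun x hx => h x (mem_tvars_func.2 ⟨i, hx⟩)

theorem litReduces_subst {ℓ : Lit L V} {σ τ : Subst L V}
    (h : ∀ x ∈ ℓ.vars, Relation.ReflTransGen (Rewrites R) (σ x) (τ x)) :
    LitReduces R (ℓ.subst σ) (ℓ.subst τ) := by
  obtain ⟨b, s, t, rfl⟩ := ℓ.exists_mkLit
  exact ⟨b, _, _, _, _, mkLit_subst _ _ _ _, mkLit_subst _ _ _ _,
    reflTransGen_rewrites_subst fun x hx => h x (by simp [hx]),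
    reflTransGen_rewrites_subst fun x hx => h x (by simp [hx])⟩

/-- A grounding substitution can be replaced by an irreducible one. -/
theorem exists_irreducibleSubst (hlt : IsDesired lt) (G : Set (Lit L V)) {C : Clause L V}
    {τ : Subst L V} (hτ : Clause.Grounds τ C) :
    ∃ τ', IrreducibleSubst (conv lt G) τ' ∧ Clause.Grounds τ' C ∧
      (∀ ℓ ∈ C, LitReduces (conv lt G) (ℓ.subst τ) (ℓ.subst τ')) ∧
      ∀ x ∈ Clause.vars C, Irreducible (conv lt G) (τ x) → τ' x = τ x := by
  classical
  choose nf hnf using (groundOriented_conv (lt := lt) G).exists_isNormalForm hlt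
  have hτ' := Clause.isGround_subst_iff.1 hτ
  -- Off the variables of `C` the identity is chosen: `IrreducibleSubst` ignores such variables,
  -- whereas values of `τ` there could be reducible.
  refine ⟨fun x => if x ∈ Clause.vars C then nf (τ x) else .var x, ?_, ?_, ?_, ?_⟩
  · intro x hx
    by_cases h : x ∈ Clause.vars C
    · simp only [h, if_true]
      exact (hnf (τ x)).2
    · simp [h] at hx
  · refine Clause.isGround_subst_iff.2 fun x hx => ?_
    simp only [hx, if_true]
    exact (groundOriented_conv G).isGroundTerm (hnf (τ x)).1 (hτ' x hx)
  · intro ℓ hℓ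
    refine litReduces_subst fun x hx => ?_
    have : x ∈ Clause.vars C := ⟨ℓ, hℓ, hx⟩
    simp only [this, if_true]
    exact (hnf (τ x)).1
  · intro x hx h
    simp only [hx, if_true]
    obtain h' | ⟨c, hc, -⟩ := (hnf (τ x)).1.cases_head
    · exact h'.symm
    · exact absurd hc (h c)

end Orderings

end SCLEQ

namespace SCLEQ

/-! ### Most general unifiers and most general instances with a given position. -/

section Unification

variable {L : FirstOrder.Language.{u, v}} {V : Type w}

open FirstOrder.Language (Term)

/-! ### Most general unifiers -/

theorem isMGU_empty : IsMGU (∅ : Set (L.Term V × L.Term V)) fun x => .var x where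
  unifies := fun _ he => he.elim
  general := fun θ _ => ⟨θ, fun _ => rfl⟩
  idem := fun _ => rfl
  off := fun _ _ => rfl
  noFresh := fun _ ⟨_, he, _⟩ => he.elim

/-- With `θ = μη`, idempotence gives `μθ = μμη = μη = θ`. This is why the rules can keep the
grounding substitution `σ` after applying `μ` to a clause. -/
theorem IsMGU.subst_subst {E : Set (L.Term V × L.Term V)} {μ θ : Subst L V} (h : IsMGU E μ)
    (hθ : Unifies E θ) (x : V) : (μ x).subst θ = θ x := by
  obtain ⟨η, hη⟩ := h.general θ hθ
  have : θ = fun x => (μ x).subst η := funext hη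
  rw [hη x]
  conv_lhs => rw [this]
  rw [← SCLEQ.subst_subst, h.idem]

theorem IsMGU.lit {E : Set (L.Term V × L.Term V)} {μ θ : Subst L V} (h : IsMGU E μ)
    (hθ : Unifies E θ) (ℓ : Lit L V) : (ℓ.subst μ).subst θ = ℓ.subst θ := by
  rw [Lit.subst_subst]
  exact Lit.subst_congr fun x _ => h.subst_subst hθ x

theorem IsMGU.clause {E : Set (L.Term V × L.Term V)} {μ θ : Subst L V} (h : IsMGU E μ)
    (hθ : Unifies E θ) (C : Clause L V) :
    Clause.subst (Clause.subst C μ) θ = Clause.subst C θ := by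
  rw [Clause.subst_subst]
  exact Clause.subst_congr fun x _ => h.subst_subst hθ x

theorem IsMGU.congr {E F : Set (L.Term V × L.Term V)} {μ : Subst L V} (h : IsMGU E μ)
    (hu : ∀ θ, Unifies E θ ↔ Unifies F θ) (hv : eqVars E ⊆ eqVars F) : IsMGU F μ where
  unifies := (hu μ).1 h.unifies
  general := fun θ hθ => h.general θ ((hu θ).2 hθ)
  idem := h.idem
  off := fun x hx => h.off x fun hx' => hx (hv hx')
  noFresh := by
    intro x hx y hy
    by_cases hx' : x ∈ eqVars E
    · exact hv (h.noFresh x hx' y hy)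
    · rw [h.off x hx', mem_tvars_var] at hy
      exact hy ▸ hx

/-- The number of symbols of a term. -/
def tsize : L.Term V → ℕ
  | .var _ => 1
  | .func _ ts => 1 + ∑ i, tsize (ts i)

/-- The equations in a list. -/
def eqSet (E : List (L.Term V × L.Term V)) : Set (L.Term V × L.Term V) := {e | e ∈ E}

theorem eqVars_finite (E : List (L.Term V × L.Term V)) : (eqVars (eqSet E)).Finite := by
  classical
  have : eqVars (eqSet E) = ⋃ e ∈ E.toFinset, ((tvars e.1 ∪ tvars e.2 : Finset V) : Set V) := by
    ext x
    simp [eqVars, eqSet]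
  rw [this]
  exact E.toFinset.finite_toSet.biUnion fun e _ => Finset.finite_toSet _

theorem unifies_cons {e : L.Term V × L.Term V} {E : List (L.Term V × L.Term V)} {θ : Subst L V} :
    Unifies (eqSet (e :: E)) θ ↔ e.1.subst θ = e.2.subst θ ∧ Unifies (eqSet E) θ := by
  simp [Unifies, eqSet]

theorem mem_eqVars_cons {e : L.Term V × L.Term V} {E : List (L.Term V × L.Term V)} {x : V} :
    x ∈ eqVars (eqSet (e :: E)) ↔ (x ∈ tvars e.1 ∨ x ∈ tvars e.2) ∨ x ∈ eqVars (eqSet E) := by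
  simp [eqVars, eqSet]

open Classical in
/-- The substitution that maps `x` to `t`. -/
noncomputable def bind (x : V) (t : L.Term V) : Subst L V := Function.update (fun y => .var y) x t

theorem bind_self (x : V) (t : L.Term V) : bind x t x = t := by
  simp [bind]

theorem bind_of_ne {x y : V} (h : y ≠ x) (t : L.Term V) : bind x t y = .var y := by
  simp [bind, h]

theorem subst_bind_of_notMem {x : V} {s t : L.Term V} (h : x ∉ tvars s) : s.subst (bind x t) = s :=
  subst_eq_self fun y hy => bind_of_ne (by rintro rfl; exact h hy) t

theorem subst_bind_subst {x : V} {s t : L.Term V} {θ : Subst L V} (h : θ x = t.subst θ) :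
    (s.subst (bind x t)).subst θ = s.subst θ := by
  rw [SCLEQ.subst_subst]
  refine subst_congr.2 fun y _ => ?_
  by_cases hy : y = x
  · subst hy
    rw [bind_self, h]
  · rw [bind_of_ne hy]
    rfl

theorem mem_tvars_subst_bind {x y : V} {s t : L.Term V} (hx : x ∉ tvars t)
    (h : y ∈ tvars (s.subst (bind x t))) : y ≠ x ∧ (y ∈ tvars s ∨ y ∈ tvars t) := by
  obtain ⟨z, hz, hy⟩ := mem_tvars_subst.1 h
  by_cases hzx : z = x
  · subst hzx
    rw [bind_self] at hy
    exact ⟨fun e => hx (e ▸ hy), .inr hy⟩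
  · rw [bind_of_ne hzx, mem_tvars_var] at hy
    subst hy
    exact ⟨hzx, .inl hz⟩

/-- Elimination of a variable in a unification problem. -/
theorem isMGU_elim {x : V} {t : L.Term V} (hx : x ∉ tvars t) {E : List (L.Term V × L.Term V)}
    {μ : Subst L V}
    (h : IsMGU (eqSet (E.map fun e => (e.1.subst (bind x t), e.2.subst (bind x t)))) μ) :
    IsMGU (eqSet ((.var x, t) :: E)) fun y => (bind x t y).subst μ := by
  set E' := E.map fun e => (e.1.subst (bind x t), e.2.subst (bind x t)) with hE'
  have hvars : ∀ y ∈ eqVars (eqSet E'), y ≠ x ∧ y ∈ eqVars (eqSet ((.var x, t) :: E)) := by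
    rintro y ⟨e, he, hy⟩
    obtain ⟨e, he', rfl⟩ := List.mem_map.1 he
    rw [mem_eqVars_cons]
    obtain hy | hy := hy
    · obtain ⟨h1, h2⟩ := mem_tvars_subst_bind hx hy
      exact ⟨h1, h2.elim (fun h => .inr ⟨e, he', .inl h⟩) fun h => .inl (.inr h)⟩
    · obtain ⟨h1, h2⟩ := mem_tvars_subst_bind hx hy
      exact ⟨h1, h2.elim (fun h => .inr ⟨e, he', .inr h⟩) fun h => .inl (.inr h)⟩
  have hμvars : ∀ z, z ≠ x → ∀ y ∈ tvars (μ z), y ≠ x := by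
    intro z hz y hy
    by_cases hz' : z ∈ eqVars (eqSet E')
    · exact (hvars y (h.noFresh z hz' y hy)).1
    · rw [h.off z hz', mem_tvars_var] at hy
      exact hy ▸ hz
  have hb : ∀ z, ∀ y ∈ tvars (bind x t z), y ≠ x := by
    intro z y hy
    have : y ∈ tvars ((Term.var z : L.Term V).subst (bind x t)) := hy
    exact (mem_tvars_subst_bind hx this).1
  have hbt : ∀ s : L.Term V, s.subst (fun y => (bind x t y).subst μ) =
      (s.subst (bind x t)).subst μ := fun s => (SCLEQ.subst_subst s _ _).symm
  refine ⟨?_, ?_, ?_, ?_, ?_⟩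
  · rw [unifies_cons]
    refine ⟨?_, fun e he => ?_⟩
    · simp only [hbt]
      rw [subst_bind_of_notMem hx]
      simp only [Term.subst, bind_self]
    · rw [hbt, hbt]
      exact h.unifies (e.1.subst (bind x t), e.2.subst (bind x t))
        (List.mem_map.2 ⟨e, he, rfl⟩)
  · intro θ hθ
    rw [unifies_cons] at hθ
    obtain ⟨h1, h2⟩ := hθ
    have h1' : θ x = t.subst θ := h1
    obtain ⟨η, hη⟩ := h.general θ (by
      intro e he
      obtain ⟨e, he', rfl⟩ := List.mem_map.1 he
      rw [subst_bind_subst h1', subst_bind_subst h1']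
      exact h2 e he')
    refine ⟨η, fun y => ?_⟩
    have hθ : θ = fun x => (μ x).subst η := funext hη
    rw [SCLEQ.subst_subst, ← hθ]
    exact (subst_bind_subst (s := .var y) h1').symm
  · intro y
    have : ((bind x t y).subst μ).subst (fun y => (bind x t y).subst μ) =
        ((bind x t y).subst μ).subst μ := by
      refine subst_congr.2 fun z hz => ?_
      obtain ⟨z', hz', hz⟩ := mem_tvars_subst.1 hz
      rw [bind_of_ne (hμvars z' (hb y z' hz') z hz)]
      rfl
    rw [this, SCLEQ.subst_subst]
    exact subst_congr.2 fun z _ => h.idem z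
  · intro y hy
    have hyx : y ≠ x := fun e => hy (mem_eqVars_cons.2 (.inl (.inl (mem_tvars_var.2 e))))
    simp only [bind_of_ne hyx, Term.subst]
    exact h.off y fun h' => hy (hvars y h').2
  · intro y hy z hz
    obtain ⟨y', hy', hz⟩ := mem_tvars_subst.1 hz
    have hy'' : y' ∈ eqVars (eqSet ((.var x, t) :: E)) := by
      by_cases hyx : y = x
      · subst hyx
        rw [bind_self] at hy'
        exact mem_eqVars_cons.2 (.inl (.inr hy'))
      · rw [bind_of_ne hyx, mem_tvars_var] at hy'
        exact hy' ▸ hy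
    by_cases h' : y' ∈ eqVars (eqSet E')
    · exact (hvars z (h.noFresh y' h' z hz)).2
    · rw [h.off y' h', mem_tvars_var] at hz
      exact hz ▸ hy''

/-- The occurs check: if `x` occurred in an argument, `θ x` would be at most as large as the
instance of that argument, hence strictly smaller than itself. -/
theorem notMem_tvars_of_subst_eq {x : V} {n : ℕ} {f : L.Functions n} {ts : Fin n → L.Term V}
    {θ : Subst L V} (h : θ x = (Term.func f ts).subst θ) : x ∉ tvars (Term.func f ts) := by
  have key : ∀ t : L.Term V, x ∈ tvars t → tsize (θ x) ≤ tsize (t.subst θ) := by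
    intro t
    induction t with
    | var y => intro hx; rw [mem_tvars_var] at hx; exact hx ▸ le_rfl
    | func g us ih =>
      intro hx
      obtain ⟨i, hi⟩ := mem_tvars_func.1 hx
      simp only [Term.subst, tsize]
      have := Finset.single_le_sum (f := fun i => tsize ((us i).subst θ))
        (fun _ _ => Nat.zero_le _) (Finset.mem_univ i)
      have := ih i hi
      omega
  intro hx
  obtain ⟨i, hi⟩ := mem_tvars_func.1 hx
  have h1 := key _ hi
  have h2 := congrArg tsize h
  simp only [Term.subst, tsize] at h2
  have := Finset.single_le_sum (f := fun i => tsize ((ts i).subst θ))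
    (fun _ _ => Nat.zero_le _) (Finset.mem_univ i)
  omega

/-- The unification algorithm, by lexicographic induction on the number of variables and the total
size. Elimination lowers the number of variables; decomposition keeps it and lowers the size;
deletion of `x = x` lowers one of the two. The unifier `θ` excludes symbol clashes and failures of
the occurs check. -/
theorem exists_isMGU_list (E : List (L.Term V × L.Term V)) (θ : Subst L V)
    (hθ : Unifies (eqSet E) θ) : ∃ μ, IsMGU (eqSet E) μ := by
  induction hn : (eqVars (eqSet E)).ncard using Nat.strong_induction_on generalizing E with
  | _ n ihn =>
  induction hm : (E.map fun e => tsize e.1 + tsize e.2).sum using Nat.strong_induction_on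
    generalizing E with
  | _ m ihm =>
  have elim : ∀ (x : V) (t : L.Term V) (F : List (L.Term V × L.Term V)), x ∉ tvars t →
      Unifies (eqSet ((.var x, t) :: F)) θ → (eqVars (eqSet ((.var x, t) :: F))).ncard = n →
      ∃ μ, IsMGU (eqSet ((.var x, t) :: F)) μ := by
    intro x t F hx hF hc
    obtain ⟨h1, h2⟩ := unifies_cons.1 hF
    have h1' : θ x = t.subst θ := h1
    have hlt : (eqVars (eqSet (F.map fun e => (e.1.subst (bind x t),
        e.2.subst (bind x t))))).ncard < n := by
      rw [← hc]
      refine Set.ncard_lt_ncard (Set.ssubset_iff_exists.2 ⟨?_, x, ?_, ?_⟩) (eqVars_finite _)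
      · rintro y ⟨e, he, hy⟩
        obtain ⟨e, he', rfl⟩ := List.mem_map.1 he
        rw [mem_eqVars_cons]
        obtain hy | hy := hy
        · exact (mem_tvars_subst_bind hx hy).2.elim (fun h => .inr ⟨e, he', .inl h⟩)
            fun h => .inl (.inr h)
        · exact (mem_tvars_subst_bind hx hy).2.elim (fun h => .inr ⟨e, he', .inr h⟩)
            fun h => .inl (.inr h)
      · exact mem_eqVars_cons.2 (.inl (.inl (mem_tvars_var.2 rfl)))
      · rintro ⟨e, he, hy⟩
        obtain ⟨e, he', rfl⟩ := List.mem_map.1 he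
        obtain hy | hy := hy
        · exact (mem_tvars_subst_bind hx hy).1 rfl
        · exact (mem_tvars_subst_bind hx hy).1 rfl
    obtain ⟨μ, hμ⟩ := ihn _ hlt (F.map fun e => (e.1.subst (bind x t), e.2.subst (bind x t))) (by
      intro e he
      obtain ⟨e, he', rfl⟩ := List.mem_map.1 he
      rw [subst_bind_subst h1', subst_bind_subst h1']
      exact h2 e he') rfl
    exact ⟨_, isMGU_elim hx hμ⟩
  match E, hθ, hn, hm with
  | [], _, _, _ => exact ⟨_, (by simpa [eqSet] using isMGU_empty)⟩
  | (.var x, .var y) :: E, hθ, hn, hm =>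
    by_cases hxy : x = y
    · subst hxy
      by_cases hx : x ∈ eqVars (eqSet E)
      · have hv : eqVars (eqSet E) = eqVars (eqSet ((.var x, .var x) :: E)) := by
          ext z
          simp only [mem_eqVars_cons, mem_tvars_var]
          grind
        obtain ⟨μ, hμ⟩ := ihm ((E.map fun e => tsize e.1 + tsize e.2).sum)
          (by rw [← hm]; simp [tsize]) E (unifies_cons.1 hθ).2 (by rw [hv, hn]) rfl
        exact ⟨μ, hμ.congr (fun θ => by simp [unifies_cons]) hv.le⟩
      · have hlt : (eqVars (eqSet E)).ncard < n := by
          rw [← hn]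
          refine Set.ncard_lt_ncard (Set.ssubset_iff_exists.2
            ⟨fun z hz => mem_eqVars_cons.2 (.inr hz), x, ?_, hx⟩) (eqVars_finite _)
          exact mem_eqVars_cons.2 (.inl (.inl (mem_tvars_var.2 rfl)))
        obtain ⟨μ, hμ⟩ := ihn _ hlt E (unifies_cons.1 hθ).2 rfl
        exact ⟨μ, hμ.congr (fun θ => by simp [unifies_cons])
          fun z hz => mem_eqVars_cons.2 (.inr hz)⟩
    · exact elim x _ E (by simpa [mem_tvars_var] using hxy) hθ hn
  | (.var x, .func f ts) :: E, hθ, hn, hm =>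
    exact elim x _ E (notMem_tvars_of_subst_eq (unifies_cons.1 hθ).1) hθ hn
  | (.func f ts, .var x) :: E, hθ, hn, hm =>
    have hv : eqVars (eqSet ((.var x, .func f ts) :: E)) =
        eqVars (eqSet ((.func f ts, .var x) :: E)) := by
      ext z
      simp only [mem_eqVars_cons]
      grind
    obtain ⟨h1, h2⟩ := unifies_cons.1 hθ
    obtain ⟨μ, hμ⟩ := elim x _ E (notMem_tvars_of_subst_eq h1.symm)
      (unifies_cons.2 ⟨h1.symm, h2⟩) (by rw [hv, hn])
    refine ⟨μ, hμ.congr (fun θ => ?_) hv.le⟩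
    rw [unifies_cons, unifies_cons]
    exact and_congr_left fun _ => eq_comm
  | (.func (l := k) f ts, .func (l := k') g us) :: E, hθ, hn, hm =>
    obtain ⟨h1, h2⟩ := unifies_cons.1 hθ
    simp only [Term.subst, Term.func.injEq] at h1
    obtain ⟨rfl, hfg, -⟩ := h1
    obtain rfl := eq_of_heq hfg
    have hu : ∀ θ, Unifies (eqSet (List.ofFn (fun i => (ts i, us i)) ++ E)) θ ↔
        Unifies (eqSet ((.func f ts, .func f us) :: E)) θ := by
      intro θ
      rw [unifies_cons]
      simp only [Term.subst, Term.func.injEq, heq_eq_eq, true_and, funext_iff, Unifies, eqSet,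
        Set.mem_ofPred_eq, List.mem_append, List.mem_ofFn]
      constructor
      · exact fun h => ⟨fun i => h _ (.inl ⟨i, rfl⟩), fun e he => h e (.inr he)⟩
      · rintro ⟨h, h'⟩ e (⟨i, rfl⟩ | he)
        · exact h i
        · exact h' e he
    have hv : eqVars (eqSet (List.ofFn (fun i => (ts i, us i)) ++ E)) =
        eqVars (eqSet ((.func f ts, .func f us) :: E)) := by
      ext x
      rw [mem_eqVars_cons]
      simp only [eqVars, eqSet, Set.mem_ofPred_eq, List.mem_append, List.mem_ofFn,
        mem_tvars_func]
      constructor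
      · rintro ⟨e, ⟨i, rfl⟩ | he, hx⟩
        · exact .inl (hx.imp (fun h => ⟨i, h⟩) fun h => ⟨i, h⟩)
        · exact .inr ⟨e, he, hx⟩
      · rintro ((⟨i, hi⟩ | ⟨i, hi⟩) | ⟨e, he, hx⟩)
        · exact ⟨_, .inl ⟨i, rfl⟩, .inl hi⟩
        · exact ⟨_, .inl ⟨i, rfl⟩, .inr hi⟩
        · exact ⟨e, .inr he, hx⟩
    obtain ⟨μ, hμ⟩ := ihm (((List.ofFn (fun i => (ts i, us i)) ++ E).map
      fun e => tsize e.1 + tsize e.2).sum) (by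
        rw [← hm]
        simp only [List.map_append, List.sum_append, List.map_ofFn, List.sum_ofFn,
          List.map_cons, List.sum_cons, tsize, Function.comp_def, Finset.sum_add_distrib]
        omega) _ ((hu θ).2 hθ) (by rw [hv, hn]) rfl
    exact ⟨μ, hμ.congr hu hv.le⟩

theorem exists_isMGU {s t : L.Term V} {θ : Subst L V} (h : s.subst θ = t.subst θ) :
    ∃ μ, IsMGU {(s, t)} μ := by
  have he : eqSet [(s, t)] = {(s, t)} := by
    ext e
    simp [eqSet]
  rw [← he]
  exact exists_isMGU_list [(s, t)] θ (by rw [he]; simpa [Unifies] using h)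

/-! ### Most general instances with a given position -/

theorem IsPos.func_cons {n : ℕ} {f : L.Functions n} {ts : Fin n → L.Term V} {i : ℕ}
    {p : List ℕ} : IsPos (Term.func f ts) (i :: p) ↔ ∃ h : i < n, IsPos (ts ⟨i, h⟩) p := by
  simp only [IsPos, Option.isSome_iff_exists, subtermAt_func_cons_eq_some]
  grind

/-- The most general term with position `p` among those that have `t` as an instance. -/
theorem exists_linear_generalization [Infinite V] {t q : L.Term V} {p : List ℕ}
    (h : subtermAt t p = some q) : ∀ X : Set V, X.Finite → ∃ k : L.Term V,
      (∀ y ∈ tvars k, y ∉ X) ∧ IsPos k p ∧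
      ∀ t', IsPos t' p → (∃ θ : Subst L V, t'.subst θ = t) → ∃ ρ : Subst L V, k.subst ρ = t' := by
  classical
  refine subtermAt_induction (P := fun t p _ => ∀ X : Set V, X.Finite → ∃ k : L.Term V,
      (∀ y ∈ tvars k, y ∉ X) ∧ IsPos k p ∧
      ∀ t', IsPos t' p → (∃ θ : Subst L V, t'.subst θ = t) → ∃ ρ : Subst L V, k.subst ρ = t')
      ?_ ?_ h
  · intro t X hX
    obtain ⟨y, hy⟩ := hX.infinite_compl.nonempty
    refine ⟨.var y, ?_, by simp [IsPos], fun t' _ _ => ⟨fun _ => t', rfl⟩⟩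
    intro z hz
    rw [mem_tvars_var] at hz
    exact hz ▸ hy
  · intro n f ts i p q _ ih X hX
    obtain ⟨k, hk1, hk2, hk3⟩ := ih X hX
    -- The arguments off the path become distinct fresh variables. The resulting term is linear
    -- there, so a matcher can be assembled argument by argument.
    let e := (hX.union (tvars k).finite_toSet).infinite_compl.natEmbedding
    have he : ∀ j, (e j : V) ∉ X ∧ (e j : V) ∉ tvars k := by
      intro j
      have := (e j).2
      simpa using this
    refine ⟨.func f fun j => if j = i then k else .var (e j), ?_, ?_, ?_⟩
    · intro y hy
      obtain ⟨j, hj⟩ := mem_tvars_func.1 hy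
      split_ifs at hj with hji
      · exact hk1 y hj
      · rw [mem_tvars_var] at hj
        exact hj ▸ (he j).1
    · rw [IsPos.func_cons]
      exact ⟨i.2, by simpa using hk2⟩
    · rintro t' ht' ⟨θ, hθ⟩
      cases t' with
      | var x => simp [IsPos] at ht'
      | func g us =>
        simp only [Term.subst, Term.func.injEq] at hθ
        obtain ⟨rfl, hg, hu⟩ := hθ
        obtain rfl := eq_of_heq hg
        have hu := eq_of_heq hu
        obtain ⟨_, hi⟩ := IsPos.func_cons.1 ht'
        obtain ⟨ρ, hρ⟩ := hk3 (us i) hi ⟨θ, congrFun hu i⟩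
        refine ⟨fun z => if z ∈ tvars k then ρ z else
          if h : ∃ j : Fin _, (e j : V) = z then us h.choose else .var z, ?_⟩
        simp only [Term.subst]
        congr 1
        funext j
        split_ifs with hji
        · subst hji
          rw [← hρ]
          exact subst_congr.2 fun z hz => by simp [hz]
        · have hex : ∃ j' : Fin _, (e j' : V) = e j := ⟨j, rfl⟩
          have hch : hex.choose = j := by
            have := e.injective (Subtype.ext hex.choose_spec)
            exact Fin.ext this
          simp only [Term.subst, (he j).2, if_false, dif_pos hex, hch]

/-- Following `p` into `l` ends at a variable `x` with a remaining path `p'`. Whether an instance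
has the position `p` depends on the value of `x` alone. -/
theorem exists_var_of_not_isPos {l : L.Term V} {σ : Subst L V} {p : List ℕ} (h : ¬ IsPos l p)
    (h' : IsPos (l.subst σ) p) : ∃ x ∈ tvars l, ∃ p',
      ∀ η : Subst L V, IsPos (l.subst η) p ↔ IsPos (η x) p' := by
  induction l generalizing p with
  | var x => exact ⟨x, mem_tvars_var.2 rfl, p, fun η => Iff.rfl⟩
  | func f ts ih =>
    cases p with
    | nil => simp [IsPos] at h
    | cons i p =>
      simp only [Term.subst] at h'
      obtain ⟨hi, h'⟩ := IsPos.func_cons.1 h'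
      obtain ⟨x, hx, p', hp⟩ := ih ⟨i, hi⟩ (fun h1 => h (IsPos.func_cons.2 ⟨hi, h1⟩)) h'
      refine ⟨x, mem_tvars_func.2 ⟨_, hx⟩, p', fun η => ?_⟩
      rw [← hp η]
      simp only [Term.subst, IsPos.func_cons]
      exact ⟨fun ⟨_, h⟩ => h, fun h => ⟨hi, h⟩⟩

/-- It suffices to bind the one variable at which `p` leaves `l`, to the most general term that has
the remaining path. -/
theorem exists_isPosExtension [Infinite V] {l r : L.Term V} {σ : Subst L V} {p : List ℕ}
    (h : ¬ IsPos l p) (h' : IsPos (l.subst σ) p) {X : Set V} (hX : X.Finite)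
    (hlr : ∀ x, x ∈ tvars l ∨ x ∈ tvars r → x ∈ X) : ∃ δ, IsPosExtension l r σ p X δ := by
  classical
  obtain ⟨x, hx, p', hp⟩ := exists_var_of_not_isPos h h'
  obtain ⟨q, hq⟩ := ((hp σ).1 h').exists_subtermAt
  obtain ⟨k, hk1, hk2, hk3⟩ := exists_linear_generalization hq X hX
  have key : ∀ η : Subst L V, (∃ ρ : Subst L V, k.subst ρ = η x) → ∃ ρ : Subst L V,
      (l.subst (bind x k)).subst ρ = l.subst η ∧ (r.subst (bind x k)).subst ρ = r.subst η := by
    rintro η ⟨ρ, hρ⟩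
    -- The variables of `k` are fresh, so `ρ` can be used on them without disturbing `η` on `X`.
    have : ∀ z ∈ X, (bind x k z).subst (fun y => if y ∈ tvars k then ρ y else η y) = η z := by
      intro z hz
      by_cases hzx : z = x
      · subst hzx
        rw [bind_self, ← hρ]
        exact subst_congr.2 fun y hy => by simp [hy]
      · rw [bind_of_ne hzx]
        have : z ∉ tvars k := fun h => hk1 z h hz
        simp [Term.subst, this]
    refine ⟨fun y => if y ∈ tvars k then ρ y else η y, ?_, ?_⟩
    · rw [SCLEQ.subst_subst]
      exact subst_congr.2 fun z hz => this z (hlr z (.inl hz))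
    · rw [SCLEQ.subst_subst]
      exact subst_congr.2 fun z hz => this z (hlr z (.inr hz))
  refine ⟨bind x k, ?_, ?_, ?_, ?_⟩
  · rw [hp, bind_self]
    exact hk2
  · intro y hy
    have hyx : y = x := by
      by_contra hne
      exact hy (bind_of_ne hne k)
    subst hyx
    rw [bind_self]
    exact ⟨mem_mkLit_vars.2 (.inl hx), hk1⟩
  · exact key σ (hk3 (σ x) ((hp σ).1 h') ⟨fun z => .var z, subst_var _⟩)
  · rintro η hη ⟨ρ, hρ, -⟩
    refine key η (hk3 (η x) ((hp η).1 hη) ⟨ρ, ?_⟩)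
    rw [SCLEQ.subst_subst] at hρ
    exact subst_congr.1 hρ x hx

end Unification

end SCLEQ

namespace SCLEQ

/-! ### Refutational completeness of ground rewriting. -/

section Completion

variable {L : FirstOrder.Language.{u, v}} {V : Type w}

open FirstOrder.Language (Term)
open Relation (ReflTransGen Join)

/-- The ground literals that result from those in `G` by rewriting with derived equations. -/
inductive Derived (lt : L.Term V → L.Term V → Prop) (G : Set (Lit L V)) : Lit L V → Prop
  | base {ℓ} : ℓ ∈ G → Derived lt G ℓ
  | rewrite {l r s t : L.Term V} {b : Bool} {p : List ℕ} : Derived lt G (mkLit true l r) →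
      Derived lt G (mkLit b s t) → lt r l → subtermAt s p = some l →
      Derived lt G (mkLit b (replaceAt s p r) t)

/-- The derived equations, oriented by `lt`. -/
def derivedRules (lt : L.Term V → L.Term V → Prop) (G : Set (Lit L V)) : TRS L V :=
  {e | Derived lt G (mkLit true e.1 e.2) ∧ lt e.2 e.1}

variable {lt : L.Term V → L.Term V → Prop} {G : Set (Lit L V)}

theorem Derived.isGround (hG : ∀ ℓ ∈ G, ℓ.IsGround) {ℓ : Lit L V} (h : Derived lt G ℓ) :
    ℓ.IsGround := by
  induction h with
  | base h => exact hG _ h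
  | rewrite _ _ _ _ ih1 ih2 =>
    rw [mkLit_isGround] at *
    exact ⟨ih2.1.replaceAt ih1.2 _, ih2.2⟩

theorem groundOriented_derivedRules (hG : ∀ ℓ ∈ G, ℓ.IsGround) :
    GroundOriented lt (derivedRules lt G) := by
  rintro l r ⟨h, h'⟩
  have := h.isGround hG
  rw [mkLit_isGround] at this
  exact ⟨this.1, this.2, h'⟩

theorem Derived.rewrites (hG : ∀ ℓ ∈ G, ℓ.IsGround) {b : Bool} {s s' t : L.Term V}
    (h : Derived lt G (mkLit b s t)) (hs : ReflTransGen (Rewrites (derivedRules lt G)) s s') :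
    Derived lt G (mkLit b s' t) := by
  induction hs with
  | refl => exact h
  | tail _ h' ih =>
    obtain ⟨l, r, p, h1, h2, rfl⟩ := (groundOriented_derivedRules hG).rewrites_iff.1 h'
    exact .rewrite h1.1 ih h1.2 h2

/-- By totality on ground terms, a nontrivial derived equation is itself a rule in one direction. -/
theorem Derived.join (hlt : IsDesired lt) (hG : ∀ ℓ ∈ G, ℓ.IsGround) {s t : L.Term V}
    (h : Derived lt G (mkLit true s t)) :
    Join (ReflTransGen (Rewrites (derivedRules lt G))) s t := by
  have hg := mkLit_isGround.1 (h.isGround hG)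
  by_cases hst : s = t
  · exact ⟨s, .refl, hst ▸ .refl⟩
  have hR := groundOriented_derivedRules (lt := lt) hG
  obtain h' | h' := hlt.total s t hg.1 hg.2 hst
  · refine ⟨s, .refl, .single (hR.rewrites_iff.2 ⟨t, s, [], ⟨?_, h'⟩, by simp, by simp⟩)⟩
    rwa [mkLit_comm] at h
  · exact ⟨t, .single (hR.rewrites_iff.2 ⟨s, t, [], ⟨h, h'⟩, by simp, by simp⟩), .refl⟩

theorem GroundOriented.rewrites_cases {R : TRS L V} (hR : GroundOriented lt R) {s t : L.Term V}
    (h : Rewrites R s t) : (s, t) ∈ R ∨ ∃ (n : ℕ) (f : L.Functions n) (ts : Fin n → L.Term V)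
      (i : Fin n) (u : L.Term V), s = .func f ts ∧ t = .func f (Function.update ts i u) ∧
        Rewrites R (ts i) u := by
  obtain ⟨l, r, p, h1, h2, rfl⟩ := hR.rewrites_iff.1 h
  cases p with
  | nil =>
    rw [subtermAt_nil, Option.some.injEq] at h2
    subst h2
    rw [replaceAt_nil]
    exact .inl h1
  | cons i p =>
    cases s with
    | var x => simp at h2
    | @func n f ts =>
      obtain ⟨hi, h2⟩ := subtermAt_func_cons_eq_some.1 h2
      refine .inr ⟨n, f, ts, ⟨i, hi⟩, replaceAt (ts ⟨i, hi⟩) p r, rfl, ?_,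
        hR.rewrites_iff.2 ⟨l, r, p, h1, h2, rfl⟩⟩
      rw [replaceAt_func_cons]
      congr 1
      funext j
      by_cases hj : j = ⟨i, hi⟩
      · subst hj
        simp
      · rw [Function.update_of_ne hj, if_neg fun h => hj (Fin.ext h)]

/-- If one of the two steps is at the root, the peak is a critical pair, and derived equations are
closed under such overlaps. Otherwise both steps are inside arguments: in the same argument
induction applies, in different ones the steps commute. -/
theorem locally_confluent_derivedRules (hlt : IsDesired lt) (hG : ∀ ℓ ∈ G, ℓ.IsGround)
    {s t₁ t₂ : L.Term V} (h₁ : Rewrites (derivedRules lt G) s t₁)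
    (h₂ : Rewrites (derivedRules lt G) s t₂) :
    Join (ReflTransGen (Rewrites (derivedRules lt G))) t₁ t₂ := by
  have hR := groundOriented_derivedRules (lt := lt) hG
  have root : ∀ {s t₁ t₂ : L.Term V}, (s, t₁) ∈ derivedRules lt G →
      Rewrites (derivedRules lt G) s t₂ →
      Join (ReflTransGen (Rewrites (derivedRules lt G))) t₁ t₂ := by
    intro s t₁ t₂ h₁ h₂
    -- Rewriting the left side of the rule `s → t₁` yields the derived equation `t₂ ≈ t₁`.
    obtain ⟨c, h, h'⟩ := Derived.join hlt hG (h₁.1.rewrites hG (.single h₂))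
    exact ⟨c, h', h⟩
  induction s generalizing t₁ t₂ with
  | var x =>
    obtain h₁ | ⟨n, f, ts, i, u, hs, -⟩ := hR.rewrites_cases h₁
    · exact root h₁ h₂
    · cases hs
  | func f ts ih =>
    obtain h₁' | ⟨n, g, ts', i, u, hs, rfl, hu⟩ := hR.rewrites_cases h₁
    · exact root h₁' h₂
    obtain h₂' | ⟨n', g', ts'', j, u', hs', rfl, hu'⟩ := hR.rewrites_cases h₂
    · obtain ⟨c, h, h'⟩ := root h₂' h₁
      exact ⟨c, h', h⟩
    cases hs
    cases hs'
    by_cases hij : i = j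
    · subst hij
      obtain ⟨c, hc, hc'⟩ := ih i hu hu'
      refine ⟨.func f (Function.update ts i c), ?_, ?_⟩
      · have := reflTransGen_rewrites_arg (f := f) (ts := Function.update ts i u) i
          (u := c) (by rw [Function.update_self]; exact hc)
        rwa [Function.update_idem] at this
      · have := reflTransGen_rewrites_arg (f := f) (ts := Function.update ts i u') i
          (u := c) (by rw [Function.update_self]; exact hc')
        rwa [Function.update_idem] at this
    · refine ⟨.func f (Function.update (Function.update ts i u) j u'), ?_, ?_⟩
      · exact .single (Rewrites.func j (by rwa [Function.update_of_ne (Ne.symm hij)]))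
      · rw [Function.update_comm hij]
        exact .single (Rewrites.func i (by rwa [Function.update_of_ne hij]))

/-- Newman's lemma for a terminating rewrite relation. -/
theorem join_of_locally_confluent {α : Type*} {r gt : α → α → Prop} (hwf : WellFounded gt)
    (hr : ∀ a b, r a b → gt b a)
    (hl : ∀ a b c, r a b → r a c → Join (ReflTransGen r) b c) {a b c : α}
    (hb : ReflTransGen r a b) (hc : ReflTransGen r a c) : Join (ReflTransGen r) b c := by
  induction a using hwf.induction generalizing b c with
  | _ a ih =>
    obtain rfl | ⟨b', hab, hb⟩ := hb.cases_head
    · exact ⟨c, hc, .refl⟩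
    obtain rfl | ⟨c', hac, hc⟩ := hc.cases_head
    · exact ⟨b, .refl, .head hab hb⟩
    obtain ⟨d, hbd, hcd⟩ := hl a b' c' hab hac
    obtain ⟨e, hbe, hde⟩ := ih b' (hr _ _ hab) hb hbd
    obtain ⟨f, hcf, hef⟩ := ih c' (hr _ _ hac) hc (hcd.trans hde)
    exact ⟨f, hbe.trans hef, hcf⟩

/-- Rewriting with derived equations is refutationally complete for ground literals. -/
theorem exists_derived_refutation [Infinite V] (hlt : IsDesired lt)
    (hG : ∀ ℓ ∈ G, ℓ.IsGround) (hc : ¬ Consistent G) : ∃ w, Derived lt G (mkLit false w w) := by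
  by_contra hno
  apply hc
  have hR := groundOriented_derivedRules (lt := lt) hG
  choose nf hnf using hR.exists_isNormalForm hlt
  have hnf_eq : ∀ {s t : L.Term V}, ReflTransGen (Rewrites (derivedRules lt G)) s t →
      nf s = nf t := by
    intro s t h
    obtain ⟨c, h1, h2⟩ := join_of_locally_confluent hlt.wf (fun _ _ => hR.lt_of_rewrites hlt)
      (fun _ _ _ => locally_confluent_derivedRules hlt hG) (hnf s).1 (h.trans (hnf t).1)
    have e : ∀ {x y : L.Term V}, Irreducible (derivedRules lt G) x →
        ReflTransGen (Rewrites (derivedRules lt G)) x y → x = y := by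
      intro x y hx hxy
      obtain rfl | ⟨d, hd, -⟩ := hxy.cases_head
      · rfl
      · exact absurd hd (hx d)
    rw [e (hnf s).2 h1, e (hnf t).2 h2]
  -- The model of normal forms: by confluence every term evaluates to its normal form, so derived
  -- equations hold.
  let str : L.Structure (L.Term V) :=
    { funMap := fun f ts => nf (.func f ts), RelMap := fun _ _ => False }
  have hreal : ∀ t : L.Term V, t.realize (fun x => nf (.var x)) = nf t := by
    intro t
    induction t with
    | var x => rfl
    | func f ts ih =>
      rw [Term.realize_func]
      have : (fun i => (ts i).realize fun x => nf (.var x)) = fun i => nf (ts i) := funext ih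
      rw [this]
      exact (hnf_eq (reflTransGen_rewrites_args fun i => (hnf (ts i)).1)).symm
  obtain ⟨x⟩ : Nonempty V := inferInstance
  refine ⟨L.Term V, ⟨.var x⟩, str, fun x => nf (.var x), fun g hg => ?_⟩
  obtain ⟨b, s, t, rfl⟩ := g.exists_mkLit
  rw [holds_mkLit, hreal, hreal]
  cases b with
  | true =>
    simp only [true_iff]
    obtain ⟨c, h1, h2⟩ := (Derived.base (lt := lt) hg).join hlt hG
    rw [hnf_eq h1, hnf_eq h2]
  | false =>
    simp only [Bool.false_eq_true, false_iff]
    intro h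
    -- A violated inequation has two sides with a common normal form; rewriting both of them derives
    -- `w ≉ w`.
    refine hno ⟨nf t, ?_⟩
    have h1 := (Derived.base (lt := lt) hg).rewrites hG (hnf s).1
    rw [mkLit_comm] at h1
    have h2 := h1.rewrites hG (hnf t).1
    rwa [h] at h2

end Completion

end SCLEQ

namespace SCLEQ

/-! ### Rewrite steps, lifting, and existence of refutations. -/

section Chains

variable {L : FirstOrder.Language.{u, v}} {V : Type w}

open FirstOrder.Language (Term)

/-! ### Rewrite steps -/

namespace RStep

/-- The distinguished ground literal of a rewrite step. -/
def gl (I : RStep L V) : Lit L V := I.lit.subst I.subst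

/-- The ground instance of the other literals of a rewrite step. -/
def grest (I : RStep L V) : Clause L V := Clause.subst I.rest I.subst

theorem subst_cl (I : RStep L V) : Clause.subst I.cl I.subst = I.gl ::ₘ I.grest :=
  Clause.subst_cons _ _ _

section Projections

variable (ℓ : Lit L V) (C : Clause L V) (σ : Subst L V) (I₁ I₂ : RStep L V) (p : List ℕ)

@[simp] theorem subst_leaf : (leaf ℓ C σ).subst = σ := rfl
@[simp] theorem lit_infer : (infer ℓ C σ I₁ I₂ p).lit = ℓ := rfl
@[simp] theorem rest_infer : (infer ℓ C σ I₁ I₂ p).rest = C := rfl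
@[simp] theorem subst_infer : (infer ℓ C σ I₁ I₂ p).subst = σ := rfl

end Projections

end RStep

namespace AnnLit

/-- The ground instance of the other literals of an annotated literal. -/
def grest (a : AnnLit L V) : Clause L V := Clause.subst a.rest a.subst

theorem subst_cl (a : AnnLit L V) : Clause.subst a.cl a.subst = a.gl ::ₘ a.grest :=
  Clause.subst_cons _ _ _

end AnnLit

theorem IsLeafOf.gl_eq {a : AnnLit L V} {I : RStep L V} (h : IsLeafOf a I) : I.gl = a.gl := by
  obtain ⟨π, σ, rfl, hσ⟩ := h
  simp only [RStep.gl, RStep.lit, RStep.subst, AnnLit.gl, Lit.subst_subst]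
  exact Lit.subst_congr fun x hx => hσ x (Clause.mem_vars_cons.2 (.inl hx))

theorem IsLeafOf.grest_eq {a : AnnLit L V} {I : RStep L V} (h : IsLeafOf a I) :
    I.grest = a.grest := by
  obtain ⟨π, σ, rfl, hσ⟩ := h
  simp only [RStep.grest, RStep.rest, RStep.subst, AnnLit.grest, Clause.subst_subst]
  exact Clause.subst_congr fun x hx => hσ x (Clause.mem_vars_cons.2 (.inr hx))

theorem IsLeafOf.valid {a : AnnLit L V} {I : RStep L V} (h : IsLeafOf a I) {M : Type*}
    [L.Structure M] (ha : Clause.Valid M a.cl) : Clause.Valid M I.cl := by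
  obtain ⟨π, σ, rfl, hσ⟩ := h
  have := ha.subst fun x => .var (π x)
  rwa [AnnLit.cl, Clause.subst_cons] at this

variable {lt : L.Term V → L.Term V → Prop} {I₁ I₂ I : RStep L V} {p : List ℕ}

/-- The substitution of the result extends those of the parents and unifies `q` with `l₁`, so `δ`
and `μ` vanish under it. What remains is a rewrite step on the distinguished ground literals and the
union of the side literals. -/
theorem IsRewriteInference.ground (h : IsRewriteInference lt I₁ I₂ p I) :
    ∃ (b : Bool) (l r s t : L.Term V), I₁.gl = mkLit true l r ∧ I₂.gl = mkLit b s t ∧ lt r l ∧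
      subtermAt s p = some l ∧ I.gl = mkLit b (replaceAt s p r) t ∧
      I.grest = I₁.grest + I₂.grest := by
  obtain ⟨-, l₁, r₁, l₂, r₂, b, δ, μ, σ, q, h1, h2, hr, hp, -, hq, hμ, hσ₁, hσ₂, rfl⟩ := h
  have hl₁ : l₁.subst σ = l₁.subst I₁.subst := subst_congr.2 fun x hx =>
    hσ₁ x (Clause.mem_vars_cons.2 (.inl (by rw [h1]; simp [hx])))
  have hr₁ : r₁.subst σ = r₁.subst I₁.subst := subst_congr.2 fun x hx =>
    hσ₁ x (Clause.mem_vars_cons.2 (.inl (by rw [h1]; simp [hx])))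
  have hl₂ : (l₂.subst δ).subst σ = l₂.subst I₂.subst := by
    rw [subst_subst]
    exact subst_congr.2 fun x hx =>
      (hσ₂ x (Clause.mem_vars_cons.2 (.inl (by rw [h2]; simp [hx])))).2
  have hr₂ : (r₂.subst δ).subst σ = r₂.subst I₂.subst := by
    rw [subst_subst]
    exact subst_congr.2 fun x hx =>
      (hσ₂ x (Clause.mem_vars_cons.2 (.inl (by rw [h2]; simp [hx])))).2
  have hu : Unifies {(q, l₁)} σ := by
    have := subtermAt_subst hq σ
    rw [hl₂, hp, Option.some.injEq] at this
    simp [Unifies, hl₁, this]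
  refine ⟨b, _, _, _, _, by rw [RStep.gl, h1, mkLit_subst], by rw [RStep.gl, h2, mkLit_subst],
    hr, hp, ?_, ?_⟩
  · simp only [RStep.gl, RStep.lit_infer, RStep.subst_infer]
    rw [hμ.lit hu, mkLit_subst, replaceAt_subst hq, hl₂, hr₂, hr₁]
  · simp only [RStep.grest, RStep.rest_infer, RStep.subst_infer]
    rw [Clause.subst_add, hμ.clause hu, hμ.clause hu, Clause.subst_subst]
    congr 1
    · exact Clause.subst_congr fun x hx => hσ₁ x (Clause.mem_vars_cons.2 (.inr hx))
    · exact Clause.subst_congr fun x hx => (hσ₂ x (Clause.mem_vars_cons.2 (.inr hx))).2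

/-- Soundness: if no side literal holds, the instances of both distinguished literals do, and equals
may be replaced by equals. -/
theorem IsRewriteInference.valid (h : IsRewriteInference lt I₁ I₂ p I) {M : Type*}
    [L.Structure M] (h₁ : Clause.Valid M I₁.cl) (h₂ : Clause.Valid M I₂.cl) :
    Clause.Valid M I.cl := by
  obtain ⟨-, l₁, r₁, l₂, r₂, b, δ, μ, σ, q, h1, h2, hr, hp, -, hq, hμ, hσ₁, hσ₂, rfl⟩ := h
  intro a
  have h₁' := h₁.subst μ
  have h₂' := (h₂.subst δ).subst μ
  simp only [RStep.cl, h1, h2, Clause.subst_cons, mkLit_subst] at h₁' h₂'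
  obtain ⟨ℓ₁, hℓ₁, hh₁⟩ := h₁' a
  obtain ⟨ℓ₂, hℓ₂, hh₂⟩ := h₂' a
  simp only [RStep.cl, RStep.lit_infer, RStep.rest_infer]
  obtain rfl | hℓ₁ := Multiset.mem_cons.1 hℓ₁
  swap
  · exact ⟨ℓ₁, by simp [hℓ₁], hh₁⟩
  obtain rfl | hℓ₂ := Multiset.mem_cons.1 hℓ₂
  swap
  · exact ⟨ℓ₂, by simp [hℓ₂], hh₂⟩
  refine ⟨_, Multiset.mem_cons_self _ _, ?_⟩
  have hql : q.subst μ = l₁.subst μ := hμ.unifies (q, l₁) rfl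
  rw [holds_mkLit] at hh₁ hh₂
  rw [mkLit_subst, holds_mkLit, replaceAt_subst hq,
    realize_replaceAt (subtermAt_subst hq μ) (by rw [hql]; exact (hh₁.1 rfl).symm)]
  exact hh₂

/-! ### Chains -/

variable {Γ : Trail L V} {P Q : List (RStep L V)}

theorem IsChain.induction {motive : RStep L V → Prop} (hP : IsChain lt Γ P)
    (leaf : ∀ a ∈ Γ, ∀ I, IsLeafOf a I → motive I)
    (infer : ∀ I₁ I₂ p I, IsRewriteInference lt I₁ I₂ p I → motive I₁ → motive I₂ → motive I) :
    ∀ I ∈ P, motive I := by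
  have key : ∀ (i : ℕ) (I : RStep L V), P[i]? = some I → motive I := by
    intro i
    induction i using Nat.strong_induction_on with
    | _ i ih =>
      intro I hI
      obtain ⟨a, ha, h⟩ | ⟨I₁, h₁, I₂, h₂, p, h⟩ := hP i I hI
      · exact leaf a ha I h
      · have get : ∀ J ∈ P.take i, motive J := by
          intro J hJ
          obtain ⟨j, hj, hJ⟩ := List.mem_take_iff_getElem.1 hJ
          exact ih j (by omega) J (by rw [← hJ]; exact List.getElem?_eq_getElem _)
        exact infer I₁ I₂ p I h (get _ h₁) (get _ h₂)
  intro I hI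
  obtain ⟨i, hi⟩ := List.mem_iff_getElem?.1 hI
  exact key i I hi

theorem IsChain.append (hP : IsChain lt Γ P) (hQ : IsChain lt Γ Q) : IsChain lt Γ (P ++ Q) := by
  intro i I hI
  by_cases hi : i < P.length
  · rw [List.getElem?_append_left hi] at hI
    rw [List.take_append_of_le_length hi.le]
    exact hP i I hI
  · push Not at hi
    rw [List.getElem?_append_right hi] at hI
    refine (hQ _ I hI).imp_right ?_
    rintro ⟨I₁, h₁, I₂, h₂, h⟩
    rw [List.take_append, List.take_of_length_le hi]
    exact ⟨I₁, List.mem_append_right _ h₁, I₂, List.mem_append_right _ h₂, h⟩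

theorem IsChain.concat (hP : IsChain lt Γ P) (h₁ : I₁ ∈ P) (h₂ : I₂ ∈ P)
    (h : IsRewriteInference lt I₁ I₂ p I) : IsChain lt Γ (P ++ [I]) := by
  intro i J hJ
  by_cases hi : i < P.length
  · rw [List.getElem?_append_left hi] at hJ
    rw [List.take_append_of_le_length hi.le]
    exact hP i J hJ
  · push Not at hi
    rw [List.getElem?_append_right hi] at hJ
    have hi' : i - P.length = 0 := by
      by_contra hne
      rw [List.getElem?_eq_none (by simp; omega)] at hJ
      cases hJ
    rw [hi'] at hJ
    simp only [List.getElem?_cons_zero, Option.some.injEq] at hJ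
    subst hJ
    right
    rw [List.take_append, List.take_of_length_le hi]
    exact ⟨I₁, List.mem_append_left _ h₁, I₂, List.mem_append_left _ h₂, p, h⟩

theorem isChain_leaf {a : AnnLit L V} (ha : a ∈ Γ) (h : IsLeafOf a I) : IsChain lt Γ [I] := by
  intro i J hJ
  obtain ⟨-, rfl⟩ : i = 0 ∧ I = J := by
    cases i with
    | zero => simpa using hJ
    | succ i => simp at hJ
  exact .inl ⟨a, ha, h⟩

/-! ### Lifting of ground rewriting -/

/-- Renamings are permutations of all variables; the symmetric group of `V` is transitive on finite
tuples of distinct elements, so `A` can be moved onto a fresh tuple. -/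
theorem exists_perm_avoiding [Infinite V] {A X : Set V} (hA : A.Finite) (hX : X.Finite) :
    ∃ π : Equiv.Perm V, ∀ x ∈ A, π x ∉ X := by
  let e := hA.toFinset.equivFin
  let y := hX.infinite_compl.natEmbedding
  obtain ⟨π, hπ⟩ := (Equiv.Perm.isMultiplyPretransitive V hA.toFinset.card).exists_smul_eq
    (e.symm.toEmbedding.trans (Function.Embedding.subtype _))
    (Fin.valEmbedding.trans (y.trans (Function.Embedding.subtype _)))
  refine ⟨π, fun x hx => ?_⟩
  have := congrArg (fun f => f (e ⟨x, hA.mem_toFinset.2 hx⟩)) hπ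
  simp only [Function.Embedding.smul_apply, Function.Embedding.trans_apply,
    Equiv.coe_toEmbedding, Equiv.symm_apply_apply, Function.Embedding.coe_subtype,
    Equiv.Perm.smul_def] at this
  rw [this]
  exact (y _).2

theorem exists_isLeafOf [Infinite V] (a : AnnLit L V) {X : Set V} (hX : X.Finite) :
    ∃ I, IsLeafOf a I ∧ ∀ x ∈ Clause.vars I.cl, x ∉ X := by
  obtain ⟨π, hπ⟩ := exists_perm_avoiding (Clause.vars_finite a.cl) hX
  refine ⟨_, ⟨π, fun y => a.subst (π.symm y), rfl, by simp⟩, ?_⟩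
  intro x hx
  have : x ∈ Clause.vars (Clause.subst a.cl fun x => .var (π x)) := by
    rw [AnnLit.cl, Clause.subst_cons]
    exact hx
  obtain ⟨y, hy, h⟩ := Clause.mem_vars_subst.1 this
  rw [mem_tvars_var] at h
  exact h ▸ hπ y hy

/-- The lifting lemma: each ground rewrite step between distinguished literals is induced by a
rewrite inference, if necessary below variable level. Keeping the result away from `X` allows later
variable disjoint inferences. -/
theorem exists_isRewriteInference [Infinite V] {b : Bool} {l r s t : L.Term V} {X : Set V}
    (hX : X.Finite) (h₁ : I₁.gl = mkLit true l r) (h₂ : I₂.gl = mkLit b s t) (hr : lt r l)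
    (hp : subtermAt s p = some l) (hd : Disjoint (Clause.vars I₁.cl) (Clause.vars I₂.cl))
    (hX₁ : ∀ x ∈ Clause.vars I₁.cl, x ∉ X) (hX₂ : ∀ x ∈ Clause.vars I₂.cl, x ∉ X) :
    ∃ I, IsRewriteInference lt I₁ I₂ p I ∧ I.gl = mkLit b (replaceAt s p r) t ∧
      ∀ x ∈ Clause.vars I.cl, x ∉ X := by
  classical
  obtain ⟨l₁, r₁, hI₁, rfl, rfl⟩ := Lit.exists_of_subst_eq h₁
  obtain ⟨l₂, r₂, hI₂, rfl, rfl⟩ := Lit.exists_of_subst_eq h₂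
  have hmem₁ : ∀ x, x ∈ tvars l₁ ∨ x ∈ tvars r₁ → x ∈ Clause.vars I₁.cl := fun x hx =>
    Clause.mem_vars_cons.2 (.inl (by rw [hI₁]; simpa using hx))
  have hmem₂ : ∀ x, x ∈ tvars l₂ ∨ x ∈ tvars r₂ → x ∈ Clause.vars I₂.cl := fun x hx =>
    Clause.mem_vars_cons.2 (.inl (by rw [hI₂]; simpa using hx))
  obtain ⟨δ, q, σ, hδ, hq, hσ₁, hσ₂, hδX⟩ : ∃ (δ : Subst L V) (q : L.Term V) (σ : Subst L V),
      ((IsPos l₂ p ∧ ∀ x, δ x = .var x) ∨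
        (¬ IsPos l₂ p ∧
          IsPosExtension l₂ r₂ I₂.subst p (Clause.vars I₁.cl ∪ Clause.vars I₂.cl) δ)) ∧
      subtermAt (l₂.subst δ) p = some q ∧
      (∀ x ∈ Clause.vars I₁.cl, σ x = I₁.subst x) ∧
      (∀ x ∈ Clause.vars I₂.cl, σ x = I₂.subst x ∧ (δ x).subst σ = I₂.subst x) ∧
      ∀ x ∈ Clause.vars I₂.cl, ∀ y ∈ tvars (δ x), y ∉ X := by
    have hdis : ∀ x ∈ Clause.vars I₂.cl, x ∉ Clause.vars I₁.cl :=
      fun x hx hx' => Set.disjoint_left.1 hd hx' hx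
    by_cases hpos : IsPos l₂ p
    · obtain ⟨q, hq⟩ := hpos.exists_subtermAt
      refine ⟨fun x => .var x, q,
        fun x => if x ∈ Clause.vars I₁.cl then I₁.subst x else I₂.subst x,
        .inl ⟨hpos, fun _ => rfl⟩, by rwa [subst_var], fun x hx => by simp [hx],
        fun x hx => ?_, fun x hx y hy => ?_⟩
      · simp [Term.subst, hdis x hx]
      · rw [mem_tvars_var] at hy
        exact hy ▸ hX₂ x hx
    · obtain ⟨δ, hδ1, hδ2, ⟨ρ, hρ1, hρ2⟩, hδ4⟩ := exists_isPosExtension (r := r₂) hpos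
        (isPos_of_subtermAt hp) (X := Clause.vars I₁.cl ∪ Clause.vars I₂.cl ∪ X)
        (((Clause.vars_finite _).union (Clause.vars_finite _)).union hX)
        (fun x hx => .inl (.inr (hmem₂ x hx)))
      obtain ⟨q, hq⟩ := hδ1.exists_subtermAt
      refine ⟨δ, q, fun x => if x ∈ Clause.vars I₁.cl then I₁.subst x else
        if x ∈ Clause.vars I₂.cl then I₂.subst x else ρ x,
        .inr ⟨hpos, hδ1, fun x hx => ⟨(hδ2 x hx).1, fun y hy hy' => (hδ2 x hx).2 y hy (.inl hy')⟩,
          ⟨ρ, hρ1, hρ2⟩, hδ4⟩, hq, fun x hx => by simp [hx], fun x hx => ⟨?_, ?_⟩, ?_⟩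
      · simp [hx, hdis x hx]
      · by_cases hx' : δ x = .var x
        · rw [hx']
          simp [Term.subst, hx, hdis x hx]
        · obtain ⟨hv, hf⟩ := hδ2 x hx'
          have hρx : (δ x).subst ρ = I₂.subst x := by
            rw [subst_subst] at hρ1 hρ2
            obtain hv | hv := mem_mkLit_vars.1 hv
            · exact subst_congr.1 hρ1 x hv
            · exact subst_congr.1 hρ2 x hv
          rw [← hρx]
          refine subst_congr.2 fun y hy => ?_
          have hy' := hf y hy
          simp only [Set.mem_union, not_or] at hy'
          simp [hy'.1.1, hy'.1.2]
      · intro x hx y hy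
        by_cases hx' : δ x = .var x
        · rw [hx', mem_tvars_var] at hy
          exact hy ▸ hX₂ x hx
        · exact fun h => (hδ2 x hx').2 y hy (.inr h)
  have hl₂ : (l₂.subst δ).subst σ = l₂.subst I₂.subst := by
    rw [subst_subst]
    exact subst_congr.2 fun x hx => (hσ₂ x (hmem₂ x (.inl hx))).2
  have hu : q.subst σ = l₁.subst σ := by
    have := subtermAt_subst hq σ
    rw [hl₂, hp, Option.some.injEq] at this
    rw [← this]
    exact (subst_congr.2 fun x hx => hσ₁ x (hmem₁ x (.inl hx))).symm
  obtain ⟨μ, hμ⟩ := exists_isMGU hu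
  refine ⟨_, ⟨hd, l₁, r₁, l₂, r₂, b, δ, μ, σ, q, hI₁, hI₂, hr, hp, hδ, hq, hμ, hσ₁, hσ₂, rfl⟩,
    ?_, ?_⟩
  · simp only [RStep.gl, RStep.lit_infer, RStep.subst_infer]
    rw [hμ.lit (by simpa [Unifies] using hu), mkLit_subst, replaceAt_subst hq, hl₂,
      subst_subst r₂, subst_congr.2 fun x hx => hσ₁ x (hmem₁ x (.inr hx)),
      subst_congr.2 fun x hx => (hσ₂ x (hmem₂ x (.inr hx))).2]
  have hsub : ∀ u : L.Term V, (∀ x ∈ tvars u, x ∈ Clause.vars I₂.cl) →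
      ∀ x ∈ tvars (u.subst δ), x ∉ X := by
    intro u hu x hx
    obtain ⟨y, hy, hx⟩ := mem_tvars_subst.1 hx
    exact hδX y (hu y hy) x hx
  have hl₂X := hsub l₂ fun x hx => hmem₂ x (.inl hx)
  have hr₂X := hsub r₂ fun x hx => hmem₂ x (.inr hx)
  -- As the unifier introduces no fresh variables, it cannot bring back variables of `X`.
  have hμX : ∀ z, z ∉ X → ∀ y ∈ tvars (μ z), y ∉ X := by
    intro z hz y hy
    by_cases hz' : z ∈ eqVars {(q, l₁)}
    · obtain ⟨e, rfl, hy⟩ := hμ.noFresh z hz' y hy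
      obtain hy | hy := hy
      · exact hl₂X y (tvars_subtermAt hq y hy)
      · exact hX₁ y (hmem₁ y (.inl hy))
    · rw [hμ.off z hz', mem_tvars_var] at hy
      exact hy ▸ hz
  intro x hx
  simp only [RStep.cl, RStep.lit_infer, RStep.rest_infer, Clause.mem_vars_cons, Clause.mem_vars_add,
    Lit.mem_vars_subst, Clause.mem_vars_subst, mem_mkLit_vars] at hx
  obtain ⟨z, hz, hx⟩ | ⟨z, hz, hx⟩ | ⟨z, ⟨z', hz', hz⟩, hx⟩ := hx
  · refine hμX z ?_ x hx
    obtain hz | hz := hz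
    · obtain hz | hz := tvars_replaceAt z hz
      · exact hl₂X z hz
      · exact hX₁ z (hmem₁ z (.inr hz))
    · exact hr₂X z hz
  · exact hμX z (hX₁ z (Clause.mem_vars_cons.2 (.inr hz))) x hx
  · exact hμX z (hδX z' (Clause.mem_vars_cons.2 (.inr hz')) z hz) x hx

/-- The quantification over `X` drives the induction: the chain for the rewriting equation is chosen
so that its last step avoids the variables of the rewritten step. -/
theorem Derived.exists_isChain [Infinite V] {ℓ : Lit L V} (h : Derived lt (glits Γ) ℓ) :
    ∀ X : Set V, X.Finite → ∃ P I, IsChain lt Γ P ∧ P.getLast? = some I ∧ I.gl = ℓ ∧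
      ∀ x ∈ Clause.vars I.cl, x ∉ X := by
  induction h with
  | base h =>
    intro X hX
    obtain ⟨a, ha, rfl⟩ := h
    obtain ⟨I, hI, hX⟩ := exists_isLeafOf a hX
    exact ⟨[I], I, isChain_leaf ha hI, rfl, hI.gl_eq, hX⟩
  | rewrite _ _ hr hp ih₁ ih₂ =>
    intro X hX
    obtain ⟨P₂, I₂, hP₂, hl₂, h₂, hX₂⟩ := ih₂ X hX
    obtain ⟨P₁, I₁, hP₁, hl₁, h₁, hX₁⟩ := ih₁ (X ∪ Clause.vars I₂.cl)
      (hX.union (Clause.vars_finite _))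
    obtain ⟨I, hI, hIgl, hIX⟩ := exists_isRewriteInference hX h₁ h₂ hr hp
      (Set.disjoint_left.2 fun x hx hx' => hX₁ x hx (.inr hx'))
      (fun x hx h => hX₁ x hx (.inl h)) hX₂
    refine ⟨P₁ ++ P₂ ++ [I], I, (hP₁.append hP₂).concat
      (List.mem_append_left _ (List.mem_of_getLast? hl₁))
      (List.mem_append_right _ (List.mem_of_getLast? hl₂)) hI, by simp, hIgl, hIX⟩

/-! ### Existence of refutations -/

theorem glits_append (Γ Δ : Trail L V) : glits (Γ ++ Δ) = glits Γ ∪ glits Δ := by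
  ext ℓ
  simp only [glits, Set.mem_ofPred_eq, List.mem_append, Set.mem_union]
  grind

theorem glits_singleton (a : AnnLit L V) : glits [a] = {a.gl} := by
  ext ℓ
  simp [glits, eq_comm]

variable {β : L.Term V} {a : AnnLit L V}

/-- Superfluous steps are deleted as long as there are any; the length decreases. -/
theorem IsPreRefutation.exists_isRefutation (h : IsPreRefutation lt β Γ a P) :
    ∃ P, IsRefutation lt β Γ a P := by
  induction hn : P.length using Nat.strong_induction_on generalizing P with
  | _ n ih =>
    by_cases hmin : ∀ i, i + 1 < P.length → ¬ IsPreRefutation lt β Γ a (P.eraseIdx i)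
    · exact ⟨P, h, hmin⟩
    · push Not at hmin
      obtain ⟨i, hi, h'⟩ := hmin
      exact ih (P.eraseIdx i).length (by rw [List.length_eraseIdx_of_lt (by omega)]; omega) h' rfl

/-- Adding a false literal makes the trail inconsistent, so some `w ≉ w` is derivable on the ground
level, and the derivation lifts to a chain. -/
theorem exists_isRefutation [Infinite V] (hlt : IsDesired lt) (hf : BFalse lt β Γ a.gl)
    (hΓ : ∀ ℓ ∈ glits Γ, ℓ.IsGround) (ha : a.gl.IsGround) : ∃ P, IsRefutation lt β Γ a P := by
  have hG : ∀ ℓ ∈ glits (Γ ++ [a]), ℓ.IsGround := by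
    intro ℓ hℓ
    rw [glits_append, glits_singleton] at hℓ
    obtain hℓ | rfl := hℓ
    · exact hΓ ℓ hℓ
    · exact ha
  have hc : ¬ Consistent (glits (Γ ++ [a])) := by
    intro hc
    rw [glits_append, glits_singleton] at hc
    exact hc.not_entails_comp (entails_of_mem (.inr rfl)) (hf.2.mono Set.subset_union_left)
  obtain ⟨w, hw⟩ := exists_derived_refutation hlt hG hc
  obtain ⟨P, I, hP, hl, hI, -⟩ := hw.exists_isChain ∅ Set.finite_empty
  exact IsPreRefutation.exists_isRefutation ⟨hf, hP, I, hl, w, hI⟩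

/-! ### Invariants of chains -/

theorem IsChain.valid (hP : IsChain lt Γ P) {M : Type*} [L.Structure M]
    (hΓ : ∀ a ∈ Γ, Clause.Valid M a.cl) : ∀ I ∈ P, Clause.Valid M I.cl :=
  hP.induction (fun a ha _ h => h.valid (hΓ a ha)) fun _ _ _ _ h => h.valid

theorem IsChain.isGround_gl (hP : IsChain lt Γ P) (hΓ : ∀ a ∈ Γ, a.gl.IsGround) :
    ∀ I ∈ P, I.gl.IsGround := by
  refine hP.induction (fun a ha _ h => h.gl_eq ▸ hΓ a ha) fun _ _ _ _ h h₁ h₂ => ?_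
  obtain ⟨b, l, r, s, t, e₁, e₂, -, -, e, -⟩ := h.ground
  rw [e₁, mkLit_isGround] at h₁
  rw [e₂, mkLit_isGround] at h₂
  rw [e, mkLit_isGround]
  exact ⟨h₂.1.replaceAt h₁.2 _, h₂.2⟩

theorem IsChain.litBelow_gl (hlt : IsDesired lt) (hP : IsChain lt Γ P)
    (hΓ : ∀ a ∈ Γ, litBelow lt β a.gl) : ∀ I ∈ P, litBelow lt β I.gl := by
  refine hP.induction (fun a ha _ h => h.gl_eq ▸ hΓ a ha) fun _ _ _ _ h h₁ h₂ => ?_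
  obtain ⟨b, l, r, s, t, e₁, e₂, hr, hp, e, -⟩ := h.ground
  rw [e₂, litBelow_mkLit] at h₂
  rw [e, litBelow_mkLit]
  exact ⟨hlt.trans _ _ _ (hlt.replaceAt_lt hp hr) h₂.1, h₂.2⟩

/-- Inferences collect the ground side literals and never rewrite them. Hence falsity and position
in the trail ordering need to be checked only for side literals of annotations. -/
theorem IsChain.grest (hP : IsChain lt Γ P) :
    ∀ I ∈ P, ∀ κ ∈ I.grest, ∃ a ∈ Γ, κ ∈ a.grest := by
  refine hP.induction (fun a ha _ h κ hκ => ⟨a, ha, h.grest_eq ▸ hκ⟩) fun _ _ _ _ h h₁ h₂ κ hκ => ?_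
  obtain ⟨b, l, r, s, t, -, -, -, -, -, e⟩ := h.ground
  rw [e] at hκ
  exact (Multiset.mem_add.1 hκ).elim (h₁ κ) (h₂ κ)

end Chains

end SCLEQ

namespace SCLEQ

/-! ### Defining literals, levels, and the trails that occur in runs. -/

section Levels

variable {L : FirstOrder.Language.{u, v}} {V : Type w}

open FirstOrder.Language (Term)

/-! ### Multiset extensions of well-founded relations -/

/-- Since `r` need not be transitive, `MulLT r` is embedded into the Dershowitz–Manna ordering over
the transitive closure of `r`. -/
theorem wellFounded_mulLT {α : Type*} {r : α → α → Prop} (hr : WellFounded r) :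
    WellFounded (MulLT r) := by
  have hT := hr.transGen
  have hirr : ∀ a, ¬ Relation.TransGen r a a := fun a h => hT.irrefl.irrefl a h
  let _ : Preorder α :=
    { le := fun a b => a = b ∨ Relation.TransGen r a b
      lt := Relation.TransGen r
      le_refl := fun a => .inl rfl
      le_trans := by
        rintro a b c (rfl | h) (rfl | h')
        · exact .inl rfl
        · exact .inr h'
        · exact .inr h
        · exact .inr (h.trans h')
      lt_iff_le_not_ge := by
        intro a b
        constructor
        · intro h
          refine ⟨.inr h, ?_⟩
          rintro (rfl | h')
          · exact hirr _ h
          · exact hirr _ (h.trans h')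
        · rintro ⟨rfl | h, h'⟩
          · exact absurd (.inl rfl) h'
          · exact h }
  have : WellFoundedLT α := ⟨hT⟩
  refine Subrelation.wf ?_ (Multiset.wellFounded_isDershowitzMannaLT (α := α))
  rintro A B ⟨X, Y, Z, hZ, h1, h2, h3⟩
  refine ⟨X, Y, Z, hZ, h1, h2, fun y hy => ?_⟩
  obtain ⟨z, hz, h⟩ := h3 y hy
  exact ⟨z, hz, .single h⟩

/-! ### Defining literals -/

variable {Γ Δ : Trail L V} {ℓ κ : Lit L V} {i j k : ℕ}

theorem glits_mono (h : Γ ⊆ Δ) : glits Γ ⊆ glits Δ := fun _ ⟨a, ha, e⟩ => ⟨a, h ha, e⟩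

theorem glits_take_mono (h : i ≤ j) : glits (Γ.take i) ⊆ glits (Γ.take j) :=
  glits_mono (List.take_subset_take_left Γ h)

theorem glits_take_subset : glits (Γ.take i) ⊆ glits Γ := glits_mono (List.take_subset i Γ)

theorem subLits_range : subLits Γ (Finset.range i) = glits (Γ.take i) := by
  ext ℓ
  simp only [subLits, glits, Set.mem_ofPred_eq, Finset.mem_range, List.mem_iff_getElem?,
    List.getElem?_take]
  constructor
  · rintro ⟨j, hj, a, ha, rfl⟩
    exact ⟨a, ⟨j, by rw [if_pos hj, ha]⟩, rfl⟩
  · rintro ⟨a, ⟨j, hj⟩, rfl⟩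
    split_ifs at hj with h
    exact ⟨j, h, a, hj, rfl⟩

theorem subLits_mono {I J : Finset ℕ} (h : I ⊆ J) : subLits Γ I ⊆ subLits Γ J :=
  fun _ ⟨i, hi, h'⟩ => ⟨i, h hi, h'⟩

theorem exists_isCore {I : Finset ℕ} (hI : I ⊆ Finset.range Γ.length)
    (h : Defined (subLits Γ I) ℓ) : ∃ J ⊆ I, IsCore Γ ℓ J := by
  induction I using Finset.strongInduction with
  | H I ih =>
    by_cases hm : ∃ J ⊂ I, Defined (subLits Γ J) ℓ
    · obtain ⟨J, hJ, hd⟩ := hm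
      obtain ⟨K, hK, hc⟩ := ih J hJ (hJ.subset.trans hI) hd
      exact ⟨K, hK.trans hJ.subset, hc⟩
    · exact ⟨I, subset_rfl, hI, h, fun J hJ hd => hm ⟨J, hJ, hd⟩⟩

/-- A prefix defines `ℓ` exactly if it contains a core. Minimising the last element over all cores
therefore finds the first prefix that defines `ℓ`, and cores are no longer needed. -/
theorem isDefiningIdx_iff : IsDefiningIdx Γ ℓ i ↔
    i < Γ.length ∧ Defined (glits (Γ.take (i + 1))) ℓ ∧ ¬ Defined (glits (Γ.take i)) ℓ := by
  simp only [← subLits_range]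
  constructor
  · rintro ⟨I, ⟨hI, hd, -⟩, ⟨hi, hg⟩, hmin⟩
    have hlen := Finset.mem_range.1 (hI hi)
    refine ⟨hlen, hd.mono (subLits_mono fun j hj => ?_), fun h => ?_⟩
    · exact Finset.mem_range.2 (Nat.lt_succ_of_le (hg hj))
    · obtain ⟨J, hJ, hc⟩ := exists_isCore (Finset.range_subset_range.2 hlen.le) h
      obtain ⟨j, hj, hij⟩ := hmin J hc
      have := Finset.mem_range.1 (hJ hj)
      omega
  · rintro ⟨hlen, h1, h2⟩
    obtain ⟨I, hI, hc⟩ := exists_isCore (Finset.range_subset_range.2 hlen) h1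
    refine ⟨I, hc, ⟨?_, fun j hj => Nat.lt_succ_iff.1 (Finset.mem_range.1 (hI hj))⟩, ?_⟩
    · by_contra hi
      refine h2 (hc.2.1.mono (subLits_mono fun j hj => ?_))
      have := Finset.mem_range.1 (hI hj)
      have : j ≠ i := fun e => hi (e ▸ hj)
      exact Finset.mem_range.2 (by omega)
    · intro J hJ
      by_contra hno
      push Not at hno
      exact h2 (hJ.2.1.mono (subLits_mono fun j hj => Finset.mem_range.2 (hno j hj)))

theorem IsDefiningIdx.unique (hi : IsDefiningIdx Γ ℓ i) (hj : IsDefiningIdx Γ ℓ j) : i = j := by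
  rw [isDefiningIdx_iff] at hi hj
  by_contra hne
  obtain h | h := lt_or_gt_of_ne hne
  · exact hj.2.2 (hi.2.1.mono (glits_take_mono h))
  · exact hi.2.2 (hj.2.1.mono (glits_take_mono h))

theorem isDefiningIdx_comp : IsDefiningIdx Γ ℓ.comp i ↔ IsDefiningIdx Γ ℓ i := by
  rw [isDefiningIdx_iff, isDefiningIdx_iff, defined_comp, defined_comp]

theorem exists_isDefiningIdx (h : Defined (glits (Γ.take j)) ℓ) (h0 : ¬ Defined ∅ ℓ) :
    ∃ i < j, IsDefiningIdx Γ ℓ i := by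
  classical
  have hex : ∃ i, Defined (glits (Γ.take i)) ℓ := ⟨j, h⟩
  have hpos : Nat.find hex ≠ 0 := by
    intro e
    have := Nat.find_spec hex
    rw [e] at this
    exact h0 (this.mono (by simp [glits]))
  obtain ⟨i, hi⟩ := Nat.exists_eq_succ_of_ne_zero hpos
  have h1 := Nat.find_spec hex
  have h2 : ¬ Defined (glits (Γ.take i)) ℓ := Nat.find_min hex (by omega)
  rw [hi] at h1
  refine ⟨i, ?_, isDefiningIdx_iff.2 ⟨?_, h1, h2⟩⟩
  · have := Nat.find_min' hex h
    omega
  · by_contra hlen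
    push Not at hlen
    rw [List.take_of_length_le (by omega)] at h1
    rw [List.take_of_length_le hlen] at h2
    exact h2 h1

theorem not_defined_empty_of_isDefiningIdx (h : IsDefiningIdx Γ ℓ i) : ¬ Defined ∅ ℓ :=
  fun h' => (isDefiningIdx_iff.1 h).2.2 (h'.mono (Set.empty_subset _))

/-! ### Trails of runs -/

/-- The level of the last literal of a trail. -/
def lastLevel (Γ : Trail L V) : ℕ := (Γ.getLast?.map AnnLit.level).getD 0

/-- Properties of a literal that Propagate or Decide adds to the trail `Γ`, in relation to a model
`M` of the clauses. -/
structure Good (lt : L.Term V → L.Term V → Prop) (β : L.Term V) (M : Type*) [L.Structure M]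
    (Γ : Trail L V) (a : AnnLit L V) : Prop where
  ground : Clause.IsGround (Clause.subst a.cl a.subst)
  below : ∀ κ ∈ Clause.subst a.cl a.subst, litBelow lt β κ
  undef : ¬ Defined (glits Γ) a.gl
  irred : ∀ t ∈ a.gl.sides, Irreducible (conv lt (glits Γ)) t
  valid : Clause.Valid M a.cl
  kind : (a.level = lastLevel Γ ∧ ∀ κ ∈ a.grest, Entails (glits Γ) κ.comp) ∨
    (a.level = lastLevel Γ + 1 ∧ a.grest = {a.gl.comp})

/-- Every literal of the trail has the properties `Good` relative to its predecessors. -/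
def GoodTrail (lt : L.Term V → L.Term V → Prop) (β : L.Term V) (M : Type*) [L.Structure M]
    (Γ : Trail L V) : Prop :=
  ∀ (i : ℕ) (a : AnnLit L V), Γ[i]? = some a → Good lt β M (Γ.take i) a

variable {lt : L.Term V → L.Term V → Prop} {β : L.Term V} {M : Type*} [L.Structure M]
  {a : AnnLit L V}

theorem Good.gl_ground (h : Good lt β M Γ a) : a.gl.IsGround :=
  h.ground _ (by rw [AnnLit.subst_cl]; simp)

theorem Good.gl_below (h : Good lt β M Γ a) : litBelow lt β a.gl :=
  h.below _ (by rw [AnnLit.subst_cl]; simp)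

theorem lastLevel_concat : lastLevel (Γ ++ [a]) = a.level := by simp [lastLevel]

theorem goodTrail_nil : GoodTrail lt β M ([] : Trail L V) := by
  intro i a h
  simp at h

theorem goodTrail_concat : GoodTrail lt β M (Γ ++ [a]) ↔ GoodTrail lt β M Γ ∧ Good lt β M Γ a := by
  constructor
  · intro h
    constructor
    · intro i b hb
      have hi := (List.getElem?_eq_some_iff.1 hb).1
      have := h i b (by rw [List.getElem?_append_left hi, hb])
      rwa [List.take_append_of_le_length hi.le] at this
    · have := h Γ.length a (by simp)
      simpa using this
  · rintro ⟨h, ha⟩ i b hb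
    by_cases hi : i < Γ.length
    · rw [List.getElem?_append_left hi] at hb
      rw [List.take_append_of_le_length hi.le]
      exact h i b hb
    · have hi' := (List.getElem?_eq_some_iff.1 hb).1
      rw [List.length_append, List.length_singleton] at hi'
      obtain rfl : i = Γ.length := by omega
      simp only [List.getElem?_concat_length, Option.some.injEq] at hb
      subst hb
      simpa using ha

theorem GoodTrail.prefix (h : GoodTrail lt β M Γ) (hΔ : Δ <+: Γ) : GoodTrail lt β M Δ := by
  obtain ⟨Ξ, rfl⟩ := hΔ
  intro i a ha
  have hi := (List.getElem?_eq_some_iff.1 ha).1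
  have := h i a (by rw [List.getElem?_append_left hi, ha])
  rwa [List.take_append_of_le_length hi.le] at this

theorem GoodTrail.good_of_mem (h : GoodTrail lt β M Γ) (ha : a ∈ Γ) :
    ∃ Δ, Δ ++ [a] <+: Γ ∧ Good lt β M Δ a := by
  obtain ⟨i, hi⟩ := List.mem_iff_getElem?.1 ha
  refine ⟨Γ.take i, ?_, h i a hi⟩
  obtain ⟨hlt, he⟩ := List.getElem?_eq_some_iff.1 hi
  rw [← he, List.take_append_getElem]
  exact List.take_prefix _ _

theorem GoodTrail.level_le (h : GoodTrail lt β M Γ) : ∀ a ∈ Γ, a.level ≤ lastLevel Γ := by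
  induction Γ using List.reverseRecOn with
  | nil => simp
  | append_singleton Γ b ih =>
    obtain ⟨h1, h2⟩ := goodTrail_concat.1 h
    intro a ha
    rw [lastLevel_concat]
    obtain ha | ha := List.mem_append.1 ha
    · have := ih h1 a ha
      obtain ⟨h', -⟩ | ⟨h', -⟩ := h2.kind <;> omega
    · rw [List.mem_singleton.1 ha]

theorem GoodTrail.level_mono (h : GoodTrail lt β M Γ) {b : AnnLit L V} (ha : Γ[i]? = some a)
    (hb : Γ[j]? = some b) (hij : i ≤ j) : a.level ≤ b.level := by
  obtain rfl | hlt := hij.eq_or_lt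
  · rw [ha, Option.some.injEq] at hb
    rw [hb]
  have h1 := (h.prefix (List.take_prefix j Γ)).level_le a (List.mem_iff_getElem?.2
    ⟨i, by rw [List.getElem?_take, if_pos hlt, ha]⟩)
  obtain ⟨h', -⟩ | ⟨h', -⟩ := (h j b hb).kind <;> omega

theorem consistent_empty : Consistent (∅ : Set (Lit L V)) := by
  let _ : L.Structure PUnit.{max u w + 1} :=
    { funMap := fun _ _ => .unit, RelMap := fun _ _ => False }
  exact ⟨PUnit, inferInstance, inferInstance, fun _ => .unit, fun _ h => h.elim⟩

theorem GoodTrail.consistent (h : GoodTrail lt β M Γ) : Consistent (glits Γ) := by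
  induction Γ using List.reverseRecOn with
  | nil => exact consistent_empty.mono (by simp [glits])
  | append_singleton Γ b ih =>
    obtain ⟨h1, h2⟩ := goodTrail_concat.1 h
    rw [glits_append, glits_singleton, Set.union_singleton]
    exact consistent_insert_of_not_entails_comp fun h => h2.undef (.inr h)

/-- A part of a consistent trail that defines a false literal must make it false too, as truth would
persist. So falsity can be moved to prefixes by checking definedness only. -/
theorem GoodTrail.entails_comp_of_defined (h : GoodTrail lt β M Γ) {H : Set (Lit L V)}
    (hH : H ⊆ glits Γ) (hd : Defined H ℓ) (hf : Entails (glits Γ) ℓ.comp) :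
    Entails H ℓ.comp :=
  hd.resolve_left fun h' => h.consistent.not_entails_comp (h'.mono hH) hf

theorem GoodTrail.isDefiningIdx_gl (h : GoodTrail lt β M Γ) (ha : Γ[i]? = some a) :
    IsDefiningIdx Γ a.gl i := by
  have hi := (List.getElem?_eq_some_iff.1 ha).1
  refine isDefiningIdx_iff.2 ⟨hi, .inl (entails_of_mem ⟨a, ?_, rfl⟩), (h i a ha).undef⟩
  exact List.mem_iff_getElem?.2 ⟨i, by rw [List.getElem?_take, if_pos (by omega), ha]⟩

theorem exists_getElem?_of_mem_glits (h : ℓ ∈ glits Γ) :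
    ∃ (i : ℕ) (a : AnnLit L V), Γ[i]? = some a ∧ a.gl = ℓ := by
  obtain ⟨a, ha, rfl⟩ := h
  obtain ⟨i, hi⟩ := List.mem_iff_getElem?.1 ha
  exact ⟨i, a, hi, rfl⟩

/-- A trail literal was undefined before it was added, so it is its own defining literal; the two
clauses in the definition of levels thus agree. -/
theorem GoodTrail.litLevel_iff (h : GoodTrail lt β M Γ) : LitLevel Γ ℓ k ↔
    (∃ (i : ℕ) (a : AnnLit L V), IsDefiningIdx Γ ℓ i ∧ Γ[i]? = some a ∧ a.level = k) ∨
      (Defined ∅ ℓ ∧ k = 0) := by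
  have hno : Defined (glits Γ) ℓ → (¬ (∃ i, IsDefiningIdx Γ ℓ i) ↔ Defined ∅ ℓ) := by
    intro hd
    constructor
    · intro h'
      by_contra h0
      obtain ⟨i, -, hi⟩ := exists_isDefiningIdx (Γ := Γ) (j := Γ.length) (by simpa using hd) h0
      exact h' ⟨i, hi⟩
    · rintro h0 ⟨i, hi⟩
      exact not_defined_empty_of_isDefiningIdx hi h0
  constructor
  · rintro (⟨a, ha, rfl, rfl⟩ | ⟨-, hd, h' | ⟨h', rfl⟩⟩)
    · obtain ⟨i, hi⟩ := List.mem_iff_getElem?.1 ha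
      exact .inl ⟨i, a, h.isDefiningIdx_gl hi, hi, rfl⟩
    · exact .inl h'
    · exact .inr ⟨(hno hd).1 h', rfl⟩
  · intro h'
    by_cases hℓ : ℓ ∈ glits Γ
    · obtain ⟨i, a, hi, rfl⟩ := exists_getElem?_of_mem_glits hℓ
      have hidx := h.isDefiningIdx_gl hi
      obtain ⟨j, b, hj, hb, rfl⟩ | ⟨h0, rfl⟩ := h'
      · obtain rfl := hidx.unique hj
        rw [hi, Option.some.injEq] at hb
        subst hb
        exact .inl ⟨a, List.mem_iff_getElem?.2 ⟨i, hi⟩, rfl, rfl⟩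
      · exact absurd h0 (not_defined_empty_of_isDefiningIdx hidx)
    · refine .inr ⟨hℓ, ?_⟩
      obtain ⟨j, b, hj, hb, rfl⟩ | ⟨h0, rfl⟩ := h'
      · exact ⟨(isDefiningIdx_iff.1 hj).2.1.mono glits_take_subset, .inl ⟨j, b, hj, hb, rfl⟩⟩
      · have hd : Defined (glits Γ) ℓ := h0.mono (Set.empty_subset _)
        exact ⟨hd, .inr ⟨(hno hd).2 h0, rfl⟩⟩

theorem GoodTrail.litLevel_unique (h : GoodTrail lt β M Γ) (hj : LitLevel Γ ℓ j)
    (hk : LitLevel Γ ℓ k) : j = k := by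
  rw [h.litLevel_iff] at hj hk
  obtain ⟨i, a, hi, ha, rfl⟩ | ⟨h0, rfl⟩ := hj <;> obtain ⟨i', a', hi', ha', rfl⟩ | ⟨h0', rfl⟩ := hk
  · obtain rfl := hi.unique hi'
    rw [ha, Option.some.injEq] at ha'
    rw [ha']
  · exact absurd h0' (not_defined_empty_of_isDefiningIdx hi)
  · exact absurd h0 (not_defined_empty_of_isDefiningIdx hi')
  · rfl

theorem GoodTrail.exists_litLevel (h : GoodTrail lt β M Γ) (hd : Defined (glits Γ) ℓ) :
    ∃ k, LitLevel Γ ℓ k := by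
  by_cases h0 : Defined ∅ ℓ
  · exact ⟨0, h.litLevel_iff.2 (.inr ⟨h0, rfl⟩)⟩
  · obtain ⟨i, hlt, hi⟩ := exists_isDefiningIdx (Γ := Γ) (j := Γ.length) (by simpa using hd) h0
    exact ⟨_, h.litLevel_iff.2 (.inl ⟨i, _, hi, List.getElem?_eq_getElem hlt, rfl⟩)⟩

/-! ### The part of a trail of level zero -/

section LevelZero

variable {M : Type (max u w)} [Nonempty M] [L.Structure M]

/-- Without decisions every literal is propagated from a valid clause whose other literals are
already false, so it holds in `M` by induction along the trail. -/
theorem GoodTrail.holds_of_level_zero (h : GoodTrail lt β M Γ) (e : V → M)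
    (h0 : ∀ a ∈ Γ, a.level = 0) : ∀ g ∈ glits Γ, g.Holds e := by
  induction Γ using List.reverseRecOn with
  | nil => simp [glits]
  | append_singleton Γ b ih =>
    obtain ⟨h1, h2⟩ := goodTrail_concat.1 h
    have ih := ih h1 fun a ha => h0 a (List.mem_append_left _ ha)
    rw [glits_append, glits_singleton]
    rintro g (hg | rfl)
    · exact ih g hg
    · have hb := h0 b (by simp)
      obtain ⟨-, hk⟩ | ⟨hk, -⟩ := h2.kind
      · obtain ⟨ℓ, hℓ, hh⟩ := h2.valid.subst b.subst e
        rw [AnnLit.subst_cl] at hℓ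
        obtain rfl | hℓ := Multiset.mem_cons.1 hℓ
        · exact hh
        · exact absurd hh (holds_comp.1 (hk ℓ hℓ M e ih))
      · omega

/-- A valid clause has no false instance of level zero. -/
theorem GoodTrail.exists_not_litLevel_zero (h : GoodTrail lt β M Γ) {D : Clause L V}
    {σ : Subst L V} (hD : Clause.Valid M D) (hf : CBFalse lt β Γ (Clause.subst D σ)) :
    ∃ ℓ ∈ Clause.subst D σ, ¬ LitLevel Γ ℓ 0 := by
  by_contra hno
  push Not at hno
  obtain ⟨m⟩ : Nonempty M := inferInstance
  obtain ⟨ℓ, hℓ, hh⟩ := hD.subst σ fun _ => m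
  -- Levels do not decrease along the trail, so the prefix up to a defining literal of level zero
  -- has level zero throughout. If there is no defining literal, the empty prefix serves.
  have hH : ∃ i, (∀ a ∈ Γ.take i, a.level = 0) ∧ Defined (glits (Γ.take i)) ℓ := by
    obtain ⟨i, a, hi, ha, h0⟩ | ⟨h0, -⟩ := h.litLevel_iff.1 (hno ℓ hℓ)
    · refine ⟨i + 1, fun b hb => ?_, (isDefiningIdx_iff.1 hi).2.1⟩
      obtain ⟨j, hj⟩ := List.mem_iff_getElem?.1 hb
      rw [List.getElem?_take] at hj
      split_ifs at hj with hji
      have := h.level_mono hj ha (by omega)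
      omega
    · exact ⟨0, by simp, h0.mono (Set.empty_subset _)⟩
  obtain ⟨i, hi, hd⟩ := hH
  have := h.entails_comp_of_defined glits_take_subset hd (hf ℓ hℓ).2
  exact holds_comp.1 (this M _ ((h.prefix (List.take_prefix i Γ)).holds_of_level_zero _ hi)) hh

theorem GoodTrail.not_clauseLevel_zero (h : GoodTrail lt β M Γ) {D : Clause L V}
    {σ : Subst L V} (hD : Clause.Valid M D) (hf : CBFalse lt β Γ (Clause.subst D σ)) :
    ¬ ClauseLevel Γ (Clause.subst D σ) 0 := by
  intro hl
  obtain ⟨ℓ, hℓ, hn⟩ := h.exists_not_litLevel_zero hD hf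
  obtain ⟨-, hg⟩ | ⟨h0, -⟩ := hl
  · obtain ⟨k, hk⟩ := h.exists_litLevel (.inr (hf ℓ hℓ).2)
    have := hg ⟨ℓ, hℓ, hk⟩
    obtain rfl : k = 0 := Nat.le_zero.1 this
    exact hn hk
  · rw [h0] at hℓ
    exact absurd hℓ (Multiset.notMem_zero ℓ)

/-- On the empty trail all defined literals have level zero. -/
theorem not_hasFalseInstance_nil {D : Clause L V} (hD : Clause.Valid M D) :
    ¬ HasFalseInstance lt β [] D := by
  rintro ⟨τ, -, hf⟩
  have h : GoodTrail lt β M ([] : Trail L V) := goodTrail_nil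
  obtain ⟨ℓ, hℓ, hn⟩ := h.exists_not_litLevel_zero hD hf
  refine hn (h.litLevel_iff.2 (.inr ⟨?_, rfl⟩))
  exact Defined.mono (by simp [glits]) (.inr (hf ℓ hℓ).2)

end LevelZero

end Levels

end SCLEQ

namespace SCLEQ

/-! ### The trail induced ordering as a lexicographic ordering of ranks. -/

section TrailOrdering

variable {L : FirstOrder.Language.{u, v}} {V : Type w}

open FirstOrder.Language (Term)

variable {lt : L.Term V → L.Term V → Prop} {β : L.Term V} {M : Type*} [L.Structure M]
  {Γ : Trail L V} {a : AnnLit L V} {ℓ κ : Lit L V} {i j k : ℕ}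

theorem OnTrail.litLevel (h : GoodTrail lt β M Γ) (hi : OnTrail Γ i ℓ) :
    IsDefiningIdx Γ ℓ i ∧ ¬ LitLevel Γ ℓ 0 := by
  obtain ⟨a, ha, hpos, rfl⟩ := hi
  have := h.isDefiningIdx_gl ha
  refine ⟨this, fun h0 => ?_⟩
  have := h.litLevel_unique h0 (h.litLevel_iff.2 (.inl ⟨i, a, this, ha, rfl⟩))
  omega

theorem CompOnTrail.litLevel (h : GoodTrail lt β M Γ) (hi : CompOnTrail Γ i ℓ) :
    IsDefiningIdx Γ ℓ i ∧ ¬ LitLevel Γ ℓ 0 := by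
  obtain ⟨a, ha, hpos, rfl⟩ := hi
  have := isDefiningIdx_comp.2 (h.isDefiningIdx_gl ha)
  refine ⟨this, fun h0 => ?_⟩
  have := h.litLevel_unique h0 (h.litLevel_iff.2 (.inl ⟨i, a, this, ha, rfl⟩))
  omega

theorem OffTrail.litLevel (h : GoodTrail lt β M Γ) (hi : OffTrail lt β Γ i ℓ) :
    IsDefiningIdx Γ ℓ i ∧ ¬ LitLevel Γ ℓ 0 := by
  obtain ⟨-, -, -, -, hidx, a, ha, hpos⟩ := hi
  refine ⟨hidx, fun h0 => ?_⟩
  have := h.litLevel_unique h0 (h.litLevel_iff.2 (.inl ⟨i, a, hidx, ha, rfl⟩))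
  omega

theorem LevelPos.not_litLevel_zero (h : GoodTrail lt β M Γ) (hℓ : LevelPos lt β Γ ℓ) :
    ¬ LitLevel Γ ℓ 0 := by
  obtain ⟨-, -, k, hk, hl⟩ := hℓ
  intro h0
  have := h.litLevel_unique h0 hl
  omega

open Classical in
/-- The position of a literal in the trail induced ordering: `0` for literals of level zero, and
otherwise the successor of the index of the defining literal. -/
noncomputable def trailIdx (Γ : Trail L V) (ℓ : Lit L V) : ℕ :=
  if LitLevel Γ ℓ 0 then 0 else sInf {i | IsDefiningIdx Γ ℓ i} + 1

open Classical in
/-- The position of a literal among those with the same defining literal. -/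
noncomputable def trailKind (Γ : Trail L V) (ℓ : Lit L V) : ℕ :=
  if LitLevel Γ ℓ 0 ∨ ℓ ∈ glits Γ then 0 else if ℓ.comp ∈ glits Γ then 1 else 2

theorem trailIdx_eq (hi : IsDefiningIdx Γ ℓ i) (h0 : ¬ LitLevel Γ ℓ 0) :
    trailIdx Γ ℓ = i + 1 := by
  have : {i | IsDefiningIdx Γ ℓ i} = {i} := by
    ext j
    exact ⟨fun hj => hj.unique hi, fun hj => by rw [hj]; exact hi⟩
  simp [trailIdx, h0, this]

/-- The rank of a literal in the trail induced ordering. -/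
noncomputable def trailRank (Γ : Trail L V) (ℓ : Lit L V) : ℕ × ℕ × Multiset (L.Term V) :=
  (trailIdx Γ ℓ, trailKind Γ ℓ, ℓ.mset)

/-- The lexicographic ordering of ranks. -/
def RankLT (lt : L.Term V → L.Term V → Prop) :
    ℕ × ℕ × Multiset (L.Term V) → ℕ × ℕ × Multiset (L.Term V) → Prop :=
  Prod.Lex (· < ·) (Prod.Lex (· < ·) (MulLT lt))

theorem wellFounded_rankLT (hlt : IsDesired lt) : WellFounded (RankLT lt) :=
  WellFounded.prod_lex wellFounded_lt (WellFounded.prod_lex wellFounded_lt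
    (wellFounded_mulLT hlt.wf))

theorem OnTrail.kind (hi : OnTrail Γ i ℓ) : trailKind Γ ℓ = 0 := by
  obtain ⟨a, ha, -, rfl⟩ := hi
  have : a.gl ∈ glits Γ := ⟨a, List.mem_iff_getElem?.2 ⟨i, ha⟩, rfl⟩
  simp [trailKind, this]

theorem CompOnTrail.kind (h : GoodTrail lt β M Γ) (hi : CompOnTrail Γ i ℓ) :
    trailKind Γ ℓ = 1 := by
  have h0 := (hi.litLevel h).2
  obtain ⟨a, ha, -, rfl⟩ := hi
  have h1 : a.gl ∈ glits Γ := ⟨a, List.mem_iff_getElem?.2 ⟨i, ha⟩, rfl⟩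
  have h2 : a.gl.comp ∉ glits Γ := fun h2 =>
    h.consistent.not_entails_comp (entails_of_mem h1) (entails_of_mem h2)
  simp [trailKind, h0, h1, h2]

theorem OffTrail.kind (h : GoodTrail lt β M Γ) (hi : OffTrail lt β Γ i ℓ) :
    trailKind Γ ℓ = 2 := by
  have h0 := (hi.litLevel h).2
  simp [trailKind, h0, hi.2.2.1, hi.2.2.2.1]

theorem LevelZero.rank (hℓ : LevelZero lt β Γ ℓ) : trailRank Γ ℓ = (0, 0, ℓ.mset) := by
  simp [trailRank, trailIdx, trailKind, hℓ.2.2]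

/-- Makes the ordering well founded on `β`-defined literals. Definedness of the larger literal
excludes the two cases that concern undefined literals; in the others the ranks can be read off. -/
theorem TrailLT.rank_lt (h : GoodTrail lt β M Γ) (hκ : BDef lt β Γ κ)
    (hlt : TrailLT lt β Γ ℓ κ) : RankLT lt (trailRank Γ ℓ) (trailRank Γ κ) := by
  have lex1 : ∀ {x y k k' : ℕ} {m m'}, x < y → RankLT lt (x, k, m) (y, k', m') :=
    fun h => Prod.Lex.left _ _ h
  have lex2 : ∀ {x k k' : ℕ} {m m'}, k < k' → RankLT lt (x, k, m) (x, k', m') :=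
    fun h => Prod.Lex.right _ (Prod.Lex.left _ _ h)
  have lex3 : ∀ {x k : ℕ} {m m'}, MulLT lt m m' → RankLT lt (x, k, m) (x, k, m') :=
    fun h => Prod.Lex.right _ (Prod.Lex.right _ h)
  have on : ∀ {i ℓ}, OnTrail Γ i ℓ → trailRank Γ ℓ = (i + 1, 0, ℓ.mset) := by
    intro i ℓ hi
    rw [trailRank, trailIdx_eq (hi.litLevel h).1 (hi.litLevel h).2, hi.kind]
  have co : ∀ {i ℓ}, CompOnTrail Γ i ℓ → trailRank Γ ℓ = (i + 1, 1, ℓ.mset) := by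
    intro i ℓ hi
    rw [trailRank, trailIdx_eq (hi.litLevel h).1 (hi.litLevel h).2, hi.kind h]
  have off : ∀ {i ℓ}, OffTrail lt β Γ i ℓ → trailRank Γ ℓ = (i + 1, 2, ℓ.mset) := by
    intro i ℓ hi
    rw [trailRank, trailIdx_eq (hi.litLevel h).1 (hi.litLevel h).2, hi.kind h]
  cases hlt with
  | off_off h1 h2 h3 =>
    rw [off h1, off h2]
    obtain h3 | ⟨rfl, h3⟩ := h3
    · exact lex1 (by omega)
    · exact lex3 h3
  | on_on h1 h2 h3 => rw [on h1, on h2]; exact lex1 (by omega)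
  | comp_on h1 h2 h3 => rw [co h1, on h2]; exact lex1 (by omega)
  | on_comp h1 h2 h3 =>
    rw [on h1, co h2]
    obtain h3 | rfl := h3
    · exact lex1 (by omega)
    · exact lex2 (by omega)
  | comp_comp h1 h2 h3 => rw [co h1, co h2]; exact lex1 (by omega)
  | on_off h1 h2 h3 =>
    rw [on h1, off h2]
    obtain rfl | h3 := h3.eq_or_lt
    · exact lex2 (by omega)
    · exact lex1 (by omega)
  | comp_off h1 h2 h3 =>
    rw [co h1, off h2]
    obtain rfl | h3 := h3.eq_or_lt
    · exact lex2 (by omega)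
    · exact lex1 (by omega)
  | off_on h1 h2 h3 => rw [off h1, on h2]; exact lex1 (by omega)
  | off_comp h1 h2 h3 => rw [off h1, co h2]; exact lex1 (by omega)
  | zero_zero h1 h2 h3 => rw [h1.rank, h2.rank]; exact lex3 h3
  | zero_pos h1 h2 =>
    rw [h1.rank]
    refine lex1 ?_
    simp [trailIdx, h2.not_litLevel_zero h]
  | undef_undef _ _ _ h4 => exact absurd h4 hκ
  | def_undef _ _ _ h4 => exact absurd h4 hκ

/-! ### Comparison with literals that are defined by the last literal of the trail -/

theorem GoodTrail.onTrail_cases (h : GoodTrail lt β M Γ) (hlt : IsDesired lt)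
    (hℓ : ℓ ∈ boundedLits lt β) (hi : IsDefiningIdx Γ ℓ i) (ha : Γ[i]? = some a)
    (hpos : 0 < a.level) : OnTrail Γ i ℓ ∨ CompOnTrail Γ i ℓ ∨ OffTrail lt β Γ i ℓ := by
  by_cases h1 : ℓ ∈ glits Γ
  · obtain ⟨j, b, hb, rfl⟩ := exists_getElem?_of_mem_glits h1
    obtain rfl := (h.isDefiningIdx_gl hb).unique hi
    exact .inl ⟨b, hb, by rw [ha, Option.some.injEq] at hb; rwa [← hb], rfl⟩
  by_cases h2 : ℓ.comp ∈ glits Γ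
  · obtain ⟨j, b, hb, hbℓ⟩ := exists_getElem?_of_mem_glits h2
    have hidx := h.isDefiningIdx_gl hb
    rw [hbℓ, isDefiningIdx_comp] at hidx
    obtain rfl := hidx.unique hi
    exact .inr (.inl ⟨b, hb, by rw [ha, Option.some.injEq] at hb; rwa [← hb], by simp [hbℓ]⟩)
  · refine .inr (.inr ⟨hℓ.1, (hℓ.2.bDef_iff hlt).2 ?_, h1, h2, hi, a, ha, hpos⟩)
    exact (isDefiningIdx_iff.1 hi).2.1.mono glits_take_subset

theorem isDefiningIdx_last : IsDefiningIdx (Γ ++ [a]) ℓ Γ.length ↔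
    Defined (glits (Γ ++ [a])) ℓ ∧ ¬ Defined (glits Γ) ℓ := by
  rw [isDefiningIdx_iff, List.take_of_length_le (by simp)]
  simp

/-- Literals that are defined before the last literal of the trail are smaller than those that
are defined by the last literal. -/
theorem GoodTrail.trailLT_last (h : GoodTrail lt β M (Γ ++ [a])) (hlt : IsDesired lt)
    (hpos : 0 < a.level) (hℓ : ℓ ∈ boundedLits lt β) (hκ : κ ∈ boundedLits lt β)
    (hdℓ : Defined (glits Γ) ℓ) (hdκ : IsDefiningIdx (Γ ++ [a]) κ Γ.length) :
    TrailLT lt β (Γ ++ [a]) ℓ κ := by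
  have hdℓ' : Defined (glits (Γ ++ [a])) ℓ := hdℓ.mono (glits_mono (List.subset_append_left _ _))
  have hlast : (Γ ++ [a])[Γ.length]? = some a := by simp
  by_cases h0 : LitLevel (Γ ++ [a]) ℓ 0
  · refine .zero_pos ⟨hℓ.1, (hℓ.2.bDef_iff hlt).2 hdℓ', h0⟩ ⟨hκ.1, (hκ.2.bDef_iff hlt).2
      (isDefiningIdx_last.1 hdκ).1, a.level, hpos, h.litLevel_iff.2 (.inl ⟨_, a, hdκ, hlast, rfl⟩)⟩
  · have h0' : ¬ Defined ∅ ℓ := fun h' => h0 (h.litLevel_iff.2 (.inr ⟨h', rfl⟩))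
    obtain ⟨i, hi, hidx⟩ := exists_isDefiningIdx (Γ := Γ ++ [a]) (j := Γ.length)
      (by simpa using hdℓ) h0'
    have hi' : i < (Γ ++ [a]).length := by simp; omega
    have hbpos : 0 < ((Γ ++ [a])[i]).level := by
      by_contra hb
      exact h0 (h.litLevel_iff.2 (.inl ⟨i, _, hidx, List.getElem?_eq_getElem hi', by omega⟩))
    obtain h1 | h1 | h1 := h.onTrail_cases hlt hℓ hidx (List.getElem?_eq_getElem hi') hbpos <;>
      obtain h2 | h2 | h2 := h.onTrail_cases hlt hκ hdκ hlast hpos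
    · exact .on_on h1 h2 hi
    · exact .on_comp h1 h2 (.inl hi)
    · exact .on_off h1 h2 hi.le
    · exact .comp_on h1 h2 hi
    · exact .comp_comp h1 h2 hi
    · exact .comp_off h1 h2 hi.le
    · exact .off_on h1 h2 hi
    · exact .off_comp h1 h2 hi
    · exact .off_off h1 h2 (.inl hi)

/-- The first component of the rank of `ℓ` is strictly smaller than that of `κ`. This gives the
maximality that Explore-Refutation demands. -/
theorem GoodTrail.not_trailLT_last (h : GoodTrail lt β M (Γ ++ [a])) (hlt : IsDesired lt)
    (hpos : 0 < a.level) (hℓ : ℓ ∈ boundedLits lt β) (hdℓ : Defined (glits Γ) ℓ)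
    (hdκ : IsDefiningIdx (Γ ++ [a]) κ Γ.length) : ¬ TrailLT lt β (Γ ++ [a]) κ ℓ := by
  intro hκℓ
  have hdℓ' : Defined (glits (Γ ++ [a])) ℓ := hdℓ.mono (glits_mono (List.subset_append_left _ _))
  have hlast : (Γ ++ [a])[Γ.length]? = some a := by simp
  have hκ0 : ¬ LitLevel (Γ ++ [a]) κ 0 := by
    intro h0
    have := h.litLevel_unique h0 (h.litLevel_iff.2 (.inl ⟨_, a, hdκ, hlast, rfl⟩))
    omega
  have hr := hκℓ.rank_lt h ((hℓ.2.bDef_iff hlt).2 hdℓ')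
  have hle : trailIdx (Γ ++ [a]) κ ≤ trailIdx (Γ ++ [a]) ℓ := by
    have := (Prod.lex_def.1 hr)
    obtain h | ⟨h, -⟩ := this
    · exact le_of_lt h
    · exact le_of_eq h
  rw [trailIdx_eq hdκ hκ0] at hle
  by_cases h0 : LitLevel (Γ ++ [a]) ℓ 0
  · simp [trailIdx, h0] at hle
  · have h0' : ¬ Defined ∅ ℓ := fun h' => h0 (h.litLevel_iff.2 (.inr ⟨h', rfl⟩))
    obtain ⟨i, hi, hidx⟩ := exists_isDefiningIdx (Γ := Γ ++ [a]) (j := Γ.length)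
      (by simpa using hdℓ) h0'
    rw [trailIdx_eq hidx h0] at hle
    omega

end TrailOrdering

end SCLEQ

namespace SCLEQ

/-! ### Applicability of Explore-Refutation, and invariants of regular runs. -/

section Invariants

variable {L : FirstOrder.Language.{u, v}} {V : Type w}

open FirstOrder.Language (Term)

variable {lt : L.Term V → L.Term V → Prop} {β : L.Term V} {M : Type (max u w)}
  [L.Structure M] {Γ Δ : Trail L V} {a α : AnnLit L V} {N : Set (Clause L V)} {S T : State L V}

theorem GoodTrail.mem_grest (h : GoodTrail lt β M Γ) (ha : a ∈ Γ) {κ : Lit L V}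
    (hκ : κ ∈ a.grest) : κ ∈ boundedLits lt β ∧ Entails (glits Γ) κ.comp := by
  obtain ⟨Δ, hΔ, hg⟩ := h.good_of_mem ha
  have hmem : κ ∈ Clause.subst a.cl a.subst := by
    rw [AnnLit.subst_cl]
    exact Multiset.mem_cons_of_mem hκ
  refine ⟨⟨hg.ground κ hmem, hg.below κ hmem⟩, ?_⟩
  obtain ⟨-, hk⟩ | ⟨-, hk⟩ := hg.kind
  · exact (hk κ hκ).mono (glits_mono fun b hb => hΔ.subset (List.mem_append_left _ hb))
  · rw [hk, Multiset.mem_singleton] at hκ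
    subst hκ
    rw [Lit.comp_comp]
    exact entails_of_mem ⟨a, ha, rfl⟩

theorem GoodTrail.gl_mem_boundedLits (h : GoodTrail lt β M Γ) (ha : a ∈ Γ) :
    a.gl ∈ boundedLits lt β := by
  obtain ⟨Δ, -, hg⟩ := h.good_of_mem ha
  exact ⟨hg.gl_ground, hg.gl_below⟩

theorem GoodTrail.valid (h : GoodTrail lt β M Γ) (ha : a ∈ Γ) : Clause.Valid M a.cl := by
  obtain ⟨Δ, -, hg⟩ := h.good_of_mem ha
  exact hg.valid

theorem forall_mem_concat {P : AnnLit L V → Prop} (h : ∀ b ∈ Γ, P b) (ha : P a) :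
    ∀ b ∈ Γ ++ [a], P b := by
  intro b hb
  obtain hb | hb := List.mem_append.1 hb
  · exact h b hb
  · exact List.mem_singleton.1 hb ▸ ha

/-! ### Applicability of Explore-Refutation -/

/-- Explore-Refutation is applicable with the last step of a refutation if the only literal of the
closure that is defined by the last literal of the trail is not the complement of a decision. -/
theorem applicable_exploreRefutation [Infinite V] (hlt : IsDesired lt)
    (hΓ : GoodTrail lt β M (Γ ++ [a])) (hpos : 0 < a.level) (hS : S.trail = Γ ++ [a])
    (hβ : S.bound = β) {D : Clause L V} {ℓ : Lit L V} {σ : Subst L V}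
    (hst : S.status = .closure (D + {ℓ}) σ) (hg : Clause.Grounds σ (D + {ℓ}))
    (hf : CBFalse lt β (Γ ++ [a]) (Clause.subst (D + {ℓ}) σ))
    (hD : ∀ κ ∈ Clause.subst D σ, Defined (glits Γ) κ)
    (hℓ : ¬ Defined (glits Γ) (ℓ.subst σ))
    (hk : (∀ κ ∈ a.grest, Entails (glits Γ) κ.comp) ∨
      a.grest = {a.gl.comp} ∧ ℓ.subst σ ≠ a.gl.comp) :
    Applicable lt .exploreRefutation S := by
  have hΓ' := hΓ.prefix (List.prefix_append Γ [a])
  rw [Clause.Grounds, Clause.subst_add, Clause.subst_singleton] at hg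
  rw [Clause.subst_add, Clause.subst_singleton] at hf
  have hb : ∀ κ ∈ Clause.subst D σ + {ℓ.subst σ}, κ ∈ boundedLits lt β :=
    fun κ hκ => ⟨hg κ hκ, (hf κ hκ).1⟩
  have hℓmem : ℓ.subst σ ∈ Clause.subst D σ + {ℓ.subst σ} := by simp
  have hDmem : ∀ κ ∈ Clause.subst D σ, κ ∈ Clause.subst D σ + {ℓ.subst σ} :=
    fun κ hκ => Multiset.mem_add.2 (.inl hκ)
  have hidx : IsDefiningIdx (Γ ++ [a]) (ℓ.subst σ) Γ.length :=
    isDefiningIdx_last.2 ⟨.inr (hf _ hℓmem).2, hℓ⟩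
  obtain ⟨P, hP⟩ := exists_isRefutation (Γ := Γ ++ [a]) (a := ⟨ℓ, D, σ, S.level⟩) hlt
    (hf _ hℓmem) (fun g ⟨b, hb, e⟩ => e ▸ (hΓ.gl_mem_boundedLits hb).1) (hb _ hℓmem).1
  -- The last step of the refutation is used. Its distinguished literal `s ≉ s` is false in every
  -- structure, hence defined by the empty trail.
  obtain ⟨-, hchain, I, hI, s, hs⟩ := hP.1
  have hIP : I ∈ P := List.mem_of_getLast? hI
  have hIgl : I.gl = mkLit false s s := hs
  have hIgb : I.gl ∈ boundedLits lt β :=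
    ⟨hchain.isGround_gl (forall_mem_concat (fun b hb => (hΓ.gl_mem_boundedLits hb).1)
      (hb _ hℓmem).1) I hIP,
    hchain.litBelow_gl hlt (forall_mem_concat (fun b hb => (hΓ.gl_mem_boundedLits hb).2)
      (hb _ hℓmem).2) I hIP⟩
  have hIe : Entails ∅ I.gl.comp := by
    intro M _ _ e _
    rw [hIgl, mkLit_comp, holds_mkLit]
    simp
  -- Side literals come from `D` or from annotations on the trail and are defined before `a`, with
  -- one exception: if `a` is a decision, its annotation contributes the complement of `a`.
  have key : ∀ κ ∈ Clause.subst I.cl I.subst, κ ∈ boundedLits lt β ∧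
      Entails (glits (Γ ++ [a])) κ.comp ∧
      (Defined (glits Γ) κ ∨ κ = a.gl.comp ∧ ℓ.subst σ ≠ a.gl.comp) := by
    intro κ hκ
    rw [RStep.subst_cl] at hκ
    obtain rfl | hκ := Multiset.mem_cons.1 hκ
    · exact ⟨hIgb, hIe.mono (Set.empty_subset _), .inl (.inr (hIe.mono (Set.empty_subset _)))⟩
    obtain ⟨b, hb', hκ⟩ := hchain.grest I hIP κ hκ
    obtain hb' | hb' := List.mem_append.1 hb'
    · refine ⟨(hΓ.mem_grest hb' hκ).1, (hΓ.mem_grest hb' hκ).2, ?_⟩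
      obtain hb' | hb' := List.mem_append.1 hb'
      · exact .inl (.inr (hΓ'.mem_grest hb' hκ).2)
      · rw [List.mem_singleton.1 hb'] at hκ
        obtain hk | ⟨hk, hne⟩ := hk
        · exact .inl (.inr (hk κ hκ))
        · rw [hk, Multiset.mem_singleton] at hκ
          exact .inr ⟨hκ, hne⟩
    · rw [List.mem_singleton.1 hb'] at hκ
      have hκ : κ ∈ Clause.subst D σ := hκ
      exact ⟨hb κ (hDmem κ hκ), (hf κ (hDmem κ hκ)).2, .inl (hD κ hκ)⟩
  refine ⟨_, .exploreRefutation (D := D) (ℓ := ℓ) (σ := σ) (P := P) (I := I) hst ?_ ?_ ?_ hIP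
    ?_ ?_⟩
  · intro κ hκ
    rw [hβ, hS]
    exact ⟨fun e => hℓ (e ▸ hD κ hκ),
      hΓ.not_trailLT_last hlt hpos (hb κ (hDmem κ hκ)) (hD κ hκ) hidx⟩
  · rw [hS]
    exact ⟨Γ.length, by simp, hidx⟩
  · rw [hS, hβ]
    exact hP
  · rw [hS, hβ, Clause.subst_add, Clause.subst_singleton]
    -- No common part is needed, because all literals of the new clause are below `ℓσ`.
    refine ⟨0, _, _, ?_, (zero_add _).symm, (zero_add _).symm,
      fun κ hκ => ⟨ℓ.subst σ, hℓmem, ?_⟩⟩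
    · simp
    obtain ⟨h1, h2, h3 | ⟨rfl, hne⟩⟩ := key κ hκ
    · exact hΓ.trailLT_last hlt hpos h1 (hb _ hℓmem) h3 hidx
    · have hlast : (Γ ++ [a])[Γ.length]? = some a := by simp
      -- The exceptional literal, the complement of `a`. Here `ℓσ` is neither `a`, being false, nor
      -- this complement, by assumption; so it comes after both in the ordering.
      obtain ⟨b, hb', -, e⟩ | ⟨b, hb', -, e⟩ | h := hΓ.onTrail_cases hlt (hb _ hℓmem) hidx hlast hpos
      · rw [hlast, Option.some.injEq] at hb'
        subst hb'
        exact absurd (hf _ hℓmem).2 (hΓ.consistent.not_entails_comp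
          (entails_of_mem ⟨a, by simp, e.symm⟩))
      · rw [hlast, Option.some.injEq] at hb'
        subst hb'
        exact absurd e hne
      · exact .comp_off ⟨a, hlast, hpos, rfl⟩ h le_rfl
  · rw [hS, hβ]
    exact fun κ hκ => ⟨(key κ hκ).1.2, (key κ hκ).2.1⟩

/-! ### Invariants of runs -/

/-- The properties of the states in a regular run without Grow, relative to a model `M` of `N`. -/
structure Inv (lt : L.Term V → L.Term V → Prop) (N : Set (Clause L V)) (β : L.Term V)
    (M : Type (max u w)) [L.Structure M] (S : State L V) : Prop where
  initial : S.initial = N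
  bound : S.bound = β
  good : GoodTrail lt β M S.trail
  level : S.level = lastLevel S.trail
  valid : ∀ C ∈ S.initial ∪ S.learned, Clause.Valid M C
  noFalse : ∀ Δ, Δ <+: S.trail → Δ ≠ S.trail → ∀ E ∈ S.initial ∪ S.learned,
    ¬ HasFalseInstance lt β Δ E
  notBot : S.status ≠ .bot
  closure : ∀ D σ, S.status = .closure D σ → Clause.Valid M D ∧ Clause.Grounds σ D ∧
    CBFalse lt β S.trail (Clause.subst D σ)

theorem inv_initialState (hN : ∀ C ∈ N, Clause.Valid M C) : Inv lt N β M (initialState N β) where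
  initial := rfl
  bound := rfl
  good := goodTrail_nil
  level := rfl
  valid := fun C hC => hN C (by simpa [initialState] using hC)
  noFalse := fun Δ h1 h2 => absurd (List.prefix_nil.1 h1) h2
  notBot := by simp [initialState]
  closure := by simp [initialState]

theorem LitReduces.bFalse {ℓ κ : Lit L V} (hlt : IsDesired lt)
    (h : LitReduces (conv lt (glits Γ)) ℓ κ) (hℓ : BFalse lt β Γ ℓ) : BFalse lt β Γ κ :=
  ⟨h.litBelow (groundOriented_conv _) hlt hℓ.1, h.comp.entails_iff.2 hℓ.2⟩

/-- Conflict demands an irreducible grounding. Normalising the substitution preserves falsity and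
the bound, so any false instance suffices. -/
theorem applicable_conflict (hlt : IsDesired lt) (hS : S.status = .top) {E : Clause L V}
    (hE : E ∈ S.initial ∪ S.learned) (hf : HasFalseInstance lt S.bound S.trail E) :
    Applicable lt .conflict S := by
  obtain ⟨τ, hτ, hf⟩ := hf
  obtain ⟨τ', h1, h2, h3, -⟩ := exists_irreducibleSubst hlt (glits S.trail) hτ
  have hf' : CBFalse lt S.bound S.trail (Clause.subst E τ') := by
    intro κ hκ
    obtain ⟨ℓ, hℓ, rfl⟩ := Multiset.mem_map.1 hκ
    exact (h3 ℓ hℓ).bFalse hlt (hf _ (Multiset.mem_map_of_mem _ hℓ))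
  by_cases hl : ClauseLevel S.trail (Clause.subst E τ') 0
  · exact ⟨_, .conflict_bot hS hE h2 hf' h1 hl⟩
  · exact ⟨_, .conflict_closure hS hE h2 hf' h1 hl⟩

/-- The result of a reduction chain application. -/
theorem IsPreReduction.result {P : List (RStep L V)} {I : RStep L V} (hlt : IsDesired lt)
    (hΓ : GoodTrail lt β M Γ) (hα : α.gl ∈ boundedLits lt β) (hv : Clause.Valid M α.cl)
    (hu : ¬ Defined (glits Γ) α.gl) (h : IsPreReduction lt Γ α P) (hI : P.getLast? = some I) :
    I.gl ∈ boundedLits lt β ∧ ¬ Defined (glits Γ) I.gl ∧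
      (∀ t ∈ I.gl.sides, Irreducible (conv lt (glits Γ)) t) ∧ Clause.Valid M I.cl ∧
      ∀ κ ∈ I.grest, κ ∈ α.grest ∨ κ ∈ boundedLits lt β ∧ Entails (glits Γ) κ.comp := by
  obtain ⟨hc, I', hI', b, l, r, s, t, e1, e2, h1, h2⟩ := h
  rw [hI, Option.some.injEq] at hI'
  subst hI'
  have hIP := List.mem_of_getLast? hI
  have hIgl : I.gl = mkLit b (s.subst I.subst) (t.subst I.subst) := by
    rw [RStep.gl, e2, mkLit_subst]
  have hred : LitReduces (conv lt (glits Γ)) α.gl I.gl :=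
    ⟨b, _, _, _, _, by rw [AnnLit.gl, e1, mkLit_subst], hIgl, h1.1, h2.1⟩
  refine ⟨⟨hred.isGround (groundOriented_conv _) hα.1,
    hred.litBelow (groundOriented_conv _) hlt hα.2⟩, by rwa [hred.defined_iff], ?_,
    hc.valid (forall_mem_concat (fun b hb => hΓ.valid hb) hv) I hIP, ?_⟩
  · intro u hu
    rw [hIgl, mem_mkLit_sides] at hu
    obtain rfl | rfl := hu
    · exact h1.2
    · exact h2.2
  · intro κ hκ
    obtain ⟨c, hc', hκ⟩ := hc.grest I hIP κ hκ
    obtain hc' | hc' := List.mem_append.1 hc'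
    · exact .inr (hΓ.mem_grest hc' hκ)
    · exact .inl (List.mem_singleton.1 hc' ▸ hκ)

theorem CanPropagate.good (hlt : IsDesired lt) (hS : Inv lt N β M S) (h : CanPropagate lt S a) :
    Good lt β M S.trail a ∧ a.level = S.level := by
  obtain ⟨-, C₀, C₁, b, s, t, σ, μ, P, I, hmem, hg, hC₀, hC₁, hμ, hund, hbel, -, hred, hI, rfl⟩ := h
  rw [hS.bound] at hund hbel
  have hu : Unifies {e | ∃ f ∈ C₁, e = (f.1, s) ∨ e = (f.2, t)} σ := by
    rintro e ⟨f, hf, rfl | rfl⟩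
    · exact (hC₁ f hf).1
    · exact (hC₁ f hf).2
  rw [hμ.clause hu, Clause.subst_add, Clause.subst_singleton, clauseBelow_iff] at hbel
  rw [Clause.Grounds, Clause.subst_add, Clause.subst_add, Clause.subst_singleton] at hg
  set α : AnnLit L V := ⟨(mkLit b s t).subst μ, Clause.subst C₀ μ, σ, S.level⟩ with hα
  have hgl : α.gl = (mkLit b s t).subst σ := hμ.lit hu _
  have hgrest : α.grest = Clause.subst C₀ σ := hμ.clause hu _
  have hαb : α.gl ∈ boundedLits lt β := by
    rw [hgl]
    exact ⟨hg _ (by simp), hbel _ (by simp)⟩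
  have hαr : ∀ κ ∈ α.grest, κ ∈ boundedLits lt β := by
    intro κ hκ
    rw [hgrest] at hκ
    exact ⟨hg _ (by simp [hκ]), hbel _ (by simp [hκ])⟩
  -- Under `μ` the literals of `C₁` collapse into the propagated one, so the factored clause remains
  -- valid.
  have hv : Clause.Valid M α.cl := by
    intro e
    obtain ⟨ℓ, hℓ, hh⟩ := (hS.valid _ hmem).subst μ e
    rw [Clause.subst_add, Clause.subst_add, Clause.subst_singleton, Multiset.mem_add,
      Multiset.mem_add, Multiset.mem_singleton] at hℓ
    obtain (hℓ | hℓ) | rfl := hℓ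
    · exact ⟨ℓ, Multiset.mem_cons_of_mem hℓ, hh⟩
    · obtain ⟨ℓ', hℓ', rfl⟩ := Multiset.mem_map.1 hℓ
      obtain ⟨f, hf, rfl⟩ := Multiset.mem_map.1 hℓ'
      refine ⟨(mkLit b s t).subst μ, Multiset.mem_cons_self _ _, ?_⟩
      have h1 : f.1.subst μ = s.subst μ := hμ.unifies (f.1, s) ⟨f, hf, .inl rfl⟩
      have h2 : f.2.subst μ = t.subst μ := hμ.unifies (f.2, t) ⟨f, hf, .inr rfl⟩
      rwa [mkLit_subst, h1, h2, ← mkLit_subst] at hh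
    · exact ⟨_, Multiset.mem_cons_self _ _, hh⟩
  obtain ⟨h1, h2, h3, h4, h5⟩ := hred.1.result hlt hS.good hαb hv
    (by rw [hgl]; exact ((hgl ▸ hαb.2).bUndef_iff hlt).1 hund) hI
  have h6 : ∀ κ ∈ I.grest, κ ∈ boundedLits lt β ∧ Entails (glits S.trail) κ.comp := by
    intro κ hκ
    obtain h | h := h5 κ hκ
    · exact ⟨hαr κ h, hC₀ κ (hgrest ▸ h)⟩
    · exact h
  have hcl : ∀ κ ∈ Clause.subst I.cl I.subst, κ ∈ boundedLits lt β := by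
    intro κ hκ
    rw [RStep.subst_cl] at hκ
    obtain rfl | hκ := Multiset.mem_cons.1 hκ
    · exact h1
    · exact (h6 κ hκ).1
  exact ⟨⟨fun κ hκ => (hcl κ hκ).1, fun κ hκ => (hcl κ hκ).2, h2, h3, h4,
    .inl ⟨hS.level, fun κ hκ => (h6 κ hκ).2⟩⟩, rfl⟩

theorem CanDecide.good (hlt : IsDesired lt) (hS : Inv lt N β M S) (h : CanDecide lt S a) :
    Good lt β M S.trail a ∧ a.level = S.level + 1 := by
  obtain ⟨-, C₀, ℓ, σ, P, I, hmem, hg, -, hund, hbel, -, hred, hI, rfl⟩ := h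
  rw [hS.bound] at hund hbel
  rw [Clause.subst_add, Clause.subst_singleton, clauseBelow_iff] at hbel
  rw [Clause.Grounds, Clause.subst_add, Clause.subst_singleton] at hg
  have hb : ℓ.subst σ ∈ boundedLits lt β := ⟨hg _ (by simp), hbel _ (by simp)⟩
  obtain ⟨h1, h2, h3, h4, -⟩ := hred.1.result (α := ⟨ℓ, C₀, σ, S.level + 1⟩) hlt hS.good hb
    (by
      have := hS.valid _ hmem
      rwa [Multiset.add_comm, Multiset.singleton_add] at this)
    ((hb.2.bUndef_iff hlt).1 hund) hI
  have hcl : ∀ κ ∈ Clause.subst (I.lit ::ₘ {I.lit.comp}) I.subst, κ ∈ boundedLits lt β := by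
    intro κ hκ
    rw [Clause.subst_cons, Clause.subst_singleton] at hκ
    obtain rfl | hκ := Multiset.mem_cons.1 hκ
    · exact h1
    · rw [Multiset.mem_singleton.1 hκ]
      exact ⟨h1.1.comp, litBelow_comp.2 h1.2⟩
  refine ⟨⟨fun κ hκ => (hcl κ hκ).1, fun κ hκ => (hcl κ hκ).2, h2, h3, fun e => ?_,
    .inr ⟨by rw [hS.level], rfl⟩⟩, rfl⟩
  by_cases h : I.lit.Holds e
  · exact ⟨I.lit, by simp [AnnLit.cl], h⟩
  · exact ⟨I.lit.comp, by simp [AnnLit.cl], holds_comp.2 h⟩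

/-- As Conflict has precedence, the trail has no false instances when a literal is appended to it.
-/
theorem Inv.noFalse_concat (hlt : IsDesired lt) (hS : Inv lt N β M S) (htop : S.status = .top)
    (hc : ¬ Applicable lt .conflict S) {Δ : Trail L V} (hΔ : Δ <+: S.trail ++ [a])
    (hne : Δ ≠ S.trail ++ [a]) : ∀ E ∈ S.initial ∪ S.learned, ¬ HasFalseInstance lt β Δ E := by
  intro E hE hf
  have hΔ' : Δ <+: S.trail := (List.prefix_concat_iff.1 hΔ).resolve_left hne
  by_cases he : Δ = S.trail
  · subst he
    rw [← hS.bound] at hf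
    exact hc (applicable_conflict hlt htop hE hf)
  · exact hS.noFalse Δ hΔ' he E hE hf

/-- After Backtrack, no clause has a false instance. -/
theorem Step.backtrack_noFalse (hS : Inv lt N β M S) (h : Step lt .backtrack S T) :
    ∀ Δ, Δ <+: T.trail → ∀ E ∈ T.initial ∪ T.learned, ¬ HasFalseInstance lt β Δ E := by
  cases h with
  | @backtrack _ Γ Γ' K D ℓ σ i i' hst hΓ hl hk hf hmin hi =>
    intro Δ hΔ E hE
    have hΔ : Δ <+: Γ := hΔ
    simp only [Set.mem_union, Set.mem_singleton_iff] at hE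
    rw [← or_assoc] at hE
    obtain hE | rfl := hE
    -- For the old clauses `Δ` is a proper prefix of the former trail; for the new one the choice of
    -- the shortest prefix `Γ, K` applies.
    · refine hS.noFalse Δ ?_ ?_ E hE
      · rw [hΓ, List.append_assoc]
        exact hΔ.trans (List.prefix_append _ _)
      · rintro rfl
        have := hΔ.length_le
        rw [hΓ] at this
        simp at this
    · rw [← hS.bound]
      exact hmin Δ hΔ

theorem Step.inv [Infinite V] [Nonempty M] (hlt : IsDesired lt) (hS : Inv lt N β M S) {ρ : Rule}
    (hρ : ρ ≠ .grow)
    (hc : ρ ≠ .conflict → ρ ≠ .factorize → ¬ Applicable lt .conflict S)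
    (h : Step lt ρ S T) : Inv lt N β M T := by
  have hbt : ρ = .backtrack → ∀ Δ, Δ <+: T.trail → ∀ E ∈ T.initial ∪ T.learned,
      ¬ HasFalseInstance lt β Δ E := by
    rintro rfl
    exact h.backtrack_noFalse hS
  cases h with
  | propagate h =>
    obtain ⟨hg, hl⟩ := h.good hlt hS
    refine ⟨hS.initial, hS.bound, goodTrail_concat.2 ⟨hS.good, hg⟩, ?_, hS.valid,
      fun Δ => hS.noFalse_concat hlt h.1 (hc (by simp) (by simp)), hS.notBot, ?_⟩
    · rw [lastLevel_concat, hl]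
    · simp [h.1]
  | decide h =>
    obtain ⟨hg, hl⟩ := h.good hlt hS
    refine ⟨hS.initial, hS.bound, goodTrail_concat.2 ⟨hS.good, hg⟩, ?_, hS.valid,
      fun Δ => hS.noFalse_concat hlt h.1 (hc (by simp) (by simp)), hS.notBot, ?_⟩
    · rw [lastLevel_concat, hl]
    · simp [h.1]
  | conflict_bot hst hD hσ hf hi hl =>
    rw [hS.bound] at hf
    -- Satisfiability of `N` enters here: a valid clause is never false at level zero.
    exact absurd hl (hS.good.not_clauseLevel_zero (hS.valid _ hD) hf)
  | conflict_closure hst hD hσ hf hi hl =>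
    refine ⟨hS.initial, hS.bound, hS.good, hS.level, hS.valid, hS.noFalse, by simp, ?_⟩
    intro D' σ' h
    simp only [Status.closure.injEq] at h
    obtain ⟨rfl, rfl⟩ := h
    rw [hS.bound] at hf
    exact ⟨hS.valid _ hD, hσ, hf⟩
  | @skip _ Γ K b D σ hst hΓ hf =>
    have hpre : Γ ++ [K] <+: S.trail := by
      rw [hΓ]
      exact List.prefix_append _ _
    refine ⟨hS.initial, hS.bound, hS.good.prefix hpre, lastLevel_concat.symm, hS.valid, ?_,
      hS.notBot, ?_⟩
    · intro Δ hΔ _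
      refine hS.noFalse Δ (hΔ.trans hpre) ?_
      rintro rfl
      have := List.IsPrefix.length_le hΔ
      rw [hΓ] at this
      simp at this
    · intro D' σ' h
      have h : S.status = .closure D' σ' := h
      rw [hst, Status.closure.injEq] at h
      obtain ⟨rfl, rfl⟩ := h
      obtain ⟨h1, h2, -⟩ := hS.closure _ _ hst
      rw [hS.bound] at hf
      exact ⟨h1, h2, hf⟩
  | @exploreRefutation _ D ℓ σ P I hst hmax hdef hP hI hlt' hf =>
    refine ⟨hS.initial, hS.bound, hS.good, hS.level, hS.valid, hS.noFalse, by simp, ?_⟩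
    intro D' σ' h
    simp only [Status.closure.injEq] at h
    obtain ⟨rfl, rfl⟩ := h
    obtain ⟨h1, h2, h3⟩ := hS.closure _ _ hst
    rw [Clause.Grounds, Clause.subst_add, Clause.subst_singleton] at h2
    obtain ⟨-, hchain, -⟩ := hP.1
    refine ⟨hchain.valid (forall_mem_concat (fun b hb => hS.good.valid hb) ?_) I hI, ?_, ?_⟩
    · rwa [Multiset.add_comm, Multiset.singleton_add] at h1
    · intro κ hκ
      rw [RStep.subst_cl] at hκ
      obtain rfl | hκ := Multiset.mem_cons.1 hκ
      · exact hchain.isGround_gl (forall_mem_concat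
          (fun b hb => (hS.good.gl_mem_boundedLits hb).1) (h2 _ (by simp [AnnLit.gl]))) I hI
      · obtain ⟨b, hb, hκ⟩ := hchain.grest I hI κ hκ
        obtain hb | hb := List.mem_append.1 hb
        · exact (hS.good.mem_grest hb hκ).1.1
        · rw [List.mem_singleton.1 hb] at hκ
          exact h2 κ (Multiset.mem_add.2 (.inl hκ))
    · rwa [hS.bound] at hf
  | @factorize _ D b s t s' t' σ μ hst hs ht hμ =>
    refine ⟨hS.initial, hS.bound, hS.good, hS.level, hS.valid, hS.noFalse, by simp, ?_⟩
    intro D' σ' h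
    simp only [Status.closure.injEq] at h
    obtain ⟨rfl, rfl⟩ := h
    obtain ⟨h1, h2, h3⟩ := hS.closure _ _ hst
    have hu : Unifies {(s, s'), (t, t')} σ := by simp [Unifies, hs, ht]
    rw [Clause.Grounds, hμ.clause hu]
    rw [Clause.Grounds, Clause.subst_add] at h2
    rw [Clause.subst_add] at h3
    refine ⟨fun e => ?_, fun κ hκ => h2 κ (Multiset.mem_add.2 (.inl hκ)),
      fun κ hκ => h3 κ (Multiset.mem_add.2 (.inl hκ))⟩
    obtain ⟨ℓ, hℓ, hh⟩ := h1.subst μ e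
    rw [Clause.subst_add, Clause.subst_singleton, Multiset.mem_add, Multiset.mem_singleton] at hℓ
    obtain hℓ | rfl := hℓ
    · exact ⟨ℓ, hℓ, hh⟩
    · refine ⟨(mkLit b s t).subst μ, by rw [Clause.subst_add]; simp, ?_⟩
      have e1 : s.subst μ = s'.subst μ := hμ.unifies (s, s') (by simp)
      have e2 : t.subst μ = t'.subst μ := hμ.unifies (t, t') (by simp)
      rwa [mkLit_subst, e1, e2, ← mkLit_subst]
  | @equalityResolution _ D s s' σ μ hst hs hμ =>
    refine ⟨hS.initial, hS.bound, hS.good, hS.level, hS.valid, hS.noFalse, by simp, ?_⟩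
    intro D' σ' h
    simp only [Status.closure.injEq] at h
    obtain ⟨rfl, rfl⟩ := h
    obtain ⟨h1, h2, h3⟩ := hS.closure _ _ hst
    have hu : Unifies {(s, s')} σ := by simp [Unifies, hs]
    rw [Clause.Grounds, hμ.clause hu]
    rw [Clause.Grounds, Clause.subst_add] at h2
    rw [Clause.subst_add] at h3
    refine ⟨fun e => ?_, fun κ hκ => h2 κ (Multiset.mem_add.2 (.inl hκ)),
      fun κ hκ => h3 κ (Multiset.mem_add.2 (.inl hκ))⟩
    obtain ⟨ℓ, hℓ, hh⟩ := h1.subst μ e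
    rw [Clause.subst_add, Clause.subst_singleton, Multiset.mem_add, Multiset.mem_singleton] at hℓ
    obtain hℓ | rfl := hℓ
    · exact ⟨ℓ, hℓ, hh⟩
    · have e1 : s.subst μ = s'.subst μ := hμ.unifies (s, s') (by simp)
      rw [mkLit_subst, holds_mkLit, e1] at hh
      simp at hh
  | @backtrack _ Γ Γ' K D ℓ σ i i' hst hΓ hl hk hf hmin hi =>
    have hpre : Γ ++ [K] <+: S.trail := by
      rw [hΓ]
      exact List.prefix_append _ _
    obtain ⟨hg1, hg2⟩ := goodTrail_concat.1 (hS.good.prefix hpre)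
    refine ⟨hS.initial, hS.bound, hg1, ?_, ?_, fun Δ hΔ _ => hbt rfl Δ hΔ, by simp, by simp⟩
    · have hdec : IsDecision Γ K ↔ K.level = lastLevel Γ + 1 := Iff.rfl
      rw [hdec] at hi
      have := hg2.kind
      change K.level - i = lastLevel Γ
      omega
    · intro C hC
      simp only [Set.mem_union, Set.mem_singleton_iff] at hC
      rw [← or_assoc] at hC
      obtain hC | rfl := hC
      · exact hS.valid C hC
      · exact (hS.closure _ _ hst).1
  | grow => exact absurd rfl hρ

end Invariants

end SCLEQ

namespace SCLEQ

/-! ### Regular runs that do not end in a stuck state can be continued. -/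

section Progress

variable {L : FirstOrder.Language.{u, v}} {V : Type w}

open FirstOrder.Language (Term)

variable {lt : L.Term V → L.Term V → Prop} {β : L.Term V} {M : Type (max u w)}
  [L.Structure M] {Γ : Trail L V} {a : AnnLit L V} {N : Set (Clause L V)} {S T : State L V}

/-! ### Progress in conflict states -/

/-- Literals of a level below the level of the state are defined before the last trail literal. -/
theorem Inv.defined_of_clauseLevel (hS : Inv lt N β M S) (ht : S.trail = Γ ++ [a])
    {D : Clause L V} {i : ℕ} (hf : CBFalse lt β S.trail D)
    (hl : ClauseLevel S.trail D i) (hi : i < S.level) : ∀ κ ∈ D, Defined (glits Γ) κ := by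
  intro κ hκ
  by_contra hd
  have hg := hS.good
  rw [ht] at hf hl hg
  rw [hS.level, ht, lastLevel_concat] at hi
  have hidx : IsDefiningIdx (Γ ++ [a]) κ Γ.length :=
    isDefiningIdx_last.2 ⟨.inr (hf κ hκ).2, hd⟩
  obtain ⟨-, h⟩ | ⟨rfl, -⟩ := hl
  · have : a.level ≤ i := h ⟨κ, hκ, hg.litLevel_iff.2 (.inl ⟨_, a, hidx, by simp, rfl⟩)⟩
    omega
  · exact absurd hκ (Multiset.notMem_zero κ)

/-- All literals but one have a level below that of the state, so they are defined before the last
trail literal `a`. It remains to see whether the last one, `ℓ`, needs `a`: if not, Skip applies; if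
it does, Explore-Refutation applies except when `ℓσ` is the complement of a decision. -/
theorem Inv.backtrack_cases [Infinite V] [Nonempty M] (hlt : IsDesired lt)
    (hS : Inv lt N β M S) (h : Applicable lt .backtrack S) :
    Applicable lt .skip S ∨ Applicable lt .exploreRefutation S ∨
      ∃ Γ a D σ, S.trail = Γ ++ [a] ∧ S.status = .closure D σ ∧
        (∃ ℓ ∈ D, ℓ.subst σ = a.gl.comp) ∧ a.level = lastLevel Γ + 1 := by
  obtain ⟨T, h⟩ := h
  cases h with
  | @backtrack _ Γ₀ Γ' K D ℓ σ i i' hst hΓ hl hk hf' hmin hi =>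
  obtain ⟨hv, hg, hf⟩ := hS.closure _ _ hst
  obtain ⟨Γ, a, ht⟩ : ∃ Γ a, S.trail = Γ ++ [a] := by
    rcases List.eq_nil_or_concat S.trail with h | ⟨Γ, a, h⟩
    · rw [hΓ] at h
      simp at h
    · exact ⟨Γ, a, by simpa using h⟩
  have hf0 := hf
  rw [Clause.subst_add, Clause.subst_singleton] at hf
  have hD := hS.defined_of_clauseLevel ht (fun κ hκ => hf κ (Multiset.mem_add.2 (.inl hκ))) hl hk
  have hgood := hS.good
  rw [hS.level] at hk
  rw [ht] at hgood hf hk hf0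
  rw [lastLevel_concat] at hk
  by_cases hℓ : Defined (glits Γ) (ℓ.subst σ)
  · have hfΓ : CBFalse lt β Γ (Clause.subst (D + {ℓ}) σ) := by
      intro κ hκ
      rw [Clause.subst_add, Clause.subst_singleton] at hκ
      refine ⟨(hf κ hκ).1, hgood.entails_comp_of_defined
        (glits_mono (List.subset_append_left _ _)) ?_ (hf κ hκ).2⟩
      obtain hκ | hκ := Multiset.mem_add.1 hκ
      · exact hD κ hκ
      · exact Multiset.mem_singleton.1 hκ ▸ hℓ
    -- Skip must leave a nonempty trail. A valid clause has no false instance in the empty one, so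
    -- some `K'` remains.
    rcases List.eq_nil_or_concat Γ with rfl | ⟨Γ₁, K', rfl⟩
    · exact absurd ⟨σ, hg, hfΓ⟩ (not_hasFalseInstance_nil hv)
    · rw [List.concat_eq_append] at hfΓ ht
      rw [← hS.bound] at hfΓ
      exact .inl ⟨_, .skip hst ht hfΓ⟩
  · right
    have explore := applicable_exploreRefutation hlt hgood (by omega) ht hS.bound hst hg hf0 hD hℓ
    obtain ⟨-, hkind⟩ | ⟨hlev, hkind⟩ := (goodTrail_concat.1 hgood).2.kind
    · exact .inl (explore (.inl hkind))
    · by_cases he : ℓ.subst σ = a.gl.comp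
      · exact .inr ⟨Γ, a, _, σ, ht, hst, ⟨ℓ, by simp, he⟩, hlev⟩
      · exact .inl (explore (.inr ⟨hkind, he⟩))

/-! ### The history of conflict states -/

theorem Step.closure_cases {ρ : Rule} (h : Step lt ρ S T) {D : Clause L V} {σ : Subst L V}
    (hT : T.status = .closure D σ) :
    (ρ = .conflict ∧ S.status = .top ∧ T.trail = S.trail ∧ T.learned = S.learned) ∨
      (ρ ≠ .conflict ∧ (∃ D σ, S.status = .closure D σ) ∧ T.learned = S.learned ∧
        ((ρ ≠ .skip ∧ T.trail = S.trail) ∨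
          (ρ = .skip ∧ T.trail <+: S.trail ∧ T.trail ≠ S.trail))) := by
  cases h with
  | propagate h => simp [h.1] at hT
  | decide h => simp [h.1] at hT
  | conflict_bot => simp at hT
  | conflict_closure hst => exact .inl ⟨rfl, hst, rfl, rfl⟩
  | skip hst hΓ =>
    refine .inr ⟨by simp, ⟨_, _, hst⟩, rfl, .inr ⟨rfl, ?_, ?_⟩⟩
    · rw [hΓ]
      exact List.prefix_append _ _
    · rw [hΓ]
      simp
  | exploreRefutation hst => exact .inr ⟨by simp, ⟨_, _, hst⟩, rfl, .inl ⟨by simp, rfl⟩⟩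
  | factorize hst => exact .inr ⟨by simp, ⟨_, _, hst⟩, rfl, .inl ⟨by simp, rfl⟩⟩
  | equalityResolution hst => exact .inr ⟨by simp, ⟨_, _, hst⟩, rfl, .inl ⟨by simp, rfl⟩⟩
  | backtrack => simp at hT
  | grow hst => simp [hst] at hT

theorem IsLastConflict.unique {ρ : ℕ → Rule} {i j k : ℕ} (hj : IsLastConflict ρ j i)
    (hk : IsLastConflict ρ k i) : j = k := by
  by_contra hne
  obtain h | h := lt_or_gt_of_ne hne
  · exact hj.2.2 k h hk.1 hk.2.1
  · exact hk.2.2 j h hj.1 hj.2.1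

section Runs

variable {S : ℕ → State L V} {ρ : ℕ → Rule} {n : ℕ∞}

theorem IsRegularRun.inv [Infinite V] [Nonempty M] (hlt : IsDesired lt)
    (hN : ∀ C ∈ N, Clause.Valid M C) (hr : IsRegularRun lt N β S ρ n)
    (hng : ∀ i : ℕ, (i : ℕ∞) < n → ρ i ≠ .grow) (i : ℕ) (hi : (i : ℕ∞) ≤ n) :
    Inv lt N β M (S i) := by
  induction i with
  | zero => rw [hr.run.1]; exact inv_initialState hN
  | succ i ih =>
    have hi' : (i : ℕ∞) < n := lt_of_lt_of_le (by exact_mod_cast Nat.lt_succ_self i) hi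
    exact Step.inv hlt (ih hi'.le) (hng i hi')
      (fun h1 h2 => (hr.precedence i hi' h1 h2).1) (hr.run.2 i hi')

/-- The state in which the last application of Conflict took place. -/
theorem IsRun.exists_lastConflict (hr : IsRun lt N β S ρ n) (i : ℕ) (hi : (i : ℕ∞) ≤ n)
    {D : Clause L V} {σ : Subst L V} (hst : (S i).status = .closure D σ) :
    ∃ j, IsLastConflict ρ j i ∧ (S j).status = .top ∧ (S i).learned = (S j).learned ∧
      (((¬ ∃ m, j < m ∧ m < i ∧ ρ m = .skip) ∧ (S i).trail = (S j).trail) ∨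
        ((∃ m, j < m ∧ m < i ∧ ρ m = .skip) ∧ (S i).trail <+: (S j).trail ∧
          (S i).trail ≠ (S j).trail)) := by
  induction i generalizing D σ with
  | zero => rw [hr.1] at hst; simp [initialState] at hst
  | succ i ih =>
    have hi' : (i : ℕ∞) < n := lt_of_lt_of_le (by exact_mod_cast Nat.lt_succ_self i) hi
    obtain ⟨h1, h2, h3, h4⟩ | ⟨h1, ⟨D', σ', h2⟩, h3, h4⟩ := (hr.2 i hi').closure_cases hst
    · refine ⟨i, ⟨Nat.lt_succ_self i, h1, fun m _ _ => by omega⟩, h2, h4, .inl ⟨?_, h3⟩⟩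
      rintro ⟨m, hm, hm', -⟩
      omega
    · obtain ⟨j, ⟨hj1, hj2, hj3⟩, hj4, hj5, hj6⟩ := ih hi'.le h2
      refine ⟨j, ⟨by omega, hj2, fun m hm hm' => ?_⟩, hj4, h3.trans hj5, ?_⟩
      · obtain h | rfl := Nat.lt_succ_iff_lt_or_eq.1 hm'
        · exact hj3 m hm h
        · exact h1
      · have hskip : ∀ {m}, m < i → m < i + 1 := fun h => by omega
        obtain ⟨h4, h5⟩ | ⟨h4, h5, h6⟩ := h4
        · rw [h5]
          obtain ⟨hn, ht⟩ | ⟨⟨m, hm⟩, ht⟩ := hj6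
          · refine .inl ⟨?_, ht⟩
            rintro ⟨m, hm, hm', hs⟩
            obtain h | rfl := Nat.lt_succ_iff_lt_or_eq.1 hm'
            · exact hn ⟨m, hm, h, hs⟩
            · exact h4 hs
          · exact .inr ⟨⟨m, hm.1, hskip hm.2.1, hm.2.2⟩, ht⟩
        · have hpre : (S i).trail <+: (S j).trail := by
            obtain ⟨-, ht⟩ | ⟨-, ht, -⟩ := hj6
            · rw [ht]
            · exact ht
          refine .inr ⟨⟨i, hj1, Nat.lt_succ_self i, h4⟩, h5.trans hpre, fun he => h6 ?_⟩
          exact h5.eq_of_length_le (by rw [he]; exact hpre.length_le)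

theorem Step.hasFalseInstance {S T : State L V} (h : Step lt .conflict S T) :
    ∃ E ∈ S.initial ∪ S.learned, HasFalseInstance lt S.bound S.trail E := by
  cases h with
  | conflict_bot hst hD hσ hf hi hl => exact ⟨_, hD, _, hσ, hf⟩
  | conflict_closure hst hD hσ hf hi hl => exact ⟨_, hD, _, hσ, hf⟩

/-- Conflict is applied only after Propagate or Decide. -/
theorem IsRegularRun.before_conflict [Infinite V] [Nonempty M] (hlt : IsDesired lt)
    (hN : ∀ C ∈ N, Clause.Valid M C) (hr : IsRegularRun lt N β S ρ n)
    (hng : ∀ i : ℕ, (i : ℕ∞) < n → ρ i ≠ .grow) {j : ℕ} (hj : (j : ℕ∞) < n)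
    (hc : ρ j = .conflict) (htop : (S j).status = .top) :
    ∃ m b, m + 1 = j ∧ (S j).trail = (S m).trail ++ [b] ∧ (S j).learned = (S m).learned ∧
      ((ρ m = .propagate ∧ CanPropagate lt (S m) b) ∨
        (ρ m = .decide ∧ CanDecide lt (S m) b)) := by
  have hstep := hr.run.2 j hj
  rw [hc] at hstep
  obtain ⟨E, hE, hf⟩ := hstep.hasFalseInstance
  have hinv := hr.inv hlt hN hng j hj.le
  rw [hinv.bound] at hf
  cases j with
  | zero =>
    rw [hr.run.1] at hf
    exact absurd hf (not_hasFalseInstance_nil (hinv.valid E hE))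
  | succ m =>
    have hm : (m : ℕ∞) < n := lt_trans (by exact_mod_cast Nat.lt_succ_self m) hj
    have hstep' := hr.run.2 m hm
    have hng' := hng m hm
    have hinv' := hr.inv hlt hN hng m hm.le
    -- Backtrack leaves no false instance behind, so Conflict cannot follow it immediately.
    have hbt : ρ m ≠ .backtrack := by
      intro h
      rw [h] at hstep'
      exact hstep'.backtrack_noFalse hinv' _ (List.prefix_refl _) E hE hf
    generalize hR : ρ m = R at *
    generalize hT : S (m + 1) = T at *
    cases hstep' with
    | propagate h => exact ⟨m, _, rfl, by simp, by simp, .inl ⟨hR, h⟩⟩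
    | decide h => exact ⟨m, _, rfl, by simp, by simp, .inr ⟨hR, h⟩⟩
    | conflict_bot => simp at htop
    | conflict_closure => simp at htop
    | skip hst => simp [hst] at htop
    | exploreRefutation => simp at htop
    | factorize => simp at htop
    | equalityResolution => simp at htop
    | backtrack => exact absurd rfl hbt
    | grow => exact absurd rfl hng'

/-! ### Continuation of regular runs -/

/-- Allowing Decide only when Propagate is not applicable at all settles the second and the third
regularity condition at once. -/
theorem IsRegularRun.extend {m : ℕ} (hr : IsRegularRun lt N β S ρ m) {R : Rule} {T : State L V}
    (hT : Step lt R (S m) T)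
    (h1 : R ≠ .conflict → R ≠ .factorize →
      ¬ Applicable lt .conflict (S m) ∧ ¬ Applicable lt .factorize (S m))
    (h2 : R = .decide → ¬ Applicable lt .propagate (S m))
    (h4 : R = .backtrack → ∀ j, IsLastConflict ρ j m →
      (∃ k, j < k ∧ k < m ∧ ρ k = .skip) ∨ AfterDecide ρ j)
    (h5 : R = .backtrack → ∀ j, IsLastConflict ρ j m → AfterDecide ρ j →
      ∃ Γ a D σ, (S m).trail = Γ ++ [a] ∧ (S m).status = .closure D σ ∧
        ∃ ℓ ∈ D, ℓ.subst σ = a.gl.comp) :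
    ∃ S' ρ', (∀ i ≤ m, S' i = S i) ∧ (∀ i < m, ρ' i = ρ i) ∧
      IsRegularRun lt N β S' ρ' ((m + 1 : ℕ) : ℕ∞) ∧ ρ' m = R := by
  have cast : ∀ {i k : ℕ}, (i : ℕ∞) < (k : ℕ∞) ↔ i < k := Nat.cast_lt
  obtain ⟨S', hS, hS'⟩ : ∃ S' : ℕ → State L V, (∀ i ≤ m, S' i = S i) ∧ S' (m + 1) = T :=
    ⟨fun i => if i ≤ m then S i else T, fun i hi => if_pos hi, if_neg (by omega)⟩
  obtain ⟨ρ', hρ, hρ'⟩ : ∃ ρ' : ℕ → Rule, (∀ i < m, ρ' i = ρ i) ∧ ρ' m = R :=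
    ⟨fun i => if i < m then ρ i else R, fun i hi => if_pos hi, if_neg (lt_irrefl m)⟩
  refine ⟨S', ρ', hS, hρ, ?_, hρ'⟩
  have hlast : ∀ {i j}, i ≤ m → IsLastConflict ρ' j i → IsLastConflict ρ j i := by
    rintro i j hi ⟨a1, a2, a3⟩
    refine ⟨a1, by rwa [hρ j (by omega)] at a2, fun k hk hk' => ?_⟩
    have := a3 k hk hk'
    rwa [hρ k (by omega)] at this
  have hafter : ∀ {j}, j < m → (AfterDecide ρ' j ↔ AfterDecide ρ j) := by
    intro j hj
    constructor
    · rintro ⟨k, rfl, h⟩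
      exact ⟨k, rfl, by rwa [hρ k (by omega)] at h⟩
    · rintro ⟨k, rfl, h⟩
      exact ⟨k, rfl, by rwa [hρ k (by omega)]⟩
  have hsplit : ∀ {i : ℕ}, (i : ℕ∞) < ((m + 1 : ℕ) : ℕ∞) → i < m ∨ i = m := fun h =>
    Nat.lt_succ_iff_lt_or_eq.1 (cast.1 h)
  refine ⟨⟨by rw [hS 0 (Nat.zero_le m)]; exact hr.run.1, fun i hi => ?_⟩, fun i hi => ?_,
    fun i hi => ?_, fun i hi => ?_, fun i hi => ?_, fun i hi => ?_⟩
  · obtain hi | rfl := hsplit hi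
    · rw [hρ i hi, hS i hi.le, hS (i + 1) hi]
      exact hr.run.2 i (cast.2 hi)
    · rwa [hρ', hS i le_rfl, hS']
  · obtain hi | rfl := hsplit hi
    · rw [hρ i hi, hS i hi.le]
      exact hr.precedence i (cast.2 hi)
    · rwa [hρ', hS i le_rfl]
  · obtain hi | rfl := hsplit hi
    · rw [hρ i hi, hS i hi.le]
      exact hr.levelZero i (cast.2 hi)
    · rw [hρ', hS i le_rfl]
      exact fun _ => h2
  · obtain hi | rfl := hsplit hi
    · rw [hρ i hi, hS i hi.le, hS (i + 1) hi]
      exact hr.noOppositeDecision i (cast.2 hi)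
    · rw [hρ', hS i le_rfl]
      rintro hR a - ⟨c, hc, -⟩
      exact h2 hR ⟨_, .propagate hc⟩
  · obtain hi | rfl := hsplit hi
    · rw [hρ i hi]
      intro hb j hj
      have hj' := hlast hi.le hj
      rw [hafter (hj'.1.trans hi)]
      obtain ⟨k, a1, a2, a3⟩ | h := hr.skipOnce i (cast.2 hi) hb j hj'
      · exact .inl ⟨k, a1, a2, by rwa [hρ k (by omega)]⟩
      · exact .inr h
    · rw [hρ']
      intro hb j hj
      have hj' := hlast le_rfl hj
      rw [hafter hj'.1]
      obtain ⟨k, a1, a2, a3⟩ | h := h4 hb j hj'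
      · exact .inl ⟨k, a1, a2, by rwa [hρ k a2]⟩
      · exact .inr h
  · obtain hi | rfl := hsplit hi
    · rw [hρ i hi, hS i hi.le]
      intro hb j hj
      have hj' := hlast hi.le hj
      rw [hafter (hj'.1.trans hi)]
      exact hr.backtrackAfterDecide i (cast.2 hi) hb j hj'
    · rw [hρ', hS i le_rfl]
      intro hb j hj
      have hj' := hlast le_rfl hj
      rw [hafter hj'.1]
      exact h5 hb j hj'

/-- A regular run that does not end in a stuck state can be continued. -/
theorem IsRegularRun.exists_continuation [Infinite V] [Nonempty M] (hlt : IsDesired lt)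
    (hN : ∀ C ∈ N, Clause.Valid M C) {m : ℕ} (hr : IsRegularRun lt N β S ρ m)
    (hng : ∀ i : ℕ, (i : ℕ∞) < (m : ℕ∞) → ρ i ≠ .grow) (hns : ¬ IsStuck lt (S m)) :
    ∃ S' ρ', (∀ i ≤ m, S' i = S i) ∧ (∀ i < m, ρ' i = ρ i) ∧
      IsRegularRun lt N β S' ρ' ((m + 1 : ℕ) : ℕ∞) ∧ ρ' m ≠ .grow := by
  have hinv := hr.inv hlt hN hng m le_rfl
  have use : ∀ {R : Rule}, Applicable lt R (S m) → R ≠ .grow →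
      (R ≠ .conflict → R ≠ .factorize →
        ¬ Applicable lt .conflict (S m) ∧ ¬ Applicable lt .factorize (S m)) →
      (R = .decide → ¬ Applicable lt .propagate (S m)) →
      (R = .backtrack → ∀ j, IsLastConflict ρ j m →
        (∃ k, j < k ∧ k < m ∧ ρ k = .skip) ∨ AfterDecide ρ j) →
      (R = .backtrack → ∀ j, IsLastConflict ρ j m → AfterDecide ρ j →
        ∃ Γ a D σ, (S m).trail = Γ ++ [a] ∧ (S m).status = .closure D σ ∧
          ∃ ℓ ∈ D, ℓ.subst σ = a.gl.comp) →
      ∃ S' ρ', (∀ i ≤ m, S' i = S i) ∧ (∀ i < m, ρ' i = ρ i) ∧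
        IsRegularRun lt N β S' ρ' ((m + 1 : ℕ) : ℕ∞) ∧ ρ' m ≠ .grow := by
    rintro R ⟨T, hT⟩ hg h1 h2 h4 h5
    obtain ⟨S', ρ', a1, a2, a3, a4⟩ := hr.extend hT h1 h2 h4 h5
    exact ⟨S', ρ', a1, a2, a3, a4 ▸ hg⟩
  by_cases hc : Applicable lt .conflict (S m)
  · exact use hc (by simp) (by simp) (by simp) (by simp) (by simp)
  by_cases hfac : Applicable lt .factorize (S m)
  · exact use hfac (by simp) (by simp) (by simp) (by simp) (by simp)
  by_cases hp : Applicable lt .propagate (S m)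
  · exact use hp (by simp) (fun _ _ => ⟨hc, hfac⟩) (by simp) (by simp) (by simp)
  by_cases hd : Applicable lt .decide (S m)
  · exact use hd (by simp) (fun _ _ => ⟨hc, hfac⟩) (fun _ => hp) (by simp) (by simp)
  by_cases hs : Applicable lt .skip (S m)
  · exact use hs (by simp) (fun _ _ => ⟨hc, hfac⟩) (by simp) (by simp) (by simp)
  by_cases he : Applicable lt .exploreRefutation (S m)
  · exact use he (by simp) (fun _ _ => ⟨hc, hfac⟩) (by simp) (by simp) (by simp)
  by_cases hq : Applicable lt .equalityResolution (S m)
  · exact use hq (by simp) (fun _ _ => ⟨hc, hfac⟩) (by simp) (by simp) (by simp)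
  by_cases hb : Applicable lt .backtrack (S m)
  -- Backtrack is tried last. Its trail then ends in a decision whose complement occurs in the
  -- closure, as the fifth condition demands. For the fourth, if nothing was skipped, the trail is
  -- still that of the conflict.
  · obtain ⟨Γ, a, D, σ, ht, hst, hℓ, hlev⟩ :=
      ((hinv.backtrack_cases hlt hb).resolve_left hs).resolve_left he
    refine use hb (by simp) (fun _ _ => ⟨hc, hfac⟩) (by simp) (fun _ j hj => ?_)
      fun _ j hj _ => ⟨Γ, a, D, σ, ht, hst, hℓ⟩
    obtain ⟨j', hj', htop, -, ⟨-, htr⟩ | ⟨hskip, -⟩⟩ := hr.run.exists_lastConflict m le_rfl hst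
    · obtain rfl := hj.unique hj'
      obtain ⟨k, b, hk, hb, -, ⟨-, hprop⟩ | ⟨hdec, -⟩⟩ :=
        hr.before_conflict hlt hN hng (Nat.cast_lt.2 hj.1) hj.2.1 htop
      · rw [← htr, ht] at hb
        obtain ⟨rfl, hab⟩ := List.append_inj' hb rfl
        obtain rfl : a = b := by simpa using hab
        -- Had Propagate preceded Conflict, `a` would have the level of its predecessor; but it is
        -- one higher.
        have hkm : (k : ℕ∞) ≤ (m : ℕ∞) := Nat.cast_le.2 (by have := hj.1; omega)
        have hk' := hr.inv hlt hN hng k hkm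
        have := (hprop.good hlt hk').2
        have := hk'.level
        omega
      · exact .inr ⟨k, hk, hdec⟩
    · obtain rfl := hj.unique hj'
      exact .inl hskip
  · refine absurd ⟨hinv.notBot, fun R hR => ?_⟩ hns
    cases R <;> first | assumption | exact absurd rfl hR

end Runs

end Progress

end SCLEQ

namespace SCLEQ

/-! ### Learned clauses are not redundant, and regular runs terminate. -/

section Termination

variable {L : FirstOrder.Language.{u, v}} {V : Type w}

open FirstOrder.Language (Term)

variable {lt : L.Term V → L.Term V → Prop} {β : L.Term V} {M : Type (max u w)}
  [L.Structure M] {Γ : Trail L V} {a α : AnnLit L V} {N : Set (Clause L V)}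

/-! ### Learned clauses are not redundant -/

/-- For an irreducible literal nothing is to be rewritten. Propagate then keeps the original clause
as annotation, which the third regularity condition requires to be in `N ∪ U`. -/
theorem isReduction_leaf (hα : ∀ t ∈ α.gl.sides, Irreducible (conv lt (glits Γ)) t) :
    IsReduction lt Γ α [.leaf α.lit α.rest α.subst] := by
  have hleaf : IsLeafOf α (.leaf α.lit α.rest α.subst) := by
    refine ⟨Equiv.refl V, α.subst, ?_, fun x _ => rfl⟩
    simp [Lit.subst_var, Clause.subst_var]
  obtain ⟨b, l, r, hlit⟩ := α.lit.exists_mkLit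
  rw [AnnLit.gl, hlit, mkLit_subst] at hα
  refine ⟨⟨isChain_leaf (by simp) hleaf, _, rfl, b, l, r, l, r, hlit, hlit,
    ⟨.refl, hα _ (by simp)⟩, ⟨.refl, hα _ (by simp)⟩⟩, fun i hi hP => ?_⟩
  obtain rfl : i = 0 := by simpa using hi
  obtain ⟨-, I, hI, -⟩ := hP
  simp at hI

section Runs

variable {S : ℕ → State L V} {ρ : ℕ → Rule} {n : ℕ∞}

/-- The included instance of `E` is false in the current trail. If literals have been skipped, that
trail is a proper prefix of the one at the conflict, which has no false instances. Otherwise the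
conflict follows a decision `b`, and `E` could have propagated the complement of `b` instead. -/
theorem IsRegularRun.not_redundant [Infinite V] [Nonempty M] (hlt : IsDesired lt)
    (hN : ∀ C ∈ N, Clause.Valid M C) (hr : IsRegularRun lt N β S ρ n)
    (hng : ∀ i : ℕ, (i : ℕ∞) < n → ρ i ≠ .grow) {i : ℕ} (hi : (i : ℕ∞) < n)
    (hρ : ρ i = .backtrack) {D : Clause L V} {σ : Subst L V}
    (hst : (S i).status = .closure D σ) {E : Clause L V}
    (hE : E ∈ (S i).initial ∪ (S i).learned) {τ : Subst L V} (hτ : Clause.Grounds τ E) :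
    ¬ Clause.subst E τ ≤ Clause.subst D σ := by
  intro hle
  have hstep := hr.run.2 i hi
  rw [hρ] at hstep
  have hinv := hr.inv hlt hN hng i hi.le
  obtain ⟨-, hg, hf⟩ := hinv.closure D σ hst
  have hEf : CBFalse lt β (S i).trail (Clause.subst E τ) :=
    fun κ hκ => hf κ (Multiset.mem_of_le hle hκ)
  obtain ⟨j, hj, htop, hlearn, hcase⟩ := hr.run.exists_lastConflict i hi.le hst
  have hjn : (j : ℕ∞) < n := lt_trans (Nat.cast_lt.2 hj.1) hi
  have hinvj := hr.inv hlt hN hng j hjn.le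
  have hEj : E ∈ (S j).initial ∪ (S j).learned := by
    rwa [hinvj.initial, ← hinv.initial, ← hlearn]
  obtain ⟨hns, htr⟩ | ⟨-, hpre, hne⟩ := hcase
  swap
  · exact hinvj.noFalse _ hpre hne E hEj ⟨τ, hτ, hEf⟩
  have had : AfterDecide ρ j := (hr.skipOnce i hi hρ j hj).resolve_left hns
  obtain ⟨Γ, a, D', σ', ht, hst', ℓ', hℓ', hcomp⟩ := hr.backtrackAfterDecide i hi hρ j hj had
  rw [hst, Status.closure.injEq] at hst'
  obtain ⟨rfl, rfl⟩ := hst'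
  obtain ⟨m, b, hm, hb, hlearnm, hdec⟩ := hr.before_conflict hlt hN hng hjn hj.2.1 htop
  obtain ⟨m', hm', hρm⟩ := had
  obtain rfl : m' = m := by omega
  subst hm
  have hcd : CanDecide lt (S m') b := by
    obtain ⟨h, -⟩ | ⟨-, h⟩ := hdec
    · rw [hρm] at h
      cases h
    · exact h
  have htrail : (S m').trail = Γ ∧ b = a := by
    rw [htr, hb] at ht
    obtain ⟨h1, h2⟩ := List.append_inj' ht rfl
    exact ⟨h1, by simpa using h2⟩
  obtain ⟨htrail, rfl⟩ := htrail
  have hmn : (m' : ℕ∞) < n := lt_trans (Nat.cast_lt.2 (Nat.lt_succ_self m')) hjn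
  have hinvm := hr.inv hlt hN hng m' hmn.le
  obtain ⟨hgood, -⟩ := hcd.good hlt hinvm
  rw [htrail] at hgood
  have hund : ¬ Defined (glits Γ) b.gl.comp := by
    rw [defined_comp]
    exact hgood.undef
  obtain ⟨D₀, ℓ, rfl, hD₀⟩ : ∃ D₀ ℓ, D = D₀ + {ℓ} ∧
      ∀ κ ∈ Clause.subst D₀ σ, Defined (glits Γ) κ := by
    generalize hs : S i = s at *
    generalize S (i + 1) = s' at *
    cases hstep with
    | @backtrack _ Γ₀ Γ' K D₀ ℓ₀ σ₀ k k' hst'' hΓ hl hk =>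
      rw [hst, Status.closure.injEq] at hst''
      obtain ⟨rfl, rfl⟩ := hst''
      refine ⟨D₀, ℓ₀, rfl, hinv.defined_of_clauseLevel ht (fun κ hκ => hf κ ?_) hl hk⟩
      rw [Clause.subst_add]
      exact Multiset.mem_add.2 (.inl hκ)
  rw [Clause.subst_add, Clause.subst_singleton] at hle hf
  have hℓ : ℓ.subst σ = b.gl.comp := by
    obtain h | h := Multiset.mem_add.1 hℓ'
    · exact absurd (hcomp ▸ hD₀ _ (Multiset.mem_map_of_mem _ h)) hund
    · rwa [← Multiset.mem_singleton.1 h]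
  have hfalse : ∀ κ ∈ Clause.subst D₀ σ, BFalse lt β Γ κ := by
    intro κ hκ
    have := hf κ (Multiset.mem_add.2 (.inl hκ))
    refine ⟨this.1, hinv.good.entails_comp_of_defined ?_ (hD₀ κ hκ) this.2⟩
    rw [ht]
    exact glits_mono (List.subset_append_left _ _)
  -- `Γ` had no false instance, so some literal of the instance becomes false only with `b`; among
  -- the literals of the closure this can only be the complement of `b`.
  obtain ⟨κ, hκ, hnκ⟩ : ∃ κ ∈ Clause.subst E τ, ¬ BFalse lt β Γ κ := by
    by_contra hno
    push Not at hno
    refine hinvj.noFalse Γ ?_ ?_ E hEj ⟨τ, hτ, hno⟩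
    · rw [hb, htrail]
      exact List.prefix_append _ _
    · rw [hb, htrail]
      simp
  have hκℓ : κ = b.gl.comp := by
    obtain h | h := Multiset.mem_add.1 (Multiset.mem_of_le hle hκ)
    · exact absurd (hfalse κ h) hnκ
    · rw [Multiset.mem_singleton.1 h, hℓ]
  obtain ⟨ℓE, hℓE, hℓEκ⟩ := Multiset.mem_map.1 hκ
  obtain ⟨E₀, rfl⟩ := Multiset.exists_cons_of_mem hℓE
  have hE₀ : Clause.subst E₀ τ ≤ Clause.subst D₀ σ := by
    rw [Clause.subst_cons, hℓEκ, hκℓ, hℓ, ← Multiset.singleton_add, add_comm] at hle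
    exact le_of_add_le_add_right hle
  -- Propagate needs an irreducible grounding. The sides of `b` are normal forms, so normalising `τ`
  -- leaves the literal to be propagated unchanged.
  obtain ⟨τ', h1, h2, h3, h4⟩ := exists_irreducibleSubst hlt (glits Γ) hτ
  have hτ' : ℓE.subst τ' = b.gl.comp := by
    rw [← hκℓ, ← hℓEκ]
    refine Lit.subst_congr fun x hx => h4 x (Clause.mem_vars_cons.2 (.inl hx)) ?_
    have hsides : ∀ t ∈ (ℓE.subst τ).sides, Irreducible (conv lt (glits Γ)) t := by
      rw [hℓEκ, hκℓ]
      exact hgood.irred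
    obtain ⟨c, s, t, rfl⟩ := ℓE.exists_mkLit
    rw [mkLit_subst] at hsides
    obtain hx | hx := mem_mkLit_vars.1 hx
    · exact (groundOriented_conv (lt := lt) _).irreducible_of_subst (hsides _ (by simp)) hx
    · exact (groundOriented_conv (lt := lt) _).irreducible_of_subst (hsides _ (by simp)) hx
  have hE₀f : ∀ κ ∈ Clause.subst E₀ τ', BFalse lt β Γ κ := by
    intro κ hκ
    obtain ⟨ℓ₀, hℓ₀, rfl⟩ := Multiset.mem_map.1 hκ
    exact (h3 ℓ₀ (Multiset.mem_cons_of_mem hℓ₀)).bFalse hlt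
      (hfalse _ (Multiset.mem_of_le hE₀ (Multiset.mem_map_of_mem _ hℓ₀)))
  have hbelow : litBelow lt β b.gl.comp := litBelow_comp.2 hgood.gl_below
  have hEm : ℓE ::ₘ E₀ ∈ (S m').initial ∪ (S m').learned := by
    rwa [hinvm.initial, ← hinvj.initial, ← hlearnm]
  obtain ⟨c, s, t, hℓEst⟩ := ℓE.exists_mkLit
  refine hr.noOppositeDecision m' hmn hρm b hb ⟨⟨ℓE, E₀, τ', (S m').level⟩, ?_, hEm, ?_⟩
  · subst hℓEst
    have hsum : E₀ + (0 : Multiset (L.Term V × L.Term V)).map (fun e => mkLit c e.1 e.2) +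
        {mkLit c s t} = mkLit c s t ::ₘ E₀ := by
      rw [Multiset.map_zero, add_zero, add_comm, Multiset.singleton_add]
    -- Nothing is factored, so `C₁` is empty, `μ` is the identity, and the chain is the annotation
    -- itself.
    refine ⟨hcd.1, E₀, 0, c, s, t, τ', fun x => .var x, [.leaf (mkLit c s t) E₀ τ'], _, ?_, ?_, ?_,
      by simp, ?_, ?_, ?_, ?_, ?_, rfl, rfl⟩
    · rwa [hsum]
    · rwa [hsum]
    · rw [htrail]
      exact fun κ hκ => (hE₀f κ hκ).2
    · simpa using isMGU_empty
    · rw [hτ', hinvm.bound, htrail, hbelow.bUndef_iff hlt]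
      exact hund
    · rw [Clause.subst_var, hinvm.bound, clauseBelow_iff, Clause.subst_add, Clause.subst_singleton,
        hτ']
      intro κ hκ
      obtain hκ | hκ := Multiset.mem_add.1 hκ
      · exact (hE₀f κ hκ).1
      · exact Multiset.mem_singleton.1 hκ ▸ hbelow
    · rwa [htrail]
    · have := isReduction_leaf (lt := lt) (Γ := (S m').trail)
        (α := ⟨mkLit c s t, E₀, τ', (S m').level⟩) (by
          rw [AnnLit.gl, hτ', htrail]
          exact hgood.irred)
      rwa [Lit.subst_var, Clause.subst_var]
  · rw [show AnnLit.gl (⟨ℓE, E₀, τ', (S m').level⟩ : AnnLit L V) = b.gl.comp from hτ',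
      Lit.comp_comp]

/-! ### Termination -/

/-- Dickson's lemma for multisets over a finite set. -/
theorem exists_le_of_finite {α : Type*} {F : Set α} (hF : F.Finite) (f : ℕ → Multiset α)
    (hf : ∀ i, ∀ x ∈ f i, x ∈ F) : ∃ i j, i < j ∧ f i ≤ f j := by
  classical
  have : Finite F := hF
  obtain ⟨i, j, hij, h⟩ := wellQuasiOrdered_le fun i => fun x : F => (f i).count x.1
  refine ⟨i, j, hij, Multiset.le_iff_count.2 fun x => ?_⟩
  by_cases hx : x ∈ F
  · exact h ⟨x, hx⟩
  · rw [Multiset.count_eq_zero_of_notMem fun h => hx (hf i x h)]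
    exact Nat.zero_le _

theorem Step.learned_subset {S T : State L V} {R : Rule} (h : Step lt R S T) :
    S.learned ⊆ T.learned := by
  cases h with
  | backtrack => exact Set.subset_union_left
  | _ => exact subset_rfl

/-- Each literal is undefined when added, so the trail has no repetitions. -/
theorem GoodTrail.length_le (h : GoodTrail lt β M Γ) (hlt : IsDesired lt) (hβ : IsGroundTerm β) :
    Γ.length ≤ (boundedLits lt β : Set (Lit L V)).ncard := by
  classical
  have hnd : (Γ.map AnnLit.gl).Nodup := by
    induction Γ using List.reverseRecOn with
    | nil => simp
    | append_singleton Γ b ih =>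
      obtain ⟨h1, h2⟩ := goodTrail_concat.1 h
      rw [List.map_append, List.map_singleton]
      refine List.Nodup.append (ih h1) (by simp) ?_
      intro x hx hx'
      rw [List.mem_singleton.1 hx'] at hx
      obtain ⟨c, hc, he⟩ := List.mem_map.1 hx
      exact h2.undef (.inl (entails_of_mem ⟨c, hc, he⟩))
  have hfin := boundedLits_finite (lt := lt) hlt hβ
  rw [← List.length_map (f := AnnLit.gl), ← List.toFinset_card_of_nodup hnd,
    ← Set.ncard_coe_finset]
  refine Set.ncard_le_ncard ?_ hfin
  intro x hx
  obtain ⟨c, hc, rfl⟩ := List.mem_map.1 (List.mem_toFinset.1 hx)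
  exact h.gl_mem_boundedLits hc

/-- Infinitely many applications would give an infinite sequence of ground closures over finitely
many literals. By Dickson's lemma an earlier one is included in a later one, although its clause has
been learned by then. -/
theorem IsRegularRun.finite_backtracks [Infinite V] [Nonempty M] (hlt : IsDesired lt)
    (hβ : IsGroundTerm β) (hN : ∀ C ∈ N, Clause.Valid M C) (hr : IsRegularRun lt N β S ρ ⊤)
    (hng : ∀ i : ℕ, ρ i ≠ .grow) : ∃ t, ∀ i ≥ t, ρ i ≠ .backtrack := by
  by_contra hinf
  push Not at hinf
  have hlearn : ∀ {i j}, i ≤ j → (S i).learned ⊆ (S j).learned := by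
    intro i j hij
    induction hij with
    | refl => exact subset_rfl
    | step _ ih => exact ih.trans (hr.run.2 _ (ENat.natCast_lt_top _)).learned_subset
  have hD : ∀ i, ρ i = .backtrack → ∃ D σ, (S i).status = .closure D σ ∧
      D ∈ (S (i + 1)).learned := by
    intro i hi
    have hstep := hr.run.2 i (ENat.natCast_lt_top i)
    rw [hi] at hstep
    generalize S i = s at *
    generalize S (i + 1) = s' at *
    cases hstep with
    | backtrack hst => exact ⟨_, _, hst, by simp⟩
  choose next hnext hback using hinf
  let e : ℕ → ℕ := fun k => Nat.rec (next 0) (fun _ r => next (r + 1)) k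
  have he : ∀ k, ρ (e k) = .backtrack := by
    intro k
    cases k with
    | zero => exact hback 0
    | succ k => exact hback (e k + 1)
  have hmono : StrictMono e := strictMono_nat_of_lt_succ fun k => hnext (e k + 1)
  choose D σ hst hmem using fun k => hD (e k) (he k)
  have hinv := fun i => hr.inv hlt hN (fun i _ => hng i) i le_top
  obtain ⟨k, k', hkk, hle⟩ := exists_le_of_finite (boundedLits_finite hlt hβ)
    (fun k => Clause.subst (D k) (σ k)) fun k κ hκ =>
      ⟨((hinv (e k)).closure _ _ (hst k)).2.1 κ hκ,
        (((hinv (e k)).closure _ _ (hst k)).2.2 κ hκ).1⟩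
  exact hr.not_redundant hlt hN (fun i _ => hng i) (ENat.natCast_lt_top _) (he k') (hst k')
    (.inr (hlearn (hmono hkk) (hmem k))) ((hinv (e k)).closure _ _ (hst k)).2.1 hle

open Classical in
/-- The measure that decreases during conflict resolution. -/
noncomputable def conflictRank (S : State L V) :
    ℕ × Multiset (ℕ × ℕ × Multiset (L.Term V)) :=
  (S.trail.length, match S.status with
    | .closure D σ => (Clause.subst D σ).map (trailRank S.trail)
    | _ => 0)

/-- Skip shortens the trail. The other rules keep it and lower the multiset of ranks:
Explore-Refutation by its side condition, the remaining ones by deleting a literal. -/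
theorem Step.conflictRank_lt {S T : State L V} {R : Rule} (hlt : IsDesired lt)
    (hS : Inv lt N β M S) {D : Clause L V} {σ : Subst L V} (hst : S.status = .closure D σ)
    (hR : R ≠ .backtrack) (h : Step lt R S T) :
    (∃ D σ, T.status = .closure D σ) ∧
      Prod.Lex (· < ·) (MulLT (RankLT lt)) (conflictRank T) (conflictRank S) := by
  have sub : ∀ {A B : Multiset (Lit L V)} {ℓ : Lit L V}, B = A + {ℓ} →
      MulLT (RankLT lt) (A.map (trailRank S.trail)) (B.map (trailRank S.trail)) := by
    rintro A B ℓ rfl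
    exact ⟨A.map (trailRank S.trail), 0, {trailRank S.trail ℓ}, by simp, by simp, by simp, by simp⟩
  cases h with
  | propagate h => simp [h.1] at hst
  | decide h => simp [h.1] at hst
  | conflict_bot h => simp [h] at hst
  | conflict_closure h => simp [h] at hst
  | skip hst' hΓ =>
    refine ⟨⟨_, _, hst'⟩, Prod.Lex.left _ _ ?_⟩
    rw [hΓ]
    simp
  | @exploreRefutation _ D' ℓ σ' P I hst' hmax hdef hP hI hlt' hf =>
    refine ⟨⟨_, _, rfl⟩, ?_⟩
    simp only [conflictRank, hst']
    refine Prod.Lex.right _ ?_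
    rw [hS.bound] at hlt'
    obtain ⟨-, hg, hf'⟩ := hS.closure _ _ hst'
    obtain ⟨X, Y, Z, hZ, e1, e2, hY⟩ := hlt'
    rw [e1, e2]
    refine ⟨X.map _, Y.map _, Z.map _, by simpa using hZ, Multiset.map_add _ _ _,
      Multiset.map_add _ _ _, fun y hy => ?_⟩
    obtain ⟨y, hy', rfl⟩ := Multiset.mem_map.1 hy
    obtain ⟨z, hz, hyz⟩ := hY y hy'
    refine ⟨_, Multiset.mem_map_of_mem _ hz, hyz.rank_lt hS.good ?_⟩
    have := hf' z (by rw [e2]; exact Multiset.mem_add.2 (.inr hz))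
    exact (this.1.bDef_iff hlt).2 (.inr this.2)
  | @factorize _ D' b s t s' t' σ' μ hst' hs ht hμ =>
    refine ⟨⟨_, _, rfl⟩, ?_⟩
    simp only [conflictRank, hst']
    refine Prod.Lex.right _ (sub (ℓ := (mkLit b s' t').subst σ') ?_)
    rw [hμ.clause (by simp [Unifies, hs, ht]), Clause.subst_add _ {mkLit b s' t'},
      Clause.subst_singleton]
  | @equalityResolution _ D' s s' σ' μ hst' hs hμ =>
    refine ⟨⟨_, _, rfl⟩, ?_⟩
    simp only [conflictRank, hst']
    refine Prod.Lex.right _ (sub (ℓ := (mkLit false s s').subst σ') ?_)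
    rw [hμ.clause (by simp [Unifies, hs]), Clause.subst_add, Clause.subst_singleton]
  | backtrack => exact absurd rfl hR
  | grow h => simp [h] at hst

theorem Step.trail_length_of_top {S T : State L V} {R : Rule} (h : Step lt R S T)
    (hR : R ≠ .backtrack) (hR' : R ≠ .grow) (hS : S.status = .top) (hT : T.status = .top) :
    T.trail.length = S.trail.length + 1 := by
  cases h with
  | propagate h => simp
  | decide h => simp
  | conflict_bot => simp at hT
  | conflict_closure => simp at hT
  | skip h => simp [h] at hS
  | exploreRefutation => simp at hT
  | factorize => simp at hT
  | equalityResolution => simp at hT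
  | backtrack => exact absurd rfl hR
  | grow => exact absurd rfl hR'

theorem Inv.status_cases {S : State L V} (hS : Inv lt N β M S) :
    S.status = .top ∨ ∃ D σ, S.status = .closure D σ := by
  have := hS.notBot
  cases h : S.status with
  | top => exact .inl rfl
  | bot => exact absurd h this
  | closure D σ => exact .inr ⟨D, σ, rfl⟩

/-- There is no infinite regular run without Grow. -/
theorem IsRegularRun.ne_top [Infinite V] [Nonempty M] (hlt : IsDesired lt)
    (hβ : IsGroundTerm β) (hN : ∀ C ∈ N, Clause.Valid M C)
    (hng : ∀ i : ℕ, ρ i ≠ .grow) : ¬ IsRegularRun lt N β S ρ ⊤ := by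
  intro hr
  have hinv := fun i => hr.inv hlt hN (fun i _ => hng i) i le_top
  have hstep := fun i => hr.run.2 i (ENat.natCast_lt_top i)
  obtain ⟨t, ht⟩ := hr.finite_backtracks hlt hβ hN hng
  -- Backtrack is the only way out of a conflict state. After its last application the run either
  -- enters one and stays, lowering `conflictRank`, or appends a literal in every step.
  by_cases hcl : ∃ t' ≥ t, ∃ D σ, (S t').status = .closure D σ
  · obtain ⟨t', htt, hst⟩ := hcl
    have hclosed : ∀ k, ∃ D σ, (S (t' + k)).status = .closure D σ := by
      intro k
      induction k with
      | zero => exact hst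
      | succ k ih =>
        obtain ⟨D, σ, h⟩ := ih
        exact ((hstep (t' + k)).conflictRank_lt hlt (hinv _) h (ht _ (by omega))).1
    have hwf : WellFounded (Prod.Lex (· < ·) (MulLT (RankLT lt))) :=
      WellFounded.prod_lex (α := ℕ) wellFounded_lt (wellFounded_mulLT (wellFounded_rankLT hlt))
    obtain ⟨_, ⟨k, rfl⟩, hmin⟩ := hwf.has_min
      (Set.range fun k => conflictRank (S (t' + k))) ⟨_, 0, rfl⟩
    obtain ⟨D, σ, h⟩ := hclosed k
    exact hmin _ ⟨k + 1, rfl⟩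
      ((hstep (t' + k)).conflictRank_lt hlt (hinv _) h (ht _ (by omega))).2
  · push Not at hcl
    have htop : ∀ k, (S (t + k)).status = .top := fun k =>
      (hinv _).status_cases.resolve_right fun ⟨D, σ, h⟩ => hcl (t + k) (by omega) D σ h
    have hlen : ∀ k, k ≤ (S (t + k)).trail.length := by
      intro k
      induction k with
      | zero => exact Nat.zero_le _
      | succ k ih =>
        have := (hstep (t + k)).trail_length_of_top (ht _ (by omega)) (hng _) (htop k)
          (htop (k + 1))
        rw [← add_assoc, this]
        omega
    have h1 := hlen ((boundedLits lt β : Set (Lit L V)).ncard + 1)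
    have h2 := (hinv (t + ((boundedLits lt β : Set (Lit L V)).ncard + 1))).good.length_le hlt hβ
    omega

end Runs

end Termination

end SCLEQ

theorem mainTheorem8 {L : FirstOrder.Language.{u, v}} [L.IsAlgebraic] {V : Type w} [Infinite V]
    (lt : L.Term V → L.Term V → Prop) (hlt : SCLEQ.IsDesired lt)
    (N : Set (SCLEQ.Clause L V)) (hN : SCLEQ.Satisfiable N)
    (β : L.Term V) (hβ : SCLEQ.IsGroundTerm β)
    (S : ℕ → SCLEQ.State L V) (ρ : ℕ → SCLEQ.Rule) (n : ℕ∞)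
    (hrun : SCLEQ.IsMaximalRegularRun lt N β S ρ n) :
    ∃ m : ℕ, n = m ∧ SCLEQ.IsStuck lt (S m) := by
  obtain ⟨M, _, _, hM⟩ := hN
  obtain rfl | hn := eq_or_ne n ⊤
  · exact absurd hrun.regular (SCLEQ.IsRegularRun.ne_top (M := M) hlt hβ hM
      fun i => hrun.noGrow i (ENat.natCast_lt_top i))
  · obtain ⟨m, rfl⟩ := ENat.ne_top_iff_exists.1 hn
    refine ⟨m, rfl, ?_⟩
    by_contra hns
    exact hrun.maximal m rfl
      (hrun.regular.exists_continuation (M := M) hlt hM hrun.noGrow hns)
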